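/- Let $k$ be a perfect field of characteristic $p>0$, let $X$ be a smooth variety over $k$ (smooth, separated and of finite type), and let $D\subseteq X$ be a normal hypersurface (a closed subscheme whose ideal is locally generated by one nonzerodivisor, and whose local rings are integrally closed domains) of pure dimension $d$, that is, $\dim\mathcal O_{D,x}=d$ at every closed point $x\in D$. For $j\ge 0$ let $\Omega^j_D=\Omega^j_{D/k}$ be the sheaf of Kähler differential forms, $F$ the absolute Frobenius, $B\Omega^j_D=\operatorname{im}(d\colon F_*\Omega^{j-1}_D\to F_*\Omega^j_D)$ (with $B\Omega^0_D=0$), and let $$C^{-1}\colon \Omega^j_D\to \frac{F_*\Omega^j_D}{B\Omega^j_D},\qquad a\,db_1\wedge\dots\wedge db_j\mapsto a^p\,b_1^{p-1}db_1\wedge\dots\wedge b_j^{p-1}db_j,$$ be the $\mathcal O_D$-linear inverse Cartier operator. For a closed point $\mathfrak m\in D$ let $H^i_{\mathfrak m}$ denote local cohomology at $\mathfrak m$, with $H^i_{\mathfrak m}=0$ for $i<0$. Let $\operatorname{codim}_D\operatorname{Sing}(D)$ be the infimum of $\dim\mathcal O_{D,x}$ over the points $x\in D$ at which $\mathcal O_{D,x}$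 is not regular ($\infty$ if there are none). Let $m>0$ be an integer, and consider the condition $$(\ast)\qquad C^{-1}\colon H^{d-m}_{\mathfrak m}(\Omega^m_D)\to H^{d-m}_{\mathfrak m}\!\left(\frac{F_*\Omega^m_D}{B\Omega^m_D}\right)\ \text{ is injective at every closed point } \mathfrak m\in D.$$ (1) If $m\le \operatorname{codim}_D\operatorname{Sing}(D)-2$ and $(\ast)$ holds, then $$C^{-1}\colon H^{i}_{\mathfrak m}(\Omega^j_D)\to H^{i}_{\mathfrak m}\!\left(\frac{F_*\Omega^j_D}{B\Omega^j_D}\right)$$ is injective at every closed point $\mathfrak m\in D$ for all integers $i,j\ge 0$ with $j\le m$ and $i+j\le d$. (2) Call $D$ $m$-$F$-injective if $\operatorname{codim}_D\operatorname{Sing}(D)\ge 2m+1$ and $C^{-1}\colon H^{i}_{\mathfrak m}(\Omega^j_D)\to H^{i}_{\mathfrak m}(F_*\Omega^j_D/B\Omega^j_D)$ is injective at every closed point $\mathfrak m\in D$ for all $i,j\ge 0$ with $j\le m$ and $i+j\le d$. Then $D$ is $m$-$F$-injective if and only if $\operatorname{codim}_D\operatorname{Sing}(D)\ge 2m+1$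 and $(\ast)$ holds. -/

import Mathlib

open CategoryTheory AlgebraicGeometry IsLocalRing

universe u

noncomputable section

namespace CartierForms

/-! ### The de Rham complex of an algebra -/

section DeRham

variable (k A : Type u) [CommRing k] [CommRing A] [Algebra k A]

/-- The algebra `Ω^•` of Kähler differential forms of `A` over `k`. Its degree `n` part `Ω^n`
is `⋀[A]^n Ω[A⁄k]`. -/
abbrev Forms : Type u := ExteriorAlgebra A (Ω[A⁄k])

variable {A}

/-- The exact one-form `D a`, as an element of the algebra of forms. -/
def dform (a : A) : Forms k A := ExteriorAlgebra.ι A (KaehlerDifferential.D k A a)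

variable {k}

/-- The grade involution, `ω ↦ (-1)^n ω` for `ω` of degree `n`. -/
abbrev sgn : Forms k A →ₐ[A] Forms k A := CliffordAlgebra.involute

lemma sgn_ι (w : Ω[A⁄k]) :
    sgn (ExteriorAlgebra.ι A w : Forms k A) = - ExteriorAlgebra.ι A w :=
  CliffordAlgebra.involute_ι _

lemma ι_mul_comm (w : Ω[A⁄k]) (x : Forms k A) :
    ExteriorAlgebra.ι A w * x = sgn x * ExteriorAlgebra.ι A w := by
  induction x using CliffordAlgebra.induction with
  | algebraMap r => rw [AlgHom.commutes, Algebra.commutes]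
  | ι v =>
    have h := ExteriorAlgebra.ι_add_mul_swap (R := A) w v
    have h2 : sgn (CliffordAlgebra.ι (0 : QuadraticForm A (Ω[A⁄k])) v) =
      - ExteriorAlgebra.ι A v := sgn_ι v
    rw [h2, neg_mul]
    exact eq_neg_of_add_eq_zero_left h
  | mul a b ha hb => rw [← mul_assoc, ha, mul_assoc, hb, map_mul, mul_assoc]
  | add a b ha hb => rw [mul_add, ha, hb, map_add, add_mul]

variable (k A)

/-- The ring of matrices `!![σ x, y; 0, x]` with `x`, `y` forms and `σ` the grade involution.
It is used to construct the exterior derivative: additive maps `d` with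
`d (x * y) = d x * y + σ x * d y` are the same as ring homomorphisms `x ↦ !![σ x, d x; 0, x]`. -/
def jetSubring : Subring (Matrix (Fin 2) (Fin 2) (Forms k A)) where
  carrier := {M | M 1 0 = 0 ∧ M 0 0 = sgn (M 1 1)}
  mul_mem' := by
    rintro M N ⟨h1, h2⟩ ⟨h3, h4⟩
    constructor
    · simp [Matrix.mul_apply, Fin.sum_univ_two, h1, h3]
    · simp [Matrix.mul_apply, Fin.sum_univ_two, h1, h2, h3, h4]
  one_mem' := by constructor <;> simp
  add_mem' := by
    rintro M N ⟨h1, h2⟩ ⟨h3, h4⟩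
    constructor
    · simp [h1, h3]
    · simp [h2, h4]
  zero_mem' := by constructor <;> simp
  neg_mem' := by
    rintro M ⟨h1, h2⟩
    constructor
    · simp [h1]
    · simp [h2]

/-- The ring of matrices `!![σ x, y; 0, x]`. The scalar `a : A` acts on it as
`!![a, D a; 0, a]`. -/
def jet : Type u := jetSubring k A

instance : Ring (jet k A) := inferInstanceAs (Ring (jetSubring k A))

variable {k A}

/-- The element `!![σ x, y; 0, x]`. -/
def jet.mk (x y : Forms k A) : jet k A :=
  ⟨!![sgn x, y; 0, x], by constructor <;> simp⟩

lemma jet.mk_mul (x y x' y' : Forms k A) :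
    jet.mk x y * jet.mk x' y' = jet.mk (x * x') (sgn x * y' + y * x') := by
  apply Subtype.ext
  change !![sgn x, y; 0, x] * !![sgn x', y'; 0, x'] = _
  rw [Matrix.mul_fin_two]
  simp [jet.mk]

lemma jet.mk_add (x y x' y' : Forms k A) :
    jet.mk x y + jet.mk x' y' = jet.mk (x + x') (y + y') := by
  apply Subtype.ext
  change !![sgn x, y; 0, x] + !![sgn x', y'; 0, x'] = _
  simp [jet.mk]

lemma jet.mk_zero : (jet.mk 0 0 : jet k A) = 0 := by
  apply Subtype.ext
  change !![sgn 0, 0; 0, 0] = (0 : Matrix (Fin 2) (Fin 2) (Forms k A))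
  ext i j; fin_cases i <;> fin_cases j <;> simp

lemma jet.mk_one : (jet.mk 1 0 : jet k A) = 1 := by
  apply Subtype.ext
  change !![sgn 1, 0; 0, 1] = (1 : Matrix (Fin 2) (Fin 2) (Forms k A))
  rw [Matrix.one_fin_two]; simp

variable (k A) in
/-- The projection `!![σ x, y; 0, x] ↦ x`. -/
def jet.fst : jet k A →+* Forms k A where
  toFun M := M.1 1 1
  map_one' := by change (1 : Matrix (Fin 2) (Fin 2) (Forms k A)) 1 1 = 1; simp
  map_mul' M N := by
    change (M.1 * N.1) 1 1 = _
    simp [Matrix.mul_apply, Fin.sum_univ_two, M.2.1]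
  map_zero' := rfl
  map_add' _ _ := rfl

variable (k A) in
/-- The projection `!![σ x, y; 0, x] ↦ y`. -/
def jet.snd : jet k A →+ Forms k A where
  toFun M := M.1 0 1
  map_zero' := rfl
  map_add' _ _ := rfl

@[simp] lemma jet.fst_mk (x y : Forms k A) : jet.fst k A (jet.mk x y) = x := rfl
@[simp] lemma jet.snd_mk (x y : Forms k A) : jet.snd k A (jet.mk x y) = y := rfl

lemma jet.eta (M : jet k A) : M = jet.mk (jet.fst k A M) (jet.snd k A M) := by
  apply Subtype.ext
  change M.1 = !![sgn (M.1 1 1), M.1 0 1; 0, M.1 1 1]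
  rw [← M.2.2, ← M.2.1]
  exact Matrix.eta_fin_two M.1

lemma jet.snd_mul (M N : jet k A) : jet.snd k A (M * N) =
    jet.snd k A M * jet.fst k A N + sgn (jet.fst k A M) * jet.snd k A N := by
  conv_lhs => rw [jet.eta M, jet.eta N, jet.mk_mul, jet.snd_mk]
  rw [add_comm]

lemma dform_mul (a b : A) : dform k (a * b) = a • dform k b + b • dform k a := by
  simp [dform]

lemma dform_add (a b : A) : dform k (a + b) = dform k a + dform k b := by
  simp [dform]

instance : Algebra A (jet k A) where
  smul a M := jet.mk (algebraMap A _ a) (dform k a) * M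
  algebraMap :=
    { toFun := fun a => jet.mk (algebraMap A _ a) (dform k a)
      map_one' := by simp [dform, jet.mk_one]
      map_mul' := fun a b => by
        rw [jet.mk_mul, map_mul, dform_mul, AlgHom.commutes, Algebra.smul_def, Algebra.smul_def,
          Algebra.commutes b]
      map_zero' := by simp [dform, jet.mk_zero]
      map_add' := fun a b => by rw [jet.mk_add, map_add, dform_add] }
  commutes' a M := by
    rw [jet.eta M]
    change jet.mk _ _ * jet.mk _ _ = jet.mk _ _ * jet.mk _ _
    rw [jet.mk_mul, jet.mk_mul, AlgHom.commutes, Algebra.commutes, Algebra.commutes, dform,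
      ι_mul_comm, add_comm]
  smul_def' a M := rfl

lemma jet.smul_mk (a : A) (x y : Forms k A) :
    a • (jet.mk x y : jet k A) = jet.mk (a • x) (a • y + dform k a * x) := by
  change jet.mk _ _ * jet.mk _ _ = _
  rw [jet.mk_mul, AlgHom.commutes, Algebra.smul_def, Algebra.smul_def]

lemma jet.fst_smul (a : A) (M : jet k A) : jet.fst k A (a • M) = a • jet.fst k A M := by
  conv_lhs => rw [jet.eta M, jet.smul_mk, jet.fst_mk]

/-- `k` acts on `jet k A` through `A`. -/
instance : Algebra k (jet k A) := Algebra.compHom _ (algebraMap k A)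

instance : IsScalarTower k A (jet k A) := IsScalarTower.of_algebraMap_eq fun _ => rfl

variable (k A)

/-- The derivation `b ↦ !![-D b, 0; 0, D b]`, that is, the requirement `d (D b) = 0`. -/
def jetDerivation : Derivation k A (jet k A) :=
  Derivation.mk'
    { toFun := fun b => jet.mk (dform k b) 0
      map_add' := fun a b => by rw [jet.mk_add, dform_add, add_zero]
      map_smul' := fun c b => by
        rw [RingHom.id_apply, ← algebraMap_smul A c (jet.mk _ _ : jet k A), jet.smul_mk]
        have h : dform k (algebraMap k A c) = 0 := by simp [dform]
        rw [h, zero_mul, smul_zero, add_zero, Algebra.smul_def, dform_mul, h, smul_zero,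
          add_zero] }
    (fun a b => by
      change jet.mk _ _ = a • jet.mk _ _ + b • jet.mk _ _
      rw [jet.smul_mk, jet.smul_mk, jet.mk_add, dform_mul]
      congr 1
      simp [dform])

/-- The linear map `ω ↦ !![-ω, d ω; 0, ω]` on one-forms. -/
def jetOneForm : Ω[A⁄k] →ₗ[A] jet k A := (jetDerivation k A).liftKaehlerDifferential

lemma jetOneForm_D (b : A) :
    jetOneForm k A (KaehlerDifferential.D k A b) = jet.mk (dform k b) 0 :=
  Derivation.liftKaehlerDifferential_comp_D _ _

lemma range_D_induction {P : Ω[A⁄k] → Prop} (w : Ω[A⁄k])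
    (smul : ∀ a b : A, P (a • KaehlerDifferential.D k A b))
    (add : ∀ x y, P x → P y → P (x + y)) : P w := by
  have hw : w ∈ Submodule.span A (Set.range (KaehlerDifferential.D k A)) := by
    rw [KaehlerDifferential.span_range_derivation]; trivial
  induction hw using Submodule.closure_induction with
  | zero => simpa using smul 0 0
  | add x y _ _ hx hy => exact add x y hx hy
  | smul_mem a x hx => obtain ⟨b, rfl⟩ := hx; exact smul a b

lemma fst_jetOneForm (w : Ω[A⁄k]) : jet.fst k A (jetOneForm k A w) = ExteriorAlgebra.ι A w := by
  induction w using range_D_induction with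
  | smul a b => rw [map_smul, jetOneForm_D, jet.fst_smul, jet.fst_mk, map_smul]; rfl
  | add x y hx hy => rw [map_add, map_add, hx, hy, map_add]

lemma snd_jetOneForm_smul_D (a b : A) :
    jet.snd k A (jetOneForm k A (a • KaehlerDifferential.D k A b)) = dform k a * dform k b := by
  rw [map_smul, jetOneForm_D, jet.smul_mk, jet.snd_mk, smul_zero, zero_add]

lemma snd_jetOneForm_mem (w : Ω[A⁄k]) :
    jet.snd k A (jetOneForm k A w) ∈ ⋀[A]^2 (Ω[A⁄k]) := by
  induction w using range_D_induction with
  | smul a b =>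
    rw [snd_jetOneForm_smul_D, ExteriorAlgebra.exteriorPower, pow_two]
    exact Submodule.mul_mem_mul ⟨_, rfl⟩ ⟨_, rfl⟩
  | add x y hx hy => rw [map_add, map_add]; exact add_mem hx hy

lemma sgn_eq_self_of_mem_two {x : Forms k A} (hx : x ∈ ⋀[A]^2 (Ω[A⁄k])) : sgn x = x := by
  rw [ExteriorAlgebra.exteriorPower, pow_two] at hx
  induction hx using Submodule.mul_induction_on' with
  | mem_mul_mem m hm n hn =>
    obtain ⟨m, rfl⟩ := hm
    obtain ⟨n, rfl⟩ := hn
    rw [map_mul, sgn_ι, sgn_ι, neg_mul_neg]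
  | add x _ y _ hx hy => rw [map_add, hx, hy]

lemma jetOneForm_sq (w : Ω[A⁄k]) : jetOneForm k A w * jetOneForm k A w = 0 := by
  rw [jet.eta (jetOneForm k A w), jet.mk_mul, fst_jetOneForm, ExteriorAlgebra.ι_sq_zero, sgn_ι,
    neg_mul, ι_mul_comm, sgn_eq_self_of_mem_two k A (snd_jetOneForm_mem k A w), neg_add_cancel,
    jet.mk_zero]

/-- The algebra homomorphism `ω ↦ !![σ ω, d ω; 0, ω]`. -/
def jetHom : Forms k A →ₐ[A] jet k A :=
  ExteriorAlgebra.lift A ⟨jetOneForm k A, jetOneForm_sq k A⟩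

lemma jetHom_ι (w : Ω[A⁄k]) : jetHom k A (ExteriorAlgebra.ι A w) = jetOneForm k A w :=
  ExteriorAlgebra.lift_ι_apply A _ _ w

/-- The exterior derivative on the algebra of forms. By the lemmas below it is the additive map
with `d a = D a`, `d (D a) = 0` and `d (x * y) = d x * y + (-1)^n x * d y` for `x` of degree
`n`. -/
def extDeriv : Forms k A →+ Forms k A :=
  (jet.snd k A).comp (jetHom k A).toRingHom.toAddMonoidHom

lemma extDeriv_apply (x : Forms k A) : extDeriv k A x = jet.snd k A (jetHom k A x) := rfl

lemma fst_jetHom (x : Forms k A) : jet.fst k A (jetHom k A x) = x := by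
  induction x using CliffordAlgebra.induction with
  | algebraMap r => rw [AlgHom.commutes]; rfl
  | ι w =>
    have := jetHom_ι k A w
    rw [ExteriorAlgebra.ι] at this
    rw [this, fst_jetOneForm]
  | mul a b ha hb => rw [map_mul, map_mul, ha, hb]
  | add a b ha hb => rw [map_add, map_add, ha, hb]

lemma extDeriv_mul (x y : Forms k A) :
    extDeriv k A (x * y) = extDeriv k A x * y + sgn x * extDeriv k A y := by
  simp only [extDeriv_apply, map_mul, jet.snd_mul, fst_jetHom]

lemma extDeriv_algebraMap (a : A) : extDeriv k A (algebraMap A _ a) = dform k a := by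
  rw [extDeriv_apply, AlgHom.commutes]; rfl

lemma extDeriv_dform (a : A) : extDeriv k A (dform k a) = 0 := by
  rw [extDeriv_apply, dform, jetHom_ι, jetOneForm_D]; rfl

lemma extDeriv_ι_mem (w : Ω[A⁄k]) :
    extDeriv k A (ExteriorAlgebra.ι A w) ∈ ⋀[A]^2 (Ω[A⁄k]) := by
  rw [extDeriv_apply, jetHom_ι]; exact snd_jetOneForm_mem k A w

lemma extDeriv_smul (a : A) (x : Forms k A) :
    extDeriv k A (a • x) = dform k a * x + a • extDeriv k A x := by
  rw [Algebra.smul_def, extDeriv_mul, extDeriv_algebraMap, AlgHom.commutes, Algebra.smul_def]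

lemma sgn_mem {n : ℕ} {x : Forms k A} (hx : x ∈ ⋀[A]^n (Ω[A⁄k])) : sgn x ∈ ⋀[A]^n (Ω[A⁄k]) := by
  induction hx using Submodule.pow_induction_on_left' with
  | algebraMap r => rw [AlgHom.commutes, ExteriorAlgebra.exteriorPower, pow_zero]; exact Submodule.algebraMap_mem r
  | add x y i _ _ hx hy => rw [map_add]; exact add_mem hx hy
  | mem_mul m hm i x _ hx =>
    obtain ⟨m, rfl⟩ := hm
    rw [map_mul, sgn_ι, ExteriorAlgebra.exteriorPower, pow_succ']
    exact Submodule.mul_mem_mul (neg_mem ⟨m, rfl⟩) hx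

lemma extDeriv_mem {n : ℕ} {x : Forms k A} (hx : x ∈ ⋀[A]^n (Ω[A⁄k])) :
    extDeriv k A x ∈ ⋀[A]^(n + 1) (Ω[A⁄k]) := by
  induction hx using Submodule.pow_induction_on_left' with
  | algebraMap r => rw [extDeriv_algebraMap, ExteriorAlgebra.exteriorPower, zero_add, pow_one]; exact ⟨_, rfl⟩
  | add x y i _ _ hx hy => rw [map_add]; exact add_mem hx hy
  | mem_mul m hm i x hx' hx =>
    obtain ⟨m, rfl⟩ := hm
    rw [extDeriv_mul, sgn_ι]
    refine add_mem ?_ ?_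
    · have := Submodule.mul_mem_mul (extDeriv_ι_mem k A m) hx'
      rw [← pow_add, add_comm] at this
      exact this
    · rw [ExteriorAlgebra.exteriorPower, pow_succ']
      exact Submodule.mul_mem_mul (neg_mem ⟨m, rfl⟩) hx

lemma extDeriv_sgn (x : Forms k A) : extDeriv k A (sgn x) = - sgn (extDeriv k A x) := by
  induction x using CliffordAlgebra.induction with
  | algebraMap r =>
    rw [AlgHom.commutes, extDeriv_algebraMap, dform, sgn_ι, neg_neg]
  | ι w =>
    change extDeriv k A (sgn (ExteriorAlgebra.ι A w)) =
      - sgn (extDeriv k A (ExteriorAlgebra.ι A w))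
    rw [sgn_ι, map_neg, sgn_eq_self_of_mem_two k A (extDeriv_ι_mem k A w)]
  | mul a b ha hb =>
    rw [map_mul, extDeriv_mul, extDeriv_mul, ha, hb, map_add, map_mul, map_mul, neg_mul, mul_neg,
      neg_add]
  | add a b ha hb => rw [map_add, map_add, ha, hb, map_add, map_add, neg_add]

lemma extDeriv_extDeriv (x : Forms k A) : extDeriv k A (extDeriv k A x) = 0 := by
  induction x using CliffordAlgebra.induction with
  | algebraMap r => rw [extDeriv_algebraMap, extDeriv_dform]
  | ι w =>
    change extDeriv k A (extDeriv k A (ExteriorAlgebra.ι A w)) = 0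
    induction w using range_D_induction with
    | smul a b =>
      rw [map_smul]
      change extDeriv k A (extDeriv k A (a • dform k b)) = 0
      rw [extDeriv_smul, extDeriv_dform, smul_zero, add_zero, extDeriv_mul, extDeriv_dform,
        extDeriv_dform, zero_mul, mul_zero, add_zero]
    | add x y hx hy => rw [map_add, map_add, map_add, hx, hy, add_zero]
  | mul a b ha hb =>
    rw [extDeriv_mul, map_add, extDeriv_mul, extDeriv_mul, ha, hb, extDeriv_sgn]
    simp [sgn]
  | add a b ha hb => rw [map_add, map_add, ha, hb, add_zero]

/-- The exterior derivative `d : Ω^n → Ω^(n+1)`. -/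
def exteriorDeriv (n : ℕ) : ⋀[A]^n (Ω[A⁄k]) →+ ⋀[A]^(n + 1) (Ω[A⁄k]) where
  toFun x := ⟨extDeriv k A x, extDeriv_mem k A x.2⟩
  map_zero' := by ext; simp
  map_add' x y := by ext; simp

end DeRham

/-! ### Frobenius, boundaries and the inverse Cartier operator -/

/-- The module `F_* M`: the abelian group `M` on which `a` acts as multiplication by `a ^ p`. -/
def FrobPush (_p : ℕ) (M : Type u) : Type u := M

section Cartier

variable (k A : Type u) [CommRing k] [CommRing A] [Algebra k A] (p : ℕ) [Fact p.Prime] [CharP A p]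

instance (M : Type u) [AddCommGroup M] : AddCommGroup (FrobPush p M) :=
  inferInstanceAs (AddCommGroup M)

instance (M : Type u) [AddCommGroup M] [Module A M] : Module A (FrobPush p M) :=
  Module.compHom M (frobenius A p)

/-- The identity map `M → F_* M`. -/
def FrobPush.of (M : Type u) [AddCommGroup M] : M ≃+ FrobPush p M := AddEquiv.refl M

variable {A} in
lemma FrobPush.smul_of {M : Type u} [AddCommGroup M] [Module A M] (a : A) (x : M) :
    a • FrobPush.of p M x = FrobPush.of p M (a ^ p • x) := rfl

variable {A} in
lemma dform_pow_char (a : A) : dform k (a ^ p) = 0 := by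
  rw [dform, Derivation.leibniz_pow, ← Nat.cast_smul_eq_nsmul A p, CharP.cast_eq_zero, zero_smul,
    map_zero]

/-- The exterior derivative as an `A`-linear map `F_* Ω^n → F_* Ω^(n+1)`. -/
def frobDeriv (n : ℕ) :
    FrobPush p (⋀[A]^n (Ω[A⁄k])) →ₗ[A] FrobPush p (⋀[A]^(n + 1) (Ω[A⁄k])) where
  toFun x := FrobPush.of p _ (exteriorDeriv k A n ((FrobPush.of p _).symm x))
  map_add' x y := by rw [map_add, map_add, map_add]
  map_smul' a x := by
    obtain ⟨x, rfl⟩ := (FrobPush.of p _).surjective x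
    rw [RingHom.id_apply, FrobPush.smul_of, AddEquiv.symm_apply_apply, AddEquiv.symm_apply_apply,
      FrobPush.smul_of]
    congr 1
    apply Subtype.ext
    change extDeriv k A (a ^ p • x.1) = a ^ p • extDeriv k A x.1
    rw [extDeriv_smul, dform_pow_char, zero_mul, zero_add]

/-- `BΩ^n`, the image of `d : F_* Ω^(n-1) → F_* Ω^n`, which is zero for `n = 0`. -/
def boundaries : (n : ℕ) → Submodule A (FrobPush p (⋀[A]^n (Ω[A⁄k])))
  | 0 => ⊥
  | n + 1 => LinearMap.range (frobDeriv k A p n)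

/-- `GΩ^n = F_* Ω^n / BΩ^n`. -/
abbrev GForms (n : ℕ) : Type u := FrobPush p (⋀[A]^n (Ω[A⁄k])) ⧸ boundaries k A p n

/-- The ring of closed forms (of all degrees). -/
def closedForms : Subring (Forms k A) where
  carrier := {x | extDeriv k A x = 0}
  mul_mem' := by
    intro x y (hx : extDeriv k A x = 0) (hy : extDeriv k A y = 0)
    change extDeriv k A (x * y) = 0
    rw [extDeriv_mul, hx, hy, zero_mul, mul_zero, add_zero]
  one_mem' := by
    change extDeriv k A 1 = 0
    rw [← map_one (algebraMap A (Forms k A)), extDeriv_algebraMap]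
    simp [dform]
  add_mem' := by
    intro x y (hx : extDeriv k A x = 0) (hy : extDeriv k A y = 0)
    change extDeriv k A (x + y) = 0
    rw [map_add, hx, hy, add_zero]
  zero_mem' := map_zero _
  neg_mem' := by
    intro x (hx : extDeriv k A x = 0)
    change extDeriv k A (-x) = 0
    rw [map_neg, hx, neg_zero]

/-- The two-sided ideal of exact forms in the ring of closed forms. -/
def exactForms : Ideal (closedForms k A) where
  carrier := {x | ∃ y, extDeriv k A y = x.1}
  add_mem' := by
    rintro _ _ ⟨y, hy⟩ ⟨z, hz⟩
    exact ⟨y + z, by rw [map_add, hy, hz]; rfl⟩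
  zero_mem' := ⟨0, map_zero _⟩
  smul_mem' := by
    rintro c x ⟨y, hy⟩
    refine ⟨sgn c.1 * y, ?_⟩
    have hc : extDeriv k A c.1 = 0 := c.2
    rw [extDeriv_mul, extDeriv_sgn, hc, hy]
    simp [sgn]

instance : (exactForms k A).IsTwoSided where
  mul_mem_of_left := by
    rintro x c ⟨y, hy⟩
    refine ⟨y * c.1, ?_⟩
    have hc : extDeriv k A c.1 = 0 := c.2
    rw [extDeriv_mul, hc, hy, mul_zero, add_zero]
    rfl

/-- The ring `⨁ ZΩ^n / BΩ^n` of closed forms modulo exact forms, considered as an `A`-algebra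
through Frobenius. -/
def Cohom (_p : ℕ) : Type u := closedForms k A ⧸ exactForms k A

instance : Ring (Cohom k A p) := inferInstanceAs (Ring (closedForms k A ⧸ exactForms k A))

/-- The class of a closed form. -/
def Cohom.mk : closedForms k A →+* Cohom k A p := Ideal.Quotient.mk (exactForms k A)

variable {k A p} in
lemma Cohom.mk_eq {x y : closedForms k A} (z : Forms k A) (h : extDeriv k A z = x.1 - y.1) :
    Cohom.mk k A p x = Cohom.mk k A p y :=
  Ideal.Quotient.eq.mpr ⟨z, h⟩

/-- The ring homomorphism `a ↦ a ^ p` from `A` to the closed forms. -/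
def frobClosed : A →+* closedForms k A :=
  ((algebraMap A (Forms k A)).comp (frobenius A p)).codRestrict _ fun a => by
    change extDeriv k A (algebraMap A _ (a ^ p)) = 0
    rw [extDeriv_algebraMap, dform_pow_char]

instance : Algebra A (Cohom k A p) where
  smul a x := Cohom.mk k A p (frobClosed k A p a) * x
  algebraMap := (Cohom.mk k A p).comp (frobClosed k A p)
  commutes' a x := by
    obtain ⟨x, rfl⟩ := Ideal.Quotient.mk_surjective x
    change Cohom.mk k A p _ * Cohom.mk k A p x = Cohom.mk k A p x * Cohom.mk k A p _
    rw [← map_mul, ← map_mul]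
    congr 1
    exact Subtype.ext (Algebra.commutes (a ^ p) x.1)
  smul_def' a x := rfl

/-- `k` acts on `Cohom k A p` through `A`. -/
instance : Algebra k (Cohom k A p) := Algebra.compHom _ (algebraMap k A)

instance : IsScalarTower k A (Cohom k A p) := IsScalarTower.of_algebraMap_eq fun _ => rfl

variable {A} in
/-- The closed form `a ^ (p - 1) D a`. -/
def gammaForm (a : A) : closedForms k A :=
  ⟨a ^ (p - 1) • dform k a, by
    change extDeriv k A _ = 0
    rw [extDeriv_smul, extDeriv_dform, smul_zero, add_zero, dform, dform,
      Derivation.leibniz_pow, map_nsmul, map_smul, smul_mul_assoc, smul_mul_assoc,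
      ExteriorAlgebra.ι_sq_zero, smul_zero, smul_zero]⟩

variable {A} in
/-- The form `(a + b) ^ q D (a + b) - a ^ q D a - b ^ q D b` with `q + 1 = p` is exact: it is the
differential of `((a + b) ^ p - a ^ p - b ^ p) / p`. -/
lemma exists_D_eq (a b : A) : ∃ c : A, KaehlerDifferential.D k A c =
    (a + b) ^ (p - 1) • KaehlerDifferential.D k A (a + b) -
      (a ^ (p - 1) • KaehlerDifferential.D k A a + b ^ (p - 1) • KaehlerDifferential.D k A b) := by
  have hp : p.Prime := Fact.out
  obtain ⟨q, rfl⟩ : ∃ q, p = q + 1 := ⟨p - 1, (Nat.succ_pred_prime hp).symm⟩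
  rw [Nat.add_sub_cancel]
  have hdvd : ∀ i : ℕ, ∃ c : ℕ, i < q → (q + 1).choose (i + 1) = (q + 1) * c := fun i => by
    by_cases h : i < q
    · obtain ⟨c, hc⟩ := hp.dvd_choose_self (Nat.succ_ne_zero i) (by omega)
      exact ⟨c, fun _ => hc⟩
    · exact ⟨0, fun h' => absurd h' h⟩
  choose c hc using hdvd
  have h1 : ∀ i < q, c i * (i + 1) = q.choose i := fun i hi => by
    have h := Nat.add_one_mul_choose_eq q i
    rw [hc i hi] at h
    refine Nat.eq_of_mul_eq_mul_left (Nat.succ_pos q) ?_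
    rw [Nat.succ_eq_add_one, h, mul_assoc]
  have h2 : ∀ i < q, c i * (q - i) = q.choose (i + 1) := fun i hi => by
    have h := Nat.choose_succ_right_eq q i
    have h3 := h1 i hi
    refine Nat.eq_of_mul_eq_mul_right (Nat.succ_pos i) ?_
    rw [Nat.succ_eq_add_one, h, ← h3]; ring
  refine ⟨∑ i ∈ Finset.range q, c i • (a ^ (i + 1) * b ^ (q - i)), ?_⟩
  have hD : ∀ i ∈ Finset.range q, KaehlerDifferential.D k A (c i • (a ^ (i + 1) * b ^ (q - i))) =
      (a ^ i * b ^ (q - i) * (q.choose i : A)) • KaehlerDifferential.D k A a +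
      (a ^ (i + 1) * b ^ (q - (i + 1)) * (q.choose (i + 1) : A)) •
        KaehlerDifferential.D k A b := fun i hi => by
    have hi := Finset.mem_range.mp hi
    rw [← h1 i hi, ← h2 i hi, map_nsmul, Derivation.leibniz, Derivation.leibniz_pow,
      Derivation.leibniz_pow]
    simp only [← Nat.cast_smul_eq_nsmul A, smul_add, smul_smul, Nat.sub_sub, Nat.add_sub_cancel]
    rw [add_comm]
    congr 2 <;> push_cast <;> ring
  have hab : (a + b) ^ q = ∑ i ∈ Finset.range q, a ^ i * b ^ (q - i) * (q.choose i : A) + a ^ q := by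
    rw [add_pow, Finset.sum_range_succ]; simp
  have hab' : (a + b) ^ q = ∑ i ∈ Finset.range q,
      a ^ (i + 1) * b ^ (q - (i + 1)) * (q.choose (i + 1) : A) + b ^ q := by
    rw [add_pow, Finset.sum_range_succ']; simp
  rw [map_sum, Finset.sum_congr rfl hD, Finset.sum_add_distrib, ← Finset.sum_smul,
    ← Finset.sum_smul, ← sub_eq_of_eq_add hab, ← sub_eq_of_eq_add hab', map_add, smul_add,
    sub_smul, sub_smul]
  abel

variable {A} in
lemma gammaForm_add (a b : A) :
    Cohom.mk k A p (gammaForm k p (a + b)) =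
      Cohom.mk k A p (gammaForm k p a) + Cohom.mk k A p (gammaForm k p b) := by
  obtain ⟨c, hc⟩ := exists_D_eq k p a b
  rw [← map_add]
  refine Cohom.mk_eq (algebraMap A _ c) ?_
  rw [extDeriv_algebraMap, dform, hc]
  simp [gammaForm, dform]

/-- The derivation `a ↦ a ^ (p - 1) D a` with values in closed forms modulo exact forms. -/
def gamma : Derivation k A (Cohom k A p) :=
  have leib (a b : A) : Cohom.mk k A p (gammaForm k p (a * b)) =
      a • Cohom.mk k A p (gammaForm k p b) + b • Cohom.mk k A p (gammaForm k p a) := by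
    change _ = Cohom.mk k A p _ * Cohom.mk k A p _ + Cohom.mk k A p _ * Cohom.mk k A p _
    rw [← map_mul, ← map_mul, ← map_add]
    congr 1
    apply Subtype.ext
    change (a * b) ^ (p - 1) • dform k (a * b) =
      algebraMap A _ (a ^ p) * (b ^ (p - 1) • dform k b) +
        algebraMap A _ (b ^ p) * (a ^ (p - 1) • dform k a)
    rw [← Algebra.smul_def, ← Algebra.smul_def, dform_mul, smul_add, smul_smul, smul_smul,
      smul_smul, smul_smul]
    obtain ⟨q, hq⟩ : ∃ q, p = q + 1 := ⟨p - 1, (Nat.succ_pred_prime Fact.out).symm⟩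
    rw [hq, Nat.add_sub_cancel]
    congr 2 <;> ring
  Derivation.mk'
    { toFun := fun a => Cohom.mk k A p (gammaForm k p a)
      map_add' := gammaForm_add k p
      map_smul' := fun c a => by
        have h : gammaForm k p (algebraMap k A c) = 0 := by
          apply Subtype.ext
          simp [gammaForm, dform]
        rw [RingHom.id_apply, Algebra.smul_def, leib, h, map_zero, smul_zero, add_zero,
          algebraMap_smul] }
    leib

/-- The induced `A`-linear map on one-forms, `a D b ↦ a ^ p b ^ (p - 1) D b`. -/
def gammaLin : Ω[A⁄k] →ₗ[A] Cohom k A p := (gamma k A p).liftKaehlerDifferential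

lemma gammaLin_D (a : A) :
    gammaLin k A p (KaehlerDifferential.D k A a) = Cohom.mk k A p (gammaForm k p a) :=
  Derivation.liftKaehlerDifferential_comp_D _ _

lemma gammaLin_eq (w : Ω[A⁄k]) : ∃ (v : Ω[A⁄k]) (z : closedForms k A),
    z.1 = ExteriorAlgebra.ι A v ∧ gammaLin k A p w = Cohom.mk k A p z := by
  induction w using range_D_induction with
  | smul a b =>
    refine ⟨a ^ p • b ^ (p - 1) • KaehlerDifferential.D k A b,
      frobClosed k A p a * gammaForm k p b, ?_, ?_⟩
    · rw [map_smul, map_smul, Algebra.smul_def]; rfl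
    · rw [map_smul, gammaLin_D, map_mul]; rfl
  | add x y hx hy =>
    obtain ⟨v, z, h, h'⟩ := hx
    obtain ⟨v', z', h2, h2'⟩ := hy
    refine ⟨v + v', z + z', ?_, ?_⟩
    · rw [map_add, ← h, ← h2]; rfl
    · rw [map_add, map_add, h', h2']

lemma gammaLin_sq (w : Ω[A⁄k]) : gammaLin k A p w * gammaLin k A p w = 0 := by
  obtain ⟨v, z, h, h'⟩ := gammaLin_eq k A p w
  rw [h', ← map_mul]
  have : z * z = 0 := by
    apply Subtype.ext
    change z.1 * z.1 = 0
    rw [h, ExteriorAlgebra.ι_sq_zero]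
  rw [this, map_zero]

/-- The inverse Cartier operator in all degrees, as the algebra homomorphism
`⨁ Ω^n → ⨁ ZΩ^n / BΩ^n` that extends `a D b ↦ a ^ p b ^ (p - 1) D b`. -/
def cartierAlgHom : Forms k A →ₐ[A] Cohom k A p :=
  ExteriorAlgebra.lift A ⟨gammaLin k A p, gammaLin_sq k A p⟩

/-- The component of degree `n` of a form. -/
def component (n : ℕ) : Forms k A →ₗ[A] ⋀[A]^n (Ω[A⁄k]) :=
  DirectSum.component A ℕ _ n ∘ₗ
    (DirectSum.decomposeLinearEquiv (fun i : ℕ => ⋀[A]^i (Ω[A⁄k]))).toLinearMap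

lemma component_mem {n : ℕ} (x : ⋀[A]^n (Ω[A⁄k])) : component k A n x.1 = x := by
  apply Subtype.ext
  change ((DirectSum.decompose (fun i : ℕ => ⋀[A]^i (Ω[A⁄k])) x.1) n : Forms k A) = x.1
  exact DirectSum.decompose_of_mem_same _ x.2

lemma component_of_ne {m n : ℕ} (h : m ≠ n) {x : Forms k A} (hx : x ∈ ⋀[A]^m (Ω[A⁄k])) :
    component k A n x = 0 := by
  apply Subtype.ext
  change ((DirectSum.decompose (fun i : ℕ => ⋀[A]^i (Ω[A⁄k])) x) n : Forms k A) = 0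
  exact DirectSum.decompose_of_mem_ne _ hx h

lemma component_extDeriv_zero (x : Forms k A) : component k A 0 (extDeriv k A x) = 0 := by
  induction x using DirectSum.Decomposition.inductionOn (fun i : ℕ => ⋀[A]^i (Ω[A⁄k])) with
  | zero => rw [map_zero, map_zero]
  | @homogeneous i m => exact component_of_ne k A (Nat.succ_ne_zero i) (extDeriv_mem k A m.2)
  | add m m' h h' => rw [map_add, map_add, h, h', add_zero]

lemma component_extDeriv_succ (n : ℕ) (x : Forms k A) :
    component k A (n + 1) (extDeriv k A x) = exteriorDeriv k A n (component k A n x) := by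
  induction x using DirectSum.Decomposition.inductionOn (fun i : ℕ => ⋀[A]^i (Ω[A⁄k])) with
  | zero => simp only [map_zero]
  | @homogeneous i m =>
    by_cases h : i = n
    · subst h
      rw [component_mem]
      exact component_mem k A (exteriorDeriv k A i m)
    · rw [component_of_ne k A h m.2, map_zero]
      exact component_of_ne k A (fun h' => h (Nat.succ_injective h')) (extDeriv_mem k A m.2)
  | add m m' h h' => rw [map_add, map_add, h, h', map_add, map_add]

/-- The map `⨁ ZΩ^i / BΩ^i → GΩ^n` given by the inclusion in degree `n` and by zero in the
other degrees. -/
def cohomToG (n : ℕ) : Cohom k A p →ₗ[A] GForms k A p n where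
  toFun := QuotientAddGroup.lift (exactForms k A).toAddSubgroup
    ((boundaries k A p n).mkQ.toAddMonoidHom.comp <|
      (FrobPush.of p (⋀[A]^n (Ω[A⁄k]))).toAddMonoidHom.comp <|
        (component k A n).toAddMonoidHom.comp (closedForms k A).subtype.toAddMonoidHom)
    (by
      rintro x ⟨y, hy⟩
      change (boundaries k A p n).mkQ (FrobPush.of p _ (component k A n x.1)) = 0
      rw [Submodule.mkQ_apply, Submodule.Quotient.mk_eq_zero, ← hy]
      cases n with
      | zero => rw [component_extDeriv_zero, map_zero]; exact zero_mem _
      | succ n =>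
        rw [component_extDeriv_succ]
        exact ⟨FrobPush.of p _ (component k A n y), rfl⟩)
  map_add' x y := map_add _ x y
  map_smul' a x := by
    obtain ⟨x, rfl⟩ := Ideal.Quotient.mk_surjective x
    change (boundaries k A p n).mkQ (FrobPush.of p _ (component k A n
      (algebraMap A _ (a ^ p) * x.1))) =
      a • (boundaries k A p n).mkQ (FrobPush.of p _ (component k A n x.1))
    rw [← Algebra.smul_def, map_smul (component k A n)]
    rfl

lemma cohomToG_mk (n : ℕ) (z : closedForms k A) :
    cohomToG k A p n (Cohom.mk k A p z) =
      (boundaries k A p n).mkQ (FrobPush.of p _ (component k A n z.1)) := rfl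

/-- The inverse Cartier operator `C⁻¹ : Ω^n → GΩ^n = F_* Ω^n / BΩ^n`. -/
def inverseCartier (n : ℕ) : ⋀[A]^n (Ω[A⁄k]) →ₗ[A] GForms k A p n :=
  cohomToG k A p n ∘ₗ (cartierAlgHom k A p).toLinearMap ∘ₗ (⋀[A]^n (Ω[A⁄k])).subtype

/-- The formula
`C⁻¹ (a D b₁ ∧ ⋯ ∧ D bₙ) = a ^ p (b₁ ^ (p - 1) D b₁) ∧ ⋯ ∧ (bₙ ^ (p - 1) D bₙ)`. -/
lemma inverseCartier_apply (n : ℕ) (a : A) (b : Fin n → A) :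
    inverseCartier k A p n
        (a • exteriorPower.ιMulti A n fun i => KaehlerDifferential.D k A (b i)) =
      (boundaries k A p n).mkQ (FrobPush.of p _ (a ^ p • exteriorPower.ιMulti A n fun i =>
        b i ^ (p - 1) • KaehlerDifferential.D k A (b i))) := by
  have h1 : cartierAlgHom k A p
      (ExteriorAlgebra.ιMulti A n fun i => KaehlerDifferential.D k A (b i)) =
      Cohom.mk k A p (List.ofFn fun i => gammaForm k p (b i)).prod := by
    rw [ExteriorAlgebra.ιMulti_apply, map_list_prod, map_list_prod, List.map_ofFn, List.map_ofFn]
    congr 2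
    funext i
    change cartierAlgHom k A p (ExteriorAlgebra.ι A _) = _
    rw [cartierAlgHom, ExteriorAlgebra.lift_ι_apply, gammaLin_D]
    rfl
  have h2 : ((List.ofFn fun i => gammaForm k p (b i)).prod : closedForms k A).1 =
      ExteriorAlgebra.ιMulti A n fun i => b i ^ (p - 1) • KaehlerDifferential.D k A (b i) := by
    change (closedForms k A).subtype _ = _
    rw [ExteriorAlgebra.ιMulti_apply, map_list_prod, List.map_ofFn]
    congr 2
    funext i
    rw [map_smul]
    rfl
  rw [map_smul, ← FrobPush.smul_of, map_smul]
  congr 1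
  change cohomToG k A p n (cartierAlgHom k A p
    (ExteriorAlgebra.ιMulti A n fun i => KaehlerDifferential.D k A (b i))) = _
  rw [h1, cohomToG_mk, h2]
  congr 2
  exact component_mem k A
    (exteriorPower.ιMulti A n fun i => b i ^ (p - 1) • KaehlerDifferential.D k A (b i))

end Cartier

end CartierForms

/-! ### Hypersurfaces -/

namespace Hypersurface

open CartierForms

/-- `i : D ⟶ X` is the inclusion of a closed subscheme whose ideal is locally generated by one
nonzerodivisor. -/
structure IsHypersurface {D X : Scheme.{u}} (i : D ⟶ X) : Prop where
  isClosedImmersion : IsClosedImmersion i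
  locally_principal : ∀ x : X, ∃ U : X.affineOpens, x ∈ U.1 ∧
    ∃ f ∈ nonZeroDivisors Γ(X, U.1), i.ker.ideal U = Ideal.span {f}

/-- All local rings are integrally closed domains. -/
def IsNormal (D : Scheme.{u}) : Prop :=
  ∀ x : D, IsDomain (D.presheaf.stalk x) ∧ IsIntegrallyClosed (D.presheaf.stalk x)

/-- `D` has dimension `d` at each of its closed points. -/
def HasPureDimension (D : Scheme.{u}) (d : ℕ) : Prop :=
  ∀ x : D, IsClosed ({x} : Set D) → ringKrullDim (D.presheaf.stalk x) = d

/-- The singular locus: the points whose local ring is not regular. -/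
def singularLocus (D : Scheme.{u}) : Set D :=
  {x | ¬ IsRegularLocalRing (D.presheaf.stalk x)}

/-- The codimension of a subset `Z` of `D`: the infimum of the dimensions of the local rings of
`D` at the points of `Z`. It is `⊤` if `Z` is empty. -/
def codim (D : Scheme.{u}) (Z : Set D) : WithBot ℕ∞ :=
  ⨅ x ∈ Z, ringKrullDim (D.presheaf.stalk x)

section

variable {k : Type u} [Field k] {D : Scheme.{u}}

/-- The local ring of the `k`-scheme `D` at `x`. -/
def LocalRingAt (_g : D ⟶ Spec (.of k)) (x : D) : Type u := D.presheaf.stalk x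

variable (g : D ⟶ Spec (.of k)) (x : D)

instance : CommRing (LocalRingAt g x) := inferInstanceAs (CommRing (D.presheaf.stalk x))

instance : IsLocalRing (LocalRingAt g x) := inferInstanceAs (IsLocalRing (D.presheaf.stalk x))

/-- The `k`-algebra structure given by `k → Γ(D, ⊤) → 𝒪_{D,x}`. -/
instance : Algebra k (LocalRingAt g x) :=
  ((Scheme.ΓSpecIso (.of k)).inv ≫ g.appTop ≫ D.presheaf.germ ⊤ x trivial).hom.toAlgebra

instance (p : ℕ) [CharP k p] : CharP (LocalRingAt g x) p :=
  charP_of_injective_algebraMap (algebraMap k (LocalRingAt g x)).injective p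

variable (p : ℕ) [Fact p.Prime] [CharP k p]

/-- The map `C⁻¹ : H^i_x(Ω^j_D) → H^i_x(F_* Ω^j_D / BΩ^j_D)` is injective. Here `H^i_x` is local
cohomology over `A = 𝒪_{D,x}` with support in the maximal ideal, applied to the stalks at `x`.
Differential forms, `d`, `F_*` and quotients are compatible with localization, so that the stalks
of `Ω^j_D` and `F_* Ω^j_D / BΩ^j_D` at `x` are the modules `Ω^j` and `GΩ^j` of the `k`-algebra
`A`. -/
def CartierInjectiveAt (i j : ℕ) : Prop :=
  Function.Injective ((localCohomology (maximalIdeal (LocalRingAt g x)) i).map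
    (ModuleCat.ofHom (inverseCartier k (LocalRingAt g x) p j)))

/-- `C⁻¹ : H^i_x(Ω^j_D) → H^i_x(F_* Ω^j_D / BΩ^j_D)` is injective at all closed points `x`. -/
def CartierInjective (i j : ℕ) : Prop :=
  ∀ x : D, IsClosed ({x} : Set D) → CartierInjectiveAt g x p i j

/-- A normal hypersurface `D` of dimension `d` is `m`-`F`-injective. -/
def IsFInjective (d m : ℕ) : Prop :=
  2 * m + 1 ≤ codim D (singularLocus D) ∧
    ∀ i j : ℕ, j ≤ m → i + j ≤ d → CartierInjective g p i j

end

end Hypersurface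

end

/-! The assertion is local. At a closed point of `D` let `R` be the local ring of `X` and `A =
R/(f)` that of `D`. Wedging with `df` gives the row 0 → Ω^j_A → A ⊗ Ω^{j+1}_R → Ω^{j+1}_A → 0. Forms
on `A` are forms on `R` modulo `f` and `df`, which settles everything except injectivity on the
left. For `j < m` that injectivity says that the Koszul complex of `df` over `A` is exact in low
degrees. Primes containing `f` and the coefficients of `df` are singular points of `D`, so the
codimension bound provides `m` elements of the Jacobian ideal that continue `f` to a regular
sequence, and contraction against linear forms gives exactness (`exists_of_wedgeD_mem`).

Since `C⁻¹(df)` is the class of `f^(p-1) df`, the operator `C⁻¹` maps this row to GΩ^j_A → A ⊗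
GΩ^{j+1}_R → GΩ^{j+1}_A. On the smooth side GΩ_R is projective: in a `p`-basis the matrix of `d` has
entries in the prime field, so the boundaries split off (`exists_section_mkQ_boundaries`). As `A`
has a regular sequence of length `d`, the local cohomology of both middle terms vanishes below
degree `d`.

Let `i + j + 1 = d`. A class in H^{i+1}(Ω^j_A) that dies in the middle term is the connecting image
of some α in H^i(Ω^{j+1}_A). If `C⁻¹` kills the class, naturality and the vanishing of H^i(A ⊗
GΩ^{j+1}_R) give C⁻¹(α) = 0. Hence injectivity passes from `(i, j+1)` to `(i+1, j)`
(`injective_map_inverseCartier_of_succ`). Dying in the middle term is automatic for `j > 0`. For `j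
= 0` one takes a class in the socle: at a singular point `df` lies in `𝔪Ω_R`, so multiplication by
`df` kills socles. Below the line `i + j = d` the rows show that H^i(Ω^j_A) is zero
(`extVanish_exteriorPower`).

Where a coefficient of `df` is a unit, Ω_A is free and only `(d, 0)` matters; there Frobenius
splits. The second part follows from the first because `m > 0` gives `m + 2 ≤ 2m + 1`. -/

noncomputable section

open Opposite

/-! ### Naturality of the computation of `Ext` by projective resolutions. -/

namespace CategoryTheory.ProjectiveResolution

variable {R : Type u} [CommRing R]

/-- Postcomposition on the complexes computing `Ext`. -/
def yonedaPost {X : ModuleCat.{u} R} (P : ProjectiveResolution X) {Y Y' : ModuleCat.{u} R}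
    (g : Y ⟶ Y') :
    P.complex.linearYonedaObj R Y ⟶ P.complex.linearYonedaObj R Y' :=
  (HomologicalComplex.unopFunctor _ _).map
    (((NatTrans.mapHomologicalComplex (NatTrans.rightOp ((linearYoneda R (ModuleCat.{u} R)).map g))
      (ComplexShape.down ℕ)).app P.complex).op)

def yonedaPre {X X' : ModuleCat.{u} R} (P : ProjectiveResolution X) (Q : ProjectiveResolution X')
    (Y : ModuleCat.{u} R)
    (φ : P.complex ⟶ Q.complex) :
    Q.complex.linearYonedaObj R Y ⟶ P.complex.linearYonedaObj R Y :=
  (HomologicalComplex.unopFunctor _ _).map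
    ((((((linearYoneda R (ModuleCat.{u} R)).obj Y).rightOp).mapHomologicalComplex
      (ComplexShape.down ℕ)).map φ).op)

lemma homologyUnop_naturality {K L : HomologicalComplex (ModuleCat.{u} R)ᵒᵖ (ComplexShape.down ℕ)}
    (φ : K ⟶ L) (n : ℕ) :
    (HomologicalComplex.homologyUnop L n).hom ≫ (HomologicalComplex.homologyMap φ n).unop =
    HomologicalComplex.homologyMap ((HomologicalComplex.unopFunctor _ _).map φ.op) n ≫
      (HomologicalComplex.homologyUnop K n).hom := by
  have := HomologicalComplex.homologyOp_hom_naturality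
      ((HomologicalComplex.unopFunctor _ _).map φ.op) n
  have := congrArg Quiver.Hom.unop this
  exact this

/-- The isomorphism `isoExt` combines an isomorphism in the opposite category with `homologyUnop`.
Naturality of such a composite is proved for abstract isomorphisms, so that it serves both variables
of `Ext` without unfolding derived functors. -/
lemma unop_conj_aux {C : Type*} [Category* C] {A B H H' : Cᵒᵖ} (a : A ≅ H) (b : B ≅ H')
    {m : A ⟶ B} {φ : H ⟶ H'} (hm : m = a.hom ≫ φ ≫ b.inv) {X X' : C} (v : X ≅ unop H)
    (v' : X' ≅ unop H') {ψ : X' ⟶ X} (hψ : v'.hom ≫ φ.unop = ψ ≫ v.hom) :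
    (b.unop.symm ≪≫ v'.symm).inv ≫ m.unop = ψ ≫ (a.unop.symm ≪≫ v.symm).inv := by
  subst hm
  have h : v'.hom ≫ b.hom.unop ≫ b.inv.unop ≫ φ.unop ≫ a.hom.unop = ψ ≫ v.hom ≫ a.hom.unop := by
    rw [← unop_comp_assoc, b.inv_hom_id, unop_id, Category.id_comp, ← Category.assoc, hψ,
      Category.assoc]
  simpa using h

lemma isoExt_post {X : ModuleCat.{u} R} (P : ProjectiveResolution X) {Y Y' : ModuleCat.{u} R}
    (g : Y ⟶ Y') (n : ℕ) :
    (P.isoExt (R := R) n Y).inv ≫ (((Ext R (ModuleCat.{u} R) n).obj (op X)).map g) =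
     HomologicalComplex.homologyMap (P.yonedaPost g) n ≫ (P.isoExt n Y').inv :=
  unop_conj_aux _ _ (ProjectiveResolution.leftDerived_app_eq
    (NatTrans.rightOp ((linearYoneda R (ModuleCat.{u} R)).map g)) P n) _ _
    (homologyUnop_naturality _ n)

lemma isoExt_pre {X X' : ModuleCat.{u} R} (P : ProjectiveResolution X)
    (Q : ProjectiveResolution X') (Y : ModuleCat.{u} R) {h : X ⟶ X'} (φ : Hom P Q h) (n : ℕ) :
    (Q.isoExt (R := R) n Y).inv ≫ (((Ext R (ModuleCat.{u} R) n).map h.op).app Y) =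
     HomologicalComplex.homologyMap (P.yonedaPre Q Y φ.hom) n ≫ (P.isoExt n Y).inv :=
  have e := ProjectiveResolution.isoLeftDerivedObj_hom_naturality h P Q φ.hom
      φ.hom_f_zero_comp_π_f_zero (((linearYoneda R (ModuleCat.{u} R)).obj Y).rightOp) n
  unop_conj_aux _ _ (((Iso.eq_comp_inv _).mpr e).trans (Category.assoc _ _ _)) _ _
    (homologyUnop_naturality _ n)

end CategoryTheory.ProjectiveResolution

/-! ### Cohomology classes of explicit cocycles. -/

namespace CochainComplex

open HomologicalComplex

variable {R : Type u} [CommRing R] (K L : CochainComplex (ModuleCat.{u} R) ℕ) {n : ℕ}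

lemma exists_cycles (x : K.X n) (hx : K.d n (n + 1) x = 0) : ∃ z : K.cycles n, K.iCycles n z = x :=
    by
  refine ⟨(K.liftCycles (ModuleCat.ofHom (LinearMap.toSpanSingleton R (K.X n) x)) (n + 1) (by simp)
    ?_) (1 : R), ?_⟩
  · ext
    simpa using hx
  · rw [← ModuleCat.comp_apply, liftCycles_i]
    simp

/-- The cohomology class of a cocycle. -/
def classOf (x : K.X n) (hx : K.d n (n + 1) x = 0) : K.homology n :=
  K.homologyπ n (K.exists_cycles x hx).choose

lemma iCycles_injective : Function.Injective (K.iCycles n) :=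
  (ModuleCat.mono_iff_injective _).mp inferInstance

/-- A cycle is determined by its underlying cochain, so the choice made in `classOf` is immaterial.
-/
lemma homologyπ_eq_classOf (z : K.cycles n) (x : K.X n) (hx : K.d n (n + 1) x = 0)
    (hz : K.iCycles n z = x) : K.homologyπ n z = K.classOf x hx := by
  rw [classOf]
  congr 1
  exact K.iCycles_injective (hz.trans (K.exists_cycles x hx).choose_spec.symm)

lemma exists_classOf (h : K.homology n) : ∃ x hx, K.classOf (n := n) x hx = h := by
  obtain ⟨z, rfl⟩ := (ModuleCat.epi_iff_surjective (K.homologyπ n)).mp inferInstance h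
  have hx : K.d n (n + 1) (K.iCycles n z) = 0 := by
    rw [← ModuleCat.comp_apply, iCycles_d]; rfl
  exact ⟨_, hx, (K.homologyπ_eq_classOf z _ hx rfl).symm⟩

lemma classOf_add (x y : K.X n) (hx : K.d n (n + 1) x = 0) (hy : K.d n (n + 1) y = 0) :
    K.classOf x hx + K.classOf y hy =
      K.classOf (x + y) (by rw [map_add, hx, hy, add_zero]) := by
  rw [classOf, classOf, ← map_add]
  apply homologyπ_eq_classOf
  rw [map_add, (K.exists_cycles x hx).choose_spec, (K.exists_cycles y hy).choose_spec]

variable {K L} in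
lemma homologyMap_classOf (φ : K ⟶ L) (x : K.X n) (hx : K.d n (n + 1) x = 0) :
    homologyMap φ n (K.classOf x hx) = L.classOf (φ.f n x) (by
      rw [← ModuleCat.comp_apply, φ.comm, ModuleCat.comp_apply, hx, map_zero]) := by
  rw [classOf, ← ModuleCat.comp_apply, homologyπ_naturality, ModuleCat.comp_apply]
  apply homologyπ_eq_classOf
  rw [← ModuleCat.comp_apply, cyclesMap_i, ModuleCat.comp_apply, (K.exists_cycles x hx).choose_spec]

lemma classOf_eq_zero_iff (m : ℕ) (hm : m + 1 = n) (x : K.X n) (hx : K.d n (n + 1) x = 0) :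
    K.classOf x hx = 0 ↔ ∃ y, K.d m n y = x := by
  have hex := ShortComplex.exact_of_g_is_cokernel
    (.mk (K.toCycles m n) (K.homologyπ n) (by simp)) (K.homologyIsCokernel m n (by simp [← hm]))
  rw [ShortComplex.moduleCat_exact_iff] at hex
  constructor
  · intro h
    obtain ⟨y, hy⟩ := hex _ h
    refine ⟨y, ?_⟩
    rw [← (K.exists_cycles x hx).choose_spec, ← hy]
    change _ = K.iCycles n (K.toCycles m n y)
    rw [← ModuleCat.comp_apply, toCycles_i]
  · rintro ⟨y, hy⟩
    rw [← K.homologyπ_eq_classOf (K.toCycles m n y) x hx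
      (by rw [← ModuleCat.comp_apply, toCycles_i, hy]), ← ModuleCat.comp_apply,
          toCycles_comp_homologyπ]
    rfl

lemma classOf_zero_eq_zero_iff (x : K.X 0) (hx : K.d 0 1 x = 0) :
    K.classOf x hx = 0 ↔ x = 0 := by
  have hex := ShortComplex.exact_of_g_is_cokernel
    (.mk (K.toCycles ((ComplexShape.up ℕ).prev 0) 0) (K.homologyπ 0) (by simp))
        (K.homologyIsCokernel _ 0 rfl)
  rw [ShortComplex.moduleCat_exact_iff] at hex
  constructor
  · intro h
    obtain ⟨y, hy⟩ := hex _ h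
    rw [← (K.exists_cycles x hx).choose_spec, ← hy]
    change K.iCycles 0 (K.toCycles _ 0 y) = _
    -- No index precedes 0, so `prev 0` is 0 itself and the incoming differential is zero.
    rw [← ModuleCat.comp_apply, toCycles_i, K.shape _ _ (by simp)]; rfl
  · rintro rfl
    rw [← K.homologyπ_eq_classOf 0 0 hx (map_zero _), map_zero]

end CochainComplex

/-! ### Comparison of `Abelian.Ext` with the derived-functor `Ext`. -/

namespace CategoryTheory.ProjectiveResolution

open HomologicalComplex Abelian

variable {R : Type u} [CommRing R] {X X' Y Y' : ModuleCat.{u} R} (P : ProjectiveResolution X)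
  (Q : ProjectiveResolution X') {n : ℕ}

/-- A morphism on a term of the resolution as a cochain with values in `Y`. -/
def cochain (f : P.complex.X n ⟶ Y) : (P.complex.linearYonedaObj R Y).X n := f

lemma d_cochain_eq_zero {f : P.complex.X n ⟶ Y} (hf : P.complex.d (n + 1) n ≫ f = 0) :
    (P.complex.linearYonedaObj R Y).d n (n + 1) (P.cochain f) = 0 := hf

/-- The class in `Ext` of a cocycle of a projective resolution. -/
def oldExtMk (f : P.complex.X n ⟶ Y) (hf : P.complex.d (n + 1) n ≫ f = 0) :
    ((_root_.Ext R (ModuleCat.{u} R) n).obj (op X)).obj Y :=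
  (P.isoExt (R := R) n Y).inv (CochainComplex.classOf _ (P.cochain f) (P.d_cochain_eq_zero hf))

lemma oldExtMk_add (f g : P.complex.X n ⟶ Y) (hf : P.complex.d (n + 1) n ≫ f = 0)
    (hg : P.complex.d (n + 1) n ≫ g = 0) :
    P.oldExtMk f hf + P.oldExtMk g hg = P.oldExtMk (f + g) (by simp [hf, hg]) := by
  rw [oldExtMk, oldExtMk, ← map_add, CochainComplex.classOf_add]; rfl

lemma exists_oldExtMk (a : ((_root_.Ext R (ModuleCat.{u} R) n).obj (op X)).obj Y) :
    ∃ f hf, P.oldExtMk f hf = a := by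
  obtain ⟨f, hf, h⟩ := CochainComplex.exists_classOf _ ((P.isoExt (R := R) n Y).hom a)
  refine ⟨f, hf, (congrArg (P.isoExt (R := R) n Y).inv h).trans ?_⟩
  rw [← ModuleCat.comp_apply, Iso.hom_inv_id]; rfl

lemma isoExt_inv_eq_zero_iff (x) : (P.isoExt (R := R) n Y).inv x = 0 ↔ x = 0 := by
  refine ⟨fun h => ?_, fun h => h ▸ map_zero _⟩
  have := congrArg (P.isoExt (R := R) n Y).hom h
  rwa [← ModuleCat.comp_apply, Iso.inv_hom_id, map_zero] at this

lemma extMk_eq_zero_iff_zero (f : P.complex.X 0 ⟶ Y) (hf : P.complex.d 1 0 ≫ f = 0) :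
    P.extMk f 1 rfl hf = 0 ↔ f = 0 := by
  simp only [← P.extEquivCohomologyClass.apply_eq_iff_eq,
    extEquivCohomologyClass_extMk, extEquivCohomologyClass_zero,
    CochainComplex.HomComplex.CohomologyClass.mk_eq_zero_iff]
  rw [CochainComplex.HomComplex.Cocycle.toSingleMk_mem_coboundaries_iff _ _ _ _ _ 1 (by lia)]
  constructor
  · rintro ⟨g, hg⟩
    -- A coboundary would come from degree 1, but the resolution, viewed as a cochain complex, lives
    -- in nonpositive degrees.
    have hz : Limits.IsZero (P.cochainComplex.X 1) :=
      P.cochainComplex.isZero_of_isStrictlyLE 0 1 (by lia)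
    rw [hz.eq_of_src g 0, Limits.comp_zero] at hg
    rw [← cancel_epi (P.cochainComplexXIso (-0) 0 rfl).hom, Limits.comp_zero]
    exact hg.symm
  · rintro rfl
    exact ⟨0, by simp⟩

/-- In positive degree both classes vanish exactly when `f` factors through the differential, in
degree zero exactly when `f = 0`. This makes the comparison map independent of representatives and
injective. -/
lemma extMk_eq_zero_iff_oldExtMk (f : P.complex.X n ⟶ Y) (hf : P.complex.d (n + 1) n ≫ f = 0) :
    P.extMk f (n + 1) rfl hf = 0 ↔ P.oldExtMk f hf = 0 := by
  rw [oldExtMk, isoExt_inv_eq_zero_iff]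
  cases n with
  | zero =>
    rw [extMk_eq_zero_iff_zero, CochainComplex.classOf_zero_eq_zero_iff]
    rfl
  | succ n =>
    rw [extMk_eq_zero_iff _ _ _ _ _ n rfl, CochainComplex.classOf_eq_zero_iff _ n rfl]
    rfl

lemma oldExtMk_eq_of_extMk_eq (f g : P.complex.X n ⟶ Y) (hf : P.complex.d (n + 1) n ≫ f = 0)
    (hg : P.complex.d (n + 1) n ≫ g = 0) (h : P.extMk f (n + 1) rfl hf = P.extMk g (n + 1) rfl hg) :
    P.oldExtMk f hf = P.oldExtMk g hg := by
  rw [← sub_eq_zero, sub_extMk, extMk_eq_zero_iff_oldExtMk] at h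
  have := P.oldExtMk_add (f - g) g (by simp [hf, hg]) hg
  rw [h, zero_add] at this
  rw [this]; simp

/-- The comparison of the two definitions of `Ext`. -/
def extToOld : Ext X Y n →+ ((_root_.Ext R (ModuleCat.{u} R) n).obj (op X)).obj Y :=
  AddMonoidHom.mk' (fun α => P.oldExtMk (P.extMk_surjective α (n + 1) rfl).choose
    (P.extMk_surjective α (n + 1) rfl).choose_spec.choose) (fun α β => by
      rw [oldExtMk_add]
      apply oldExtMk_eq_of_extMk_eq
      rw [(P.extMk_surjective _ (n + 1) rfl).choose_spec.choose_spec, ← add_extMk,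
        (P.extMk_surjective α (n + 1) rfl).choose_spec.choose_spec,
        (P.extMk_surjective β (n + 1) rfl).choose_spec.choose_spec]
      · exact (P.extMk_surjective α (n + 1) rfl).choose_spec.choose
      · exact (P.extMk_surjective β (n + 1) rfl).choose_spec.choose)

lemma extToOld_extMk (f : P.complex.X n ⟶ Y) (hf : P.complex.d (n + 1) n ≫ f = 0) :
    P.extToOld (P.extMk f (n + 1) rfl hf) = P.oldExtMk f hf :=
  P.oldExtMk_eq_of_extMk_eq _ _ _ _ (P.extMk_surjective _ (n + 1) rfl).choose_spec.choose_spec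

lemma extToOld_bijective : Function.Bijective (P.extToOld : Ext X Y n →+ _) := by
  constructor
  · rw [injective_iff_map_eq_zero]
    intro α h
    obtain ⟨f, hf, rfl⟩ := P.extMk_surjective α (n + 1) rfl
    rwa [extToOld_extMk, ← extMk_eq_zero_iff_oldExtMk] at h
  · intro a
    obtain ⟨f, hf, rfl⟩ := P.exists_oldExtMk a
    exact ⟨_, P.extToOld_extMk f hf⟩

lemma extToOld_comp (α : Ext X Y n) (g : Y ⟶ Y') :
    P.extToOld (α.comp (Ext.mk₀ g) (add_zero n)) =
      ((_root_.Ext R (ModuleCat.{u} R) n).obj (op X)).map g (P.extToOld α) := by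
  obtain ⟨f, hf, rfl⟩ := P.extMk_surjective α (n + 1) rfl
  rw [extMk_comp_mk₀, extToOld_extMk, extToOld_extMk, oldExtMk, oldExtMk, ← ModuleCat.comp_apply,
    isoExt_post, ModuleCat.comp_apply, CochainComplex.homologyMap_classOf]
  rfl

lemma comp_extToOld (h : X ⟶ X') (α : Ext X' Y n) :
    P.extToOld ((Ext.mk₀ h).comp α (zero_add n)) =
      ((_root_.Ext R (ModuleCat.{u} R) n).map h.op).app Y (Q.extToOld α) := by
  obtain ⟨f, hf, rfl⟩ := Q.extMk_surjective α (n + 1) rfl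
  let φ : Hom P Q h := ⟨lift h P Q, lift_commutes_zero _ _ _⟩
  rw [mk₀_comp_extMk f _ rfl hf φ, extToOld_extMk, extToOld_extMk, oldExtMk, oldExtMk,
    ← ModuleCat.comp_apply,
    isoExt_pre P Q Y φ, ModuleCat.comp_apply, CochainComplex.homologyMap_classOf]
  rfl

end CategoryTheory.ProjectiveResolution

/-! ### Local cohomology as a filtered colimit of `Ext` groups. -/

namespace localCohomology

open Abelian Limits

variable {R : Type u} [CommRing R] (I : Ideal R) {M N : ModuleCat.{u} R} {n : ℕ}

/-- The module `R ⧸ I ^ t`. -/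
abbrev quotPow (t : ℕ) : ModuleCat.{u} R := (ringModIdeals (idealPowersDiagram I)).obj (op t)

/-- The projection `R ⧸ I ^ s → R ⧸ I ^ t`. -/
abbrev quotPowMap {t s : ℕ} (h : t ≤ s) : quotPow I s ⟶ quotPow I t :=
  (ringModIdeals (idealPowersDiagram I)).map (homOfLE h).op

/-- The class in local cohomology of an element of `Ext^n(R ⧸ I ^ t, M)`. -/
def of (t : ℕ) : Ext (quotPow I t) M n →+ (localCohomology I n).obj M :=
  AddMonoidHom.comp
      ((colimit.ι (diagram (idealPowersDiagram I) n) (op (op t))).app M).hom.toAddMonoidHom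
    (projectiveResolution (quotPow I t)).extToOld

end localCohomology

namespace localCohomology

open Abelian Limits

variable {R : Type u} [CommRing R] (I : Ideal R) {M N : ModuleCat.{u} R} {n : ℕ}

lemma of_apply (t : ℕ) (α : Ext (quotPow I t) M n) : of I t α =
    (colimit.ι (diagram (idealPowersDiagram I) n) (op (op t))).app M
      ((projectiveResolution (quotPow I t)).extToOld α) := rfl

lemma map_of (t : ℕ) (α : Ext (quotPow I t) M n) (F : M ⟶ N) :
    (localCohomology I n).map F (of I t α) = of I t (α.comp (Ext.mk₀ F) (add_zero n)) := by
  rw [of_apply, of_apply, ProjectiveResolution.extToOld_comp]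
  exact congrArg (fun f => f.hom ((projectiveResolution (quotPow I t)).extToOld α))
    ((colimit.ι (diagram (idealPowersDiagram I) n) (op (op t))).naturality F).symm

lemma of_comp {t s : ℕ} (h : t ≤ s) (α : Ext (quotPow I t) M n) :
    of I s ((Ext.mk₀ (quotPowMap I h)).comp α (zero_add n)) = of I t α := by
  rw [of_apply, of_apply, ProjectiveResolution.comp_extToOld _ (projectiveResolution (quotPow I t))]
  have := colimit.w (diagram (idealPowersDiagram I) n) ((homOfLE h).op.op)
  exact congrArg (fun f => (f.app M).hom ((projectiveResolution (quotPow I t)).extToOld α)) this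

/-- Evaluation of the colimit that defines local cohomology. -/
def isColimitEval (M : ModuleCat.{u} R) (n : ℕ) :
    IsColimit
        (((evaluation _ _).obj M).mapCocone (colimit.cocone (diagram (idealPowersDiagram I) n))) :=
  isColimitOfPreserves ((evaluation (ModuleCat.{u} R) (ModuleCat.{u} R)).obj M)
    (colimit.isColimit (diagram (idealPowersDiagram I) n))

instance : PreservesFilteredColimitsOfSize.{0, 0} (forget (ModuleCat.{u} R)) :=
  preservesFilteredColimitsOfSize_shrink.{0, u, 0, u} _

/-- Evaluated at `M`, local cohomology is a filtered colimit of the `Ext^n(R ⧸ I ^ t, M)`. Hence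
each class lives at a finite stage and, by `exists_of_eq_zero`, a class that vanishes already
vanishes at a later stage. Long exact sequences can therefore be used stage by stage. -/
lemma exists_of (y : (localCohomology I n).obj M) : ∃ t α, of I t α = y := by
  obtain ⟨t, x, hx⟩ := Concrete.isColimit_exists_rep _ (isColimitEval I M n) y
  obtain ⟨α, rfl⟩ := (projectiveResolution (quotPow I t.unop.unop)).extToOld_bijective.2 x
  exact ⟨t.unop.unop, α, hx⟩

lemma exists_of_eq_zero {t : ℕ} (α : Ext (quotPow I t) M n) (h : of I t α = 0) :
    ∃ (s : ℕ) (h : t ≤ s), (Ext.mk₀ (quotPowMap I h)).comp α (zero_add n) = 0 := by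
  let F : ℕᵒᵖᵒᵖ ⥤ ModuleCat.{u} R := (diagram (idealPowersDiagram I) n) ⋙ (evaluation _ _).obj M
  let x : F.obj (op (op t)) := (projectiveResolution (quotPow I t)).extToOld α
  obtain ⟨s, f, g, hs⟩ := Concrete.isColimit_exists_of_rep_eq F (isColimitEval I M n) x 0
    (h.trans (map_zero ((colimit.ι (diagram (idealPowersDiagram I) n) (op (op t))).app M).hom).symm)
  refine ⟨s.unop.unop, leOfHom f.unop.unop, ?_⟩
  apply (projectiveResolution _).extToOld_bijective.1
  rw [ProjectiveResolution.comp_extToOld _ (projectiveResolution (quotPow I t)), map_zero]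
  exact hs.trans (map_zero (F.map g).hom)

lemma map_map_apply {M₁ M₂ M₃ : ModuleCat.{u} R} (f : M₁ ⟶ M₂) (g : M₂ ⟶ M₃)
    (y : (localCohomology I n).obj M₁) :
    (localCohomology I n).map g ((localCohomology I n).map f y) =
      (localCohomology I n).map (f ≫ g) y := by
  rw [Functor.map_comp, ModuleCat.comp_apply]

/-- The vanishing of `Ext^n(R ⧸ I ^ t, M)` for all `t`. -/
def ExtVanish (n : ℕ) (M : ModuleCat.{u} R) : Prop := ∀ t, Subsingleton (Ext (quotPow I t) M n)

variable {I} in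
lemma ExtVanish.eq_zero (h : ExtVanish I n M) (y : (localCohomology I n).obj M) : y = 0 := by
  obtain ⟨t, α, rfl⟩ := exists_of I y
  have := h t
  rw [Subsingleton.elim α 0, map_zero]

variable {I} in
lemma ExtVanish.map_injective (h : ExtVanish I n M) (F : M ⟶ N) :
    Function.Injective ((localCohomology I n).map F) := fun x y _ => by
  rw [h.eq_zero x, h.eq_zero y]

variable {I} in
-- In the long exact sequence `Ext^n(X₃)` sits between `Ext^n(X₂)` and `Ext^{n+1}(X₁)`.
lemma ExtVanish.of_shortExact {S : ShortComplex (ModuleCat.{u} R)} (hS : S.ShortExact)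
    (h₂ : ExtVanish I n S.X₂) (h₁ : ExtVanish I (n + 1) S.X₁) : ExtVanish I n S.X₃ := fun t => by
  have h1 := h₁ t
  have h2 := h₂ t
  refine subsingleton_of_forall_eq 0 fun x => ?_
  obtain ⟨y, hy⟩ := Ext.covariant_sequence_exact₃ _ hS x rfl (Subsingleton.elim _ _)
  rw [← hy, Subsingleton.elim y 0, Ext.zero_comp]

variable {I} in
lemma ExtVanish.of_retract (h : ExtVanish I n N) (i : M ⟶ N) (r : N ⟶ M) (hir : i ≫ r = 𝟙 M) :
    ExtVanish I n M := fun t => by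
  have h1 := h t
  refine subsingleton_of_forall_eq 0 fun x => ?_
  rw [← Ext.comp_mk₀_id x, ← hir, ← Ext.mk₀_comp_mk₀, ← Ext.comp_assoc _ _ _ (add_zero _) _
      (by simp),
    Subsingleton.elim (x.comp (Ext.mk₀ i) (add_zero n)) 0, Ext.zero_comp]

/-- Elements of `I ^ t` kill the classes coming from `Ext(R ⧸ I ^ t, -)`. -/
lemma map_smul_of {t : ℕ} {r : R} (hr : r ∈ I ^ t) (α : Ext (quotPow I t) M n) :
    (localCohomology I n).map (r • 𝟙 M) (of I t α) = 0 := by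
  have h : r ∈ Module.annihilator R (quotPow I t) := by
    change r ∈ Module.annihilator R (R ⧸ I ^ t)
    rwa [Ideal.annihilator_quotient]
  rw [map_of]
  have := Ext.postcomp_smul_id_eq_zero_of_mem_annihilator (M := M) h n
  have h2 := congrArg (fun f => f.hom α) this
  rw [show α.comp (Ext.mk₀ (r • 𝟙 M)) (add_zero n) = 0 from h2, map_zero]

/-- A nonzero class that lies in the kernel of a homomorphism has a nonzero multiple in the socle.
    -/
lemma exists_socle (F : M ⟶ N) (y : (localCohomology I n).obj M) (hy : y ≠ 0)
    (hF : (localCohomology I n).map F y = 0) :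
    ∃ y' : (localCohomology I n).obj M, y' ≠ 0 ∧ (localCohomology I n).map F y' = 0 ∧
      ∀ r ∈ I, (localCohomology I n).map (r • 𝟙 M) y' = 0 := by
  classical
  -- Some power of `I` kills `y`. The least such exponent is positive because `y ≠ 0`, and an
  -- element of the preceding power that does not kill `y` gives the required multiple.
  have hex : ∃ t : ℕ, ∀ r ∈ I ^ t, (localCohomology I n).map (r • 𝟙 M) y = 0 := by
    obtain ⟨t, α, rfl⟩ := exists_of I y
    exact ⟨t, fun r hr => map_smul_of I hr α⟩
  obtain ⟨ht, hmin⟩ := Nat.find_spec hex, fun m => Nat.find_min (m := m) hex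
  rcases h0 : Nat.find hex with _ | t
  · rw [h0] at ht
    have := ht 1 (by simp)
    rw [one_smul, CategoryTheory.Functor.map_id] at this
    exact absurd this hy
  · have := hmin t (by omega)
    push Not at this
    obtain ⟨s, hs, hsy⟩ := this
    refine ⟨_, hsy, ?_, fun r hr => ?_⟩
    · rw [map_map_apply, show (s • 𝟙 M) ≫ F = F ≫ (s • 𝟙 N) by simp, ← map_map_apply, hF, map_zero]
    · rw [map_map_apply, show (s • 𝟙 M) ≫ (r • 𝟙 M) =
        (s * r) • 𝟙 M by simp [mul_smul, smul_comm s r]]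
      rw [h0] at ht
      exact ht _ (pow_succ I t ▸ Ideal.mul_mem_mul hs hr)

variable {I} in
/-- Descent of injectivity along connecting homomorphisms. -/
lemma eq_zero_of_connecting {S S' : ShortComplex (ModuleCat.{u} R)} (hS : S.ShortExact)
    (hS' : S'.ShortExact) (c : S ⟶ S') (hv : ExtVanish I n S'.X₂) {G₁ G₃ : ModuleCat.{u} R}
    (a : S.X₁ ⟶ G₁) (w : G₁ ⟶ S'.X₁) (haw : a ≫ w = c.τ₁) (v : S'.X₃ ⟶ G₃)
    (hinj : Function.Injective ((localCohomology I n).map (c.τ₃ ≫ v)))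
    (y : (localCohomology I (n + 1)).obj S.X₁)
    (hy : (localCohomology I (n + 1)).map S.f y = 0)
    (hay : (localCohomology I (n + 1)).map a y = 0) : y = 0 := by
  -- The diagram chase takes place in `Ext` at a finite stage. Each vanishing known only in the
  -- colimit is made true by enlarging the stage.
  obtain ⟨t, β, rfl⟩ := exists_of I y
  rw [map_of] at hy
  obtain ⟨s, hs, h1⟩ := exists_of_eq_zero I _ hy
  rw [← of_comp I hs, map_of] at hay
  rw [← of_comp I hs]
  obtain ⟨s', hs', h2⟩ := exists_of_eq_zero I _ hay
  rw [← Ext.comp_assoc _ _ _ (zero_add _) _ (by simp)] at h1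
  rw [← of_comp I hs']
  generalize (Ext.mk₀ (quotPowMap I hs)).comp β (zero_add (n + 1)) = β' at *
  rw [← Ext.comp_assoc _ _ _ (zero_add _) _ (by simp)] at h2
  replace h1 : ((Ext.mk₀ (quotPowMap I hs')).comp β' (zero_add _)).comp (Ext.mk₀ S.f) (add_zero _) =
      0 := by
    rw [Ext.comp_assoc _ _ _ (zero_add _) (add_zero _) (by simp), h1, Ext.comp_zero]
  generalize (Ext.mk₀ (quotPowMap I hs')).comp β' (zero_add (n + 1)) = γ at *
  obtain ⟨α, hα⟩ := Ext.covariant_sequence_exact₁ _ hS γ h1 rfl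
  -- By naturality of extension classes, the connecting map of `S'` sends the image of `α` under
  -- `c.τ₃` to the image of `γ` under `c.τ₁`. The latter factors through `a`, which kills `γ`.
  have h3 : (α.comp (Ext.mk₀ c.τ₃) (add_zero _)).comp hS'.extClass rfl = 0 := by
    rw [Ext.comp_assoc _ _ _ (add_zero _) (zero_add 1) (by simp),
        ← ShortComplex.ShortExact.extClass_naturality hS hS' c,
      ← Ext.comp_assoc _ _ _ rfl (add_zero 1) (by simp), hα, ← haw, ← Ext.mk₀_comp_mk₀,
      ← Ext.comp_assoc _ _ _ (add_zero _) (by simp) (by simp), h2, Ext.zero_comp]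
  -- The image of `α` under `c.τ₃` therefore lifts to `Ext^n` of the middle term of `S'`, which is
  -- zero. Injectivity of `c.τ₃ ≫ v` then kills the class of `α` in the colimit.
  obtain ⟨α', hα'⟩ := Ext.covariant_sequence_exact₃ _ hS' _ rfl h3
  have := hv s'
  rw [Subsingleton.elim α' 0, Ext.zero_comp] at hα'
  have h4 : of I s' α = 0 := by
    apply hinj
    rw [map_of, ← Ext.mk₀_comp_mk₀, ← Ext.comp_assoc _ _ _ (add_zero _) (by simp) (by simp), ← hα',
      Ext.zero_comp]
    simp only [map_zero]
  -- The representative `α` itself vanishes at a still later stage, and with it the connecting image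
  -- of `α`.
  obtain ⟨s'', hs'', h5⟩ := exists_of_eq_zero I _ h4
  rw [← of_comp I hs'', ← hα, ← Ext.comp_assoc _ _ _ (zero_add _) rfl (by omega), h5, Ext.zero_comp,
    map_zero]

end localCohomology

end

/-! ### Differential forms under a surjection `R → A` with principal kernel. -/

noncomputable section

namespace CartierForms
variable (k R A : Type u) [CommRing k] [CommRing R] [CommRing A] [Algebra k R] [Algebra k A]
    [Algebra R A] [IsScalarTower k R A]

/-- The ring homomorphism on forms induced by a ring homomorphism. -/
def formsMap : Forms k R →ₐ[R] Forms k A :=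
  ExteriorAlgebra.lift R ⟨((ExteriorAlgebra.ι A).restrictScalars R).comp
      (KaehlerDifferential.map k k R A),
    fun _ => ExteriorAlgebra.ι_sq_zero _⟩

lemma formsMap_ι (w : Ω[R⁄k]) : formsMap k R A (ExteriorAlgebra.ι R w) =
    ExteriorAlgebra.ι A (KaehlerDifferential.map k k R A w) :=
  ExteriorAlgebra.lift_ι_apply R _ _ w

lemma formsMap_algebraMap (a : R) : formsMap k R A (algebraMap R _ a) =
    algebraMap A _ (algebraMap R A a) := by
  rw [AlgHom.commutes, IsScalarTower.algebraMap_apply R A]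

lemma formsMap_smul (a : R) (x : Forms k R) : formsMap k R A (a • x) =
    algebraMap R A a • formsMap k R A x := by
  rw [map_smul, algebraMap_smul]

lemma formsMap_dform (a : R) : formsMap k R A (dform k a) = dform k (algebraMap R A a) := by
  rw [dform, formsMap_ι, KaehlerDifferential.map_D]; rfl

lemma formsMap_sgn (x : Forms k R) : formsMap k R A (sgn x) = sgn (formsMap k R A x) := by
  induction x using CliffordAlgebra.induction with
  | algebraMap r => rw [AlgHom.commutes, formsMap_algebraMap, AlgHom.commutes]
  | ι w =>
    change formsMap k R A (sgn (ExteriorAlgebra.ι R w)) =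
        sgn (formsMap k R A (ExteriorAlgebra.ι R w))
    rw [sgn_ι, map_neg, formsMap_ι, sgn_ι]
  | mul a b ha hb => rw [map_mul, map_mul, ha, hb, map_mul, map_mul]
  | add a b ha hb => rw [map_add, map_add, ha, hb, map_add, map_add]

lemma formsMap_extDeriv (x : Forms k R) : formsMap k R A (extDeriv k R x) =
    extDeriv k A (formsMap k R A x) := by
  induction x using CliffordAlgebra.induction with
  | algebraMap r =>
      rw [extDeriv_algebraMap, formsMap_algebraMap, extDeriv_algebraMap, formsMap_dform]
  | ι w =>
    change formsMap k R A (extDeriv k R (ExteriorAlgebra.ι R w)) =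
        extDeriv k A (formsMap k R A (ExteriorAlgebra.ι R w))
    induction w using range_D_induction with
    | smul a b =>
      rw [map_smul]
      change formsMap k R A (extDeriv k R (a • dform k b)) =
          extDeriv k A (formsMap k R A (a • dform k b))
      rw [extDeriv_smul, extDeriv_dform, formsMap_smul, extDeriv_smul, formsMap_dform,
          extDeriv_dform,
        map_add, map_mul, formsMap_dform, formsMap_dform]
      simp
    | add x y hx hy => rw [map_add, map_add, map_add, hx, hy, map_add, map_add]
  | mul a b ha hb =>
    rw [extDeriv_mul, map_add, map_mul, map_mul, map_mul, extDeriv_mul, ha, hb, formsMap_sgn]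
  | add a b ha hb => rw [map_add, map_add, ha, hb, map_add, map_add]

lemma formsMap_mem {n : ℕ} {x : Forms k R} (hx : x ∈ ⋀[R]^n (Ω[R⁄k])) :
    formsMap k R A x ∈ ⋀[A]^n (Ω[A⁄k]) := by
  induction hx using Submodule.pow_induction_on_left' with
  | algebraMap r =>
      rw [formsMap_algebraMap, ExteriorAlgebra.exteriorPower, pow_zero];
      exact Submodule.algebraMap_mem _
  | add x y i _ _ hx hy => rw [map_add]; exact add_mem hx hy
  | mem_mul m hm i x _ hx =>
    obtain ⟨m, rfl⟩ := hm
    rw [map_mul, formsMap_ι, ExteriorAlgebra.exteriorPower, pow_succ']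
    exact Submodule.mul_mem_mul ⟨_, rfl⟩ hx

/-- The map induced on forms of degree `n`, as a semilinear map. -/
def formsMapDeg (n : ℕ) : ⋀[R]^n (Ω[R⁄k]) →ₛₗ[algebraMap R A] ⋀[A]^n (Ω[A⁄k]) where
  toFun x := ⟨formsMap k R A x, formsMap_mem k R A x.2⟩
  map_add' x y := by ext; simp
  map_smul' a x := Subtype.ext (formsMap_smul k R A a x)

lemma coe_formsMapDeg (n : ℕ) (x : ⋀[R]^n (Ω[R⁄k])) : (formsMapDeg k R A n x : Forms k A) =
    formsMap k R A x := rfl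

lemma formsMap_ιMulti {n : ℕ} (w : Fin n → Ω[R⁄k]) :
    formsMapDeg k R A n (exteriorPower.ιMulti R n w) =
      exteriorPower.ιMulti A n fun i => KaehlerDifferential.map k k R A (w i) := by
  apply Subtype.ext
  change formsMap k R A (ExteriorAlgebra.ιMulti R n w) = ExteriorAlgebra.ιMulti A n _
  rw [ExteriorAlgebra.ιMulti_apply, ExteriorAlgebra.ιMulti_apply, map_list_prod, List.map_ofFn]
  congr 2
  funext i
  exact formsMap_ι k R A _

/-- Forms are sums of `a D b₁ ∧ ⋯ ∧ D bₙ`. -/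
lemma exteriorPower_D_induction {n : ℕ} {P : ⋀[A]^n (Ω[A⁄k]) → Prop} (x : ⋀[A]^n (Ω[A⁄k]))
    (smul : ∀ (a : A) (b : Fin n → A),
        P (a • exteriorPower.ιMulti A n fun i => KaehlerDifferential.D k A (b i)))
    (add : ∀ x y, P x → P y → P (x + y)) : P x := by
  have hw : x ∈ Submodule.span A (Set.range fun b : Fin n → A => exteriorPower.ιMulti A n fun i =>
      KaehlerDifferential.D k A (b i)) := by
    have h := exteriorPower.ιMulti_span_of_span A n _
        (KaehlerDifferential.span_range_derivation k A)
    refine (?_ : _ ≤ Submodule.span A _) (h ▸ Submodule.mem_top : x ∈ _)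
    refine Submodule.span_mono ?_
    rintro _ ⟨w, hw, rfl⟩
    choose b hb using fun i => hw ⟨i, rfl⟩
    exact ⟨b, by simp only [hb]⟩
  induction hw using Submodule.closure_induction with
  | zero => simpa using smul 0 0
  | add x y _ _ hx hy => exact add x y hx hy
  | smul_mem a x hx => obtain ⟨b, rfl⟩ := hx; exact smul a b


variable (hsurj : Function.Surjective (algebraMap R A))

include hsurj in
lemma formsMapDeg_surjective (n : ℕ) : Function.Surjective (formsMapDeg k R A n) := by
  intro x
  induction x using exteriorPower_D_induction with
  | smul a b =>
    obtain ⟨a, rfl⟩ := hsurj a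
    choose c hc using fun i => hsurj (b i)
    refine ⟨a • exteriorPower.ιMulti R n fun i => KaehlerDifferential.D k R (c i), ?_⟩
    rw [map_smulₛₗ, formsMap_ιMulti]
    simp only [KaehlerDifferential.map_D, hc]
  | add x y hx hy =>
    obtain ⟨x, rfl⟩ := hx
    obtain ⟨y, rfl⟩ := hy
    exact ⟨x + y, map_add _ x y⟩

section Kernel

/-- The ideal of forms generated by `f` and `D f`. -/
def diffIdeal (f : R) : Ideal (Forms k R) where
  carrier := {x | ∃ α β, x = f • α + dform k f * β}
  add_mem' := by
    rintro _ _ ⟨α, β, rfl⟩ ⟨α', β', rfl⟩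
    exact ⟨α + α', β + β', by rw [smul_add, mul_add]; abel⟩
  zero_mem' := ⟨0, 0, by simp⟩
  smul_mem' := by
    rintro c _ ⟨α, β, rfl⟩
    refine ⟨c * α, sgn c * β, ?_⟩
    have h : dform k f * sgn c = c * dform k f := by
      rw [dform, ι_mul_comm]
      congr 1
      exact CliffordAlgebra.involute_involute c
    rw [smul_eq_mul, mul_add, mul_smul_comm, ← mul_assoc, ← mul_assoc, h]

instance (f : R) : (diffIdeal k R f).IsTwoSided where
  mul_mem_of_left := by
    rintro _ c ⟨α, β, rfl⟩
    exact ⟨α * c, β * c, by rw [add_mul, smul_mul_assoc, mul_assoc]⟩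

variable {k R A} in
include hsurj in
/-- Ring homomorphisms from `Forms k R` that kill the kernel of `R → A` and its differentials
factor through `Forms k A`. -/
lemma exists_factor_formsMap {Q : Type u} [Ring Q] (q : Forms k R →+* Q)
    (hq : ∀ a ∈ RingHom.ker (algebraMap R A), q (algebraMap R _ a) = 0 ∧ q (dform k a) = 0) :
    ∃ g : Forms k A →+* Q, ∀ x, g (formsMap k R A x) = q x := by
  let q₀ : A →+* Q := (algebraMap R A).liftOfSurjective hsurj
    ⟨(q : Forms k R →+* Q).comp (algebraMap R _), fun a ha => (hq a ha).1⟩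
  have hq₀ : ∀ a : R, q₀ (algebraMap R A a) = q (algebraMap R _ a) := fun a =>
    RingHom.liftOfRightInverse_comp_apply _ _ _ _ a
  have hq₁ : ∀ a b : R, algebraMap R A a = algebraMap R A b → q (dform k a) = q (dform k b) := by
    intro a b h
    rw [← sub_eq_zero, ← map_sub, dform, dform, ← map_sub, ← map_sub]
    exact (hq _ (by rw [RingHom.mem_ker, map_sub, h, sub_self])).2
  let s := Function.surjInv hsurj
  have hs : ∀ a, algebraMap R A (s a) = a := Function.surjInv_eq hsurj
  have hcomm : ∀ c x, q₀ c * q x = q x * q₀ c := fun c x => by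
    obtain ⟨c, rfl⟩ := hsurj c
    rw [hq₀, ← map_mul, ← map_mul, Algebra.commutes]
  -- Elements `q₀ c` are only known to commute with values of `q`, so the `A`-algebra structure is
  -- put on the range of `q` and not on `Q`.
  let _ : Algebra A q.range := (q₀.codRestrict q.range (fun c => by
    rw [← hs c, hq₀]; exact ⟨_, rfl⟩)).toAlgebra' (by
    rintro c ⟨_, x, rfl⟩
    exact Subtype.ext (hcomm c x))
  have hsmul : ∀ (a : A) (x : q.range), ((a • x : q.range) : Q) = q₀ a * x := fun a x => rfl
  let _ : Algebra k q.range := Algebra.compHom _ (algebraMap k A)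
  have : IsScalarTower k A q.range := IsScalarTower.of_algebraMap_eq fun _ => rfl
  let q' : Forms k R →+* q.range := q.rangeRestrict
  have hD : ∀ a, q (dform k (s (algebraMap R A a))) = q (dform k a) := fun a => hq₁ _ _ (hs _)
  have leib : ∀ a b, q (dform k (s (a * b))) = q₀ a * q (dform k (s b)) + q₀ b * q
      (dform k (s a)) := by
    intro a b
    rw [hq₁ (s (a * b)) (s a * s b) (by rw [map_mul, hs, hs, hs]), dform_mul, Algebra.smul_def,
      Algebra.smul_def, map_add, map_mul, map_mul, ← hq₀, ← hq₀, hs, hs]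
  -- By `hq₁` the value `q (dform k a)` depends only on the image of `a` in `A`, so an arbitrary
  -- set-theoretic section `s` yields an additive map satisfying the Leibniz rule.
  let D : Derivation k A q.range := Derivation.mk'
    { toFun := fun a => q' (dform k (s a))
      map_add' := fun a b => by
        rw [← map_add, ← dform_add]
        exact Subtype.ext (hq₁ _ _ (by rw [map_add, hs, hs, hs]))
      map_smul' := fun c a => by
        rw [RingHom.id_apply, ← algebraMap_smul A c (q' _)]
        apply Subtype.ext
        rw [hsmul]
        change q _ = q₀ _ * q _
        rw [Algebra.smul_def, leib, hq₁ (s (algebraMap k A c)) (algebraMap k R c)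
          (by rw [hs, ← IsScalarTower.algebraMap_apply])]
        simp [dform] }
    (fun a b => Subtype.ext (leib a b))
  have hL : ∀ w : Ω[R⁄k], (D.liftKaehlerDifferential (KaehlerDifferential.map k k R A w) : Q) =
      q (ExteriorAlgebra.ι R w) := by
    intro w
    induction w using range_D_induction with
    | smul a b =>
      rw [map_smul, KaehlerDifferential.map_D, ← algebraMap_smul A a, map_smul, hsmul,
        Derivation.liftKaehlerDifferential_comp_D, map_smul, Algebra.smul_def, map_mul, hq₀]
      exact congrArg _ (hD b)
    | add x y hx hy => rw [map_add, map_add, map_add, map_add, Subring.coe_add, hx, hy]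
  have hLsq : ∀ w, D.liftKaehlerDifferential w * D.liftKaehlerDifferential w = 0 := by
    intro w
    obtain ⟨w, rfl⟩ := KaehlerDifferential.map_surjective_of_surjective k k R A hsurj w
    apply Subtype.ext
    change (_ : Q) * _ = 0
    rw [hL, ← map_mul, ExteriorAlgebra.ι_sq_zero, map_zero]
  let g := ExteriorAlgebra.lift A ⟨D.liftKaehlerDifferential, hLsq⟩
  refine ⟨q.range.subtype.comp g.toRingHom, fun x => ?_⟩
  change (g (formsMap k R A x) : Q) = q x
  induction x using CliffordAlgebra.induction with
  | algebraMap r =>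
    rw [formsMap_algebraMap, AlgHom.commutes]
    exact hq₀ r
  | ι w =>
    change (g (formsMap k R A (ExteriorAlgebra.ι R w)) : Q) = q (ExteriorAlgebra.ι R w)
    rw [formsMap_ι, ← hL]
    congr 1
    exact ExteriorAlgebra.lift_ι_apply A _ _ _
  | mul a b ha hb => rw [map_mul, map_mul, map_mul, Subring.coe_mul, ha, hb]
  | add a b ha hb => rw [map_add, map_add, map_add, Subring.coe_add, ha, hb]

variable {k R A} in
include hsurj in
/-- The kernel of the map on forms. -/
lemma exists_of_formsMap_eq_zero {f : R} (hker : RingHom.ker (algebraMap R A) = Ideal.span {f})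
    {x : Forms k R} (hx : formsMap k R A x = 0) : ∃ α β, x = f • α + dform k f * β := by
  -- The universal property is applied to the quotient of the forms on `R` by the ideal of `f` and
  -- `df`. A form that dies on `A` then dies in this quotient. The identity `d(cf) = c df + f dc`
  -- shows that the hypothesis of the factorization holds.
  obtain ⟨g, hg⟩ := exists_factor_formsMap hsurj (Ideal.Quotient.mk (diffIdeal k R f))
      (fun a ha => by
    rw [hker, Ideal.mem_span_singleton'] at ha
    obtain ⟨c, rfl⟩ := ha
    refine ⟨Ideal.Quotient.eq_zero_iff_mem.mpr ⟨algebraMap R _ c, 0, ?_⟩,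
      Ideal.Quotient.eq_zero_iff_mem.mpr ⟨dform k c, algebraMap R _ c, ?_⟩⟩
    · rw [mul_zero, add_zero, mul_comm, map_mul, Algebra.smul_def]
    · rw [dform_mul, ← Algebra.commutes, ← Algebra.smul_def, add_comm])
  have := hg x
  rw [hx, map_zero] at this
  exact Ideal.Quotient.eq_zero_iff_mem.mp this.symm

variable {k R A} in
include hsurj in
lemma exists_of_formsMapDeg_zero_eq_zero {f : R}
    (hker : RingHom.ker (algebraMap R A) = Ideal.span {f})
    {x : ⋀[R]^0 (Ω[R⁄k])} (hx : formsMapDeg k R A 0 x = 0) : ∃ α, x = f • α := by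
  obtain ⟨α, β, h⟩ := exists_of_formsMap_eq_zero (k := k) (x := x.1) hsurj hker
      (congrArg Subtype.val hx)
  have h0 : ∀ β, component k R 0 (dform k f * β) = 0 := by
    intro β
    clear h
    induction β using DirectSum.Decomposition.inductionOn (fun i : ℕ => ⋀[R]^i (Ω[R⁄k])) with
    | zero => simp
    | @homogeneous i m =>
      refine component_of_ne k R (m := i + 1) (by omega) ?_
      rw [ExteriorAlgebra.exteriorPower, pow_succ']
      exact Submodule.mul_mem_mul ⟨_, rfl⟩ m.2
    | add m m' h h' => rw [mul_add, map_add, h, h', add_zero]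
  refine ⟨component k R 0 α, ?_⟩
  rw [← component_mem k R x, h, map_add, map_smul, h0, add_zero]

/-- Multiplication by `D f` from the left. -/
def wedgeD (f : R) (n : ℕ) : ⋀[R]^n (Ω[R⁄k]) →ₗ[R] ⋀[R]^(n + 1) (Ω[R⁄k]) where
  toFun x := ⟨dform k f * x, by
    rw [ExteriorAlgebra.exteriorPower, pow_succ']
    exact Submodule.mul_mem_mul ⟨_, rfl⟩ x.2⟩
  map_add' x y := Subtype.ext (mul_add _ _ _)
  map_smul' a x := Subtype.ext (mul_smul_comm _ _ _)

lemma coe_wedgeD (f : R) (n : ℕ) (x : ⋀[R]^n (Ω[R⁄k])) : (wedgeD k R f n x : Forms k R) =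
    dform k f * x := rfl

lemma component_wedgeD (f : R) (n : ℕ) (x : Forms k R) :
    component k R (n + 1) (dform k f * x) = wedgeD k R f n (component k R n x) := by
  induction x using DirectSum.Decomposition.inductionOn (fun i : ℕ => ⋀[R]^i (Ω[R⁄k])) with
  | zero => simp
  | @homogeneous i m =>
    by_cases h : i = n
    · subst h
      rw [component_mem]
      exact component_mem k R (wedgeD k R f i m)
    · rw [component_of_ne k R h m.2, map_zero]
      exact component_of_ne k R (fun h' => h (Nat.succ_injective h')) (wedgeD k R f i m).2
  | add m m' h h' => rw [mul_add, map_add, map_add, h, h', map_add]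

variable {k R A} in
include hsurj in
lemma exists_of_formsMapDeg_succ_eq_zero {f : R}
    (hker : RingHom.ker (algebraMap R A) = Ideal.span {f})
    {n : ℕ} {x : ⋀[R]^(n + 1) (Ω[R⁄k])} (hx : formsMapDeg k R A (n + 1) x = 0) :
    ∃ α β, x = f • α + wedgeD k R f n β := by
  obtain ⟨α, β, h⟩ := exists_of_formsMap_eq_zero (k := k) (x := x.1) hsurj hker
      (congrArg Subtype.val hx)
  refine ⟨component k R (n + 1) α, component k R n β, ?_⟩
  rw [← component_wedgeD, ← map_smul, ← map_add, ← h, component_mem]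

variable {k R A} in
lemma formsMapDeg_wedgeD {f : R} (hf : algebraMap R A f = 0) (n : ℕ) (x : ⋀[R]^n (Ω[R⁄k])) :
    formsMapDeg k R A (n + 1) (wedgeD k R f n x) = 0 := by
  apply Subtype.ext
  rw [coe_formsMapDeg, coe_wedgeD, map_mul, formsMap_dform, hf]
  simp [dform]

lemma wedgeD_wedgeD (f : R) (n : ℕ) (x : ⋀[R]^n (Ω[R⁄k])) :
    wedgeD k R f (n + 1) (wedgeD k R f n x) = 0 := by
  apply Subtype.ext
  rw [coe_wedgeD, coe_wedgeD, ← mul_assoc, dform, ExteriorAlgebra.ι_sq_zero, zero_mul]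
  rfl

end Kernel

/-! ### The rows of the modules `GΩ` and their compatibility with `C⁻¹`. -/

section Frobenius

variable (p : ℕ) [Fact p.Prime] [CharP R p] [CharP A p]

/-- The map `F_* Ω^n → F_* Ω^n` induced by a ring homomorphism. -/
def frobMap (n : ℕ) :
    FrobPush p (⋀[R]^n (Ω[R⁄k])) →ₛₗ[algebraMap R A] FrobPush p (⋀[A]^n (Ω[A⁄k])) where
  toFun x := FrobPush.of p _ (formsMapDeg k R A n ((FrobPush.of p _).symm x))
  map_add' x y := by rw [map_add, map_add, map_add]
  map_smul' a x := by
    obtain ⟨x, rfl⟩ := (FrobPush.of p _).surjective x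
    rw [FrobPush.smul_of, AddEquiv.symm_apply_apply, AddEquiv.symm_apply_apply, FrobPush.smul_of,
      map_smulₛₗ, map_pow]

lemma frobMap_of (n : ℕ) (x : ⋀[R]^n (Ω[R⁄k])) :
    frobMap k R A p n (FrobPush.of p _ x) = FrobPush.of p _ (formsMapDeg k R A n x) := rfl

lemma frobMap_frobDeriv (n : ℕ) (x : FrobPush p (⋀[R]^n (Ω[R⁄k]))) :
    frobMap k R A p (n + 1) (frobDeriv k R p n x) = frobDeriv k A p n (frobMap k R A p n x) :=
  congrArg (FrobPush.of p _) (Subtype.ext (formsMap_extDeriv k R A _))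

lemma frobMap_mem_boundaries (n : ℕ) :
    boundaries k R p n ≤ (boundaries k A p n).comap (frobMap k R A p n) := by
  intro x hx
  cases n with
  | zero =>
    rw [(Submodule.mem_bot R).mp hx]
    exact zero_mem _
  | succ n =>
    obtain ⟨y, rfl⟩ := hx
    exact ⟨_, (frobMap_frobDeriv k R A p n y).symm⟩

/-- The map `GΩ^n → GΩ^n` induced by a ring homomorphism. -/
def gMap (n : ℕ) : GForms k R p n →ₛₗ[algebraMap R A] GForms k A p n :=
  Submodule.mapQ _ _ (frobMap k R A p n) (frobMap_mem_boundaries k R A p n)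

lemma gMap_mkQ (n : ℕ) (x : FrobPush p (⋀[R]^n (Ω[R⁄k]))) :
    gMap k R A p n ((boundaries k R p n).mkQ x) = (boundaries k A p n).mkQ (frobMap k R A p n x) :=
        rfl

lemma gMap_inverseCartier (n : ℕ) (x : ⋀[R]^n (Ω[R⁄k])) :
    gMap k R A p n (inverseCartier k R p n x) = inverseCartier k A p n (formsMapDeg k R A n x) := by
  induction x using exteriorPower_D_induction with
  | smul a b =>
    rw [inverseCartier_apply, gMap_mkQ, frobMap_of, map_smulₛₗ (formsMapDeg k R A n),
      map_smulₛₗ (formsMapDeg k R A n), formsMap_ιMulti, formsMap_ιMulti]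
    simp only [KaehlerDifferential.map_D]
    rw [inverseCartier_apply, map_pow]
    congr 5
    funext i
    rw [map_smul, KaehlerDifferential.map_D, ← algebraMap_smul A, map_pow]
  | add x y hx hy => rw [map_add, map_add, hx, hy, map_add, map_add]

variable {k R A} in
include hsurj in
-- A boundary on `A` lifts to a boundary on `R` because forms lift. Subtracting it keeps the class
-- and produces a representative whose image on `A` is zero, not merely exact.
lemma exists_of_gMap_eq_zero {n : ℕ} {x : GForms k R p n} (hx : gMap k R A p n x = 0) :
    ∃ ω, formsMapDeg k R A n ω = 0 ∧ x = (boundaries k R p n).mkQ (FrobPush.of p _ ω) := by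
  obtain ⟨x, rfl⟩ := Submodule.mkQ_surjective _ x
  rw [gMap_mkQ, Submodule.mkQ_apply, Submodule.Quotient.mk_eq_zero] at hx
  cases n with
  | zero =>
    exact ⟨x, (Submodule.mem_bot A (M := FrobPush p (⋀[A]^0 (Ω[A⁄k])))).mp hx, rfl⟩
  | succ n =>
    obtain ⟨y, hy⟩ := hx
    obtain ⟨z, hz⟩ := formsMapDeg_surjective k R A hsurj n ((FrobPush.of p _).symm y)
    have hz' : frobMap k R A p n (FrobPush.of p _ z) = y := by
      rw [frobMap_of, hz, AddEquiv.apply_symm_apply]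
    refine ⟨(FrobPush.of p _).symm (x - frobDeriv k R p n (FrobPush.of p _ z)), ?_, ?_⟩
    · apply (FrobPush.of p _).injective
      rw [← frobMap_of, AddEquiv.apply_symm_apply, map_sub, frobMap_frobDeriv, hz', hy, sub_self,
        map_zero]
    · rw [AddEquiv.apply_symm_apply, map_sub]
      have : (boundaries k R p (n + 1)).mkQ (frobDeriv k R p n (FrobPush.of p _ z)) = 0 := by
        rw [Submodule.mkQ_apply, Submodule.Quotient.mk_eq_zero]
        exact ⟨_, rfl⟩
      rw [this, sub_zero]

omit [Fact p.Prime] [CharP R p] in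
-- The one-form `f^(p-1) df` is closed, since `df ∧ df = 0`. Wedging with it therefore preserves
-- exact forms, and this makes `gWedge` well defined.
lemma extDeriv_pow_smul_dform_mul (f : R) (x : Forms k R) :
    extDeriv k R (f ^ (p - 1) • (dform k f * x)) = - (f ^ (p - 1) • (dform k f * extDeriv k R x)) :=
        by
  rw [extDeriv_smul, extDeriv_mul, extDeriv_dform, zero_mul, zero_add, dform, dform, sgn_ι,
    Derivation.leibniz_pow, map_nsmul, map_smul, smul_mul_assoc, smul_mul_assoc, ← mul_assoc,
    ExteriorAlgebra.ι_sq_zero, zero_mul, smul_zero, smul_zero, zero_add, neg_mul, smul_neg]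

/-- Multiplication by `f ^ (p - 1) D f` on `F_* Ω^n`. -/
def frobWedge (f : R) (n : ℕ) :
    FrobPush p (⋀[R]^n (Ω[R⁄k])) →ₗ[R] FrobPush p (⋀[R]^(n + 1) (Ω[R⁄k])) where
  toFun x := FrobPush.of p _ (f ^ (p - 1) • wedgeD k R f n ((FrobPush.of p _).symm x))
  map_add' x y := by rw [map_add, map_add, smul_add, map_add]
  map_smul' a x := by
    obtain ⟨x, rfl⟩ := (FrobPush.of p _).surjective x
    rw [FrobPush.smul_of, AddEquiv.symm_apply_apply, AddEquiv.symm_apply_apply, RingHom.id_apply,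
      FrobPush.smul_of, map_smul (wedgeD k R f n), smul_comm]

lemma frobWedge_of (f : R) (n : ℕ) (x : ⋀[R]^n (Ω[R⁄k])) :
    frobWedge k R p f n (FrobPush.of p _ x) = FrobPush.of p _ (f ^ (p - 1) • wedgeD k R f n x) :=
        rfl

lemma frobWedge_mem_boundaries (f : R) (n : ℕ) :
    boundaries k R p n ≤ (boundaries k R p (n + 1)).comap (frobWedge k R p f n) := by
  intro x hx
  cases n with
  | zero =>
    rw [(Submodule.mem_bot R).mp hx]
    exact zero_mem _
  | succ n =>
    obtain ⟨y, rfl⟩ := hx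
    refine ⟨- frobWedge k R p f n y, ?_⟩
    rw [map_neg, neg_eq_iff_eq_neg]
    exact congrArg (FrobPush.of p _) (Subtype.ext (extDeriv_pow_smul_dform_mul k R p f _))

/-- Multiplication by `f ^ (p - 1) D f` on `GΩ^n`. -/
def gWedge (f : R) (n : ℕ) : GForms k R p n →ₗ[R] GForms k R p (n + 1) :=
  Submodule.mapQ _ _ (frobWedge k R p f n) (frobWedge_mem_boundaries k R p f n)

lemma gWedge_mkQ (f : R) (n : ℕ) (x : FrobPush p (⋀[R]^n (Ω[R⁄k]))) :
    gWedge k R p f n ((boundaries k R p n).mkQ x) =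
      (boundaries k R p (n + 1)).mkQ (frobWedge k R p f n x) := rfl

lemma wedgeD_ιMulti (f : R) (n : ℕ) (w : Fin n → Ω[R⁄k]) :
    wedgeD k R f n (exteriorPower.ιMulti R n w) =
      exteriorPower.ιMulti R (n + 1) (Matrix.vecCons (KaehlerDifferential.D k R f) w) := by
  apply Subtype.ext
  change dform k f * ExteriorAlgebra.ιMulti R n w = ExteriorAlgebra.ιMulti R (n + 1) _
  rw [ExteriorAlgebra.ιMulti_succ_apply]
  rfl

/-- `C⁻¹` is multiplicative and sends `df` to `f^(p-1) df`. This is the commutative square between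
the row of forms and the row of the `GΩ`. -/
lemma gWedge_inverseCartier (f : R) (n : ℕ) (x : ⋀[R]^n (Ω[R⁄k])) :
    gWedge k R p f n (inverseCartier k R p n x) = inverseCartier k R p (n + 1) (wedgeD k R f n x) :=
        by
  induction x using exteriorPower_D_induction with
  | smul a b =>
    rw [inverseCartier_apply, map_smul (wedgeD k R f n), wedgeD_ιMulti]
    have h1 :
        (Matrix.vecCons (KaehlerDifferential.D k R f) fun i => KaehlerDifferential.D k R (b i)) =
        fun i => KaehlerDifferential.D k R ((Matrix.vecCons f b : Fin (n + 1) → R) i) := by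
      funext i
      refine Fin.cases ?_ (fun i => ?_) i <;> rfl
    have h2 : (fun i => ((Matrix.vecCons f b : Fin (n + 1) → R) i) ^ (p - 1) •
        KaehlerDifferential.D k R ((Matrix.vecCons f b : Fin (n + 1) → R) i)) =
        Matrix.vecCons (f ^ (p - 1) • KaehlerDifferential.D k R f)
          fun i => b i ^ (p - 1) • KaehlerDifferential.D k R (b i) := by
      funext i
      refine Fin.cases ?_ (fun i => ?_) i <;> rfl
    rw [h1, inverseCartier_apply, h2, gWedge_mkQ, frobWedge_of, map_smul (wedgeD k R f n),
        wedgeD_ιMulti, smul_comm]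
    congr 3
    apply Subtype.ext
    change f ^ (p - 1) • ExteriorAlgebra.ιMulti R (n + 1) _ = ExteriorAlgebra.ιMulti R (n + 1) _
    rw [ExteriorAlgebra.ιMulti_succ_apply, ExteriorAlgebra.ιMulti_succ_apply]
    simp [Matrix.vecCons]
    rfl
  | add x y hx hy => rw [map_add, map_add, hx, hy, map_add, map_add]

variable {k R A} in
include hsurj in
/-- Multiplication by `f ^ (p - 1) D f` on `GΩ^n` is well defined on `A = R ⧸ (f)` modulo `f`. -/
lemma exists_gWedge_eq_smul {f : R} (hker : RingHom.ker (algebraMap R A) = Ideal.span {f})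
    {n : ℕ} {x : GForms k R p n} (hx : gMap k R A p n x = 0) :
    ∃ y, gWedge k R p f n x = f • y := by
  obtain ⟨ω, hω, rfl⟩ := exists_of_gMap_eq_zero hsurj p hx
  have hp : f ^ (p - 1) * f = f ^ p := by
    rw [← pow_succ, Nat.sub_add_cancel (Nat.Prime.pos Fact.out)]
  -- Modulo `f` the form `ω` is a multiple of `df`, so `df ∧ ω` is `f` times some `df ∧ α`. Together
  -- with the factor `f^(p-1)` this gives `f^p`, which is the action of the scalar `f` on `F_*`.
  have key : ∃ α, wedgeD k R f n ω = f • wedgeD k R f n α := by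
    cases n with
    | zero =>
      obtain ⟨α, rfl⟩ := exists_of_formsMapDeg_zero_eq_zero hsurj hker hω
      exact ⟨α, map_smul _ _ _⟩
    | succ n =>
      obtain ⟨α, β, rfl⟩ := exists_of_formsMapDeg_succ_eq_zero hsurj hker hω
      exact ⟨α, by rw [map_add, wedgeD_wedgeD, add_zero, map_smul]⟩
  obtain ⟨α, hα⟩ := key
  refine ⟨(boundaries k R p (n + 1)).mkQ (FrobPush.of p _ (wedgeD k R f n α)), ?_⟩
  rw [gWedge_mkQ, frobWedge_of, hα, smul_smul, hp, ← FrobPush.smul_of, map_smul]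

variable {k R A} in
lemma gMap_gWedge {f : R} (hf : algebraMap R A f = 0) (n : ℕ) (x : GForms k R p n) :
    gMap k R A p (n + 1) (gWedge k R p f n x) = 0 := by
  obtain ⟨x, rfl⟩ := Submodule.mkQ_surjective _ x
  rw [gWedge_mkQ, gMap_mkQ]
  obtain ⟨x, rfl⟩ := (FrobPush.of p _).surjective x
  rw [frobWedge_of, frobMap_of, map_smulₛₗ, formsMapDeg_wedgeD hf, smul_zero, map_zero, map_zero]

end Frobenius

end CartierForms

end

/-! ### Existence of `p`-bases. -/

noncomputable section

namespace CartierForms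

section Independence

open MvPolynomial

variable {K B ι : Type*} [CommRing K] [CommRing B] [Algebra K B] (p : ℕ) [Fact p.Prime] [CharP K p]
  (x : ι → B) (δ : ι → Derivation K B B)

lemma derivation_aeval [DecidableEq ι] (h : ∀ i j, δ i (x j) = if j = i then 1 else 0) (i : ι)
    (q : MvPolynomial ι K) :
    δ i (aeval x q) = aeval x (pderiv i q) := by
  induction q using MvPolynomial.induction_on with
  | C a => simp
  | add q r hq hr => simp only [map_add, hq, hr]
  | mul_X q j hq =>
    rw [map_mul, aeval_X, Derivation.leibniz, Derivation.leibniz, hq, h, pderiv_X, Pi.single_apply]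
    split_ifs with h1 <;> simp [h1, mul_comm]

/-- Polynomials of degree less than `p` in each variable do not vanish at a family that is part of
a dual system of derivations. -/
lemma eq_zero_of_aeval_eq_zero [DecidableEq ι] (hK : Function.Injective (algebraMap K B))
    (h : ∀ i j, δ i (x j) = if j = i then 1 else 0) (q : MvPolynomial ι K)
    (hq : ∀ e, (∃ i, p ≤ e i) → coeff e q = 0) (h0 : aeval x q = 0) : q = 0 := by
  induction hn : q.totalDegree using Nat.strong_induction_on generalizing q with
  | _ n ih =>
  -- By induction every partial derivative of `q` vanishes: it has smaller degree and, by the chain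
  -- rule, still vanishes at `x`. Its coefficient at `e` minus the `i`-th unit vector is `e i` times
  -- that of `q` at `e`, and `0 < e i < p` makes `e i` a unit. So `q` is constant.
  have hi : ∀ e i, e i ≠ 0 → coeff e q = 0 := by
    intro e i hei
    by_contra hne
    have hlt : e i < p := not_le.mp fun hle => hne (hq e ⟨i, hle⟩)
    have hp : pderiv i q = 0 := by
      by_cases hz : pderiv i q = 0
      · exact hz
      refine ih _ ?_ _ ?_ ?_ rfl
      · rw [← hn]
        obtain ⟨m, hm, hm'⟩ := Finset.exists_mem_eq_sup (pderiv i q).support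
            (support_nonempty.mpr hz)
          (fun s : ι →₀ ℕ => s.sum fun _ e => e)
        rw [mem_support_iff, coeff_pderiv] at hm
        have := le_totalDegree (mem_support_iff.mpr (left_ne_zero_of_mul hm))
        rw [Finsupp.sum_add_index' (fun _ => rfl) (fun _ _ _ => rfl), Finsupp.sum_single_index rfl]
            at this
        rw [totalDegree, hm']
        omega
      · rintro m ⟨j, hj⟩
        rw [coeff_pderiv, hq _ ⟨j, hj.trans (by simp)⟩, zero_mul]
      · rw [← derivation_aeval x δ h, h0, map_zero]
    have hc := congrArg (coeff (e - Finsupp.single i 1)) hp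
    have he : e - Finsupp.single i 1 + Finsupp.single i 1 = e := by
      ext j
      by_cases hj : i = j
      · subst hj; simp; omega
      · simp [hj]
    have hei' : (((e - Finsupp.single i 1 : ι →₀ ℕ) i : K) + 1) = (e i : K) := by
      rw [← Nat.cast_succ]
      congr 1
      simp; omega
    rw [coeff_pderiv, he, coeff_zero, hei'] at hc
    have hu : IsUnit (e i : K) := by
      have hcop : (e i).Coprime p :=
        ((Nat.Prime.coprime_iff_not_dvd Fact.out).mpr fun hd => hei
          (Nat.eq_zero_of_dvd_of_lt hd hlt)).symm
      let f := ZMod.castHom (dvd_refl p) K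
      have := (ZMod.unitOfCoprime (e i) hcop).isUnit.map f
      simpa using this
    exact hne ((hu.mul_left_eq_zero).mp hc)
  have hC : q = C (coeff 0 q) := by
    ext e
    rw [coeff_C]
    split_ifs with h1
    · rw [h1]
    · obtain ⟨i, hi'⟩ := Finsupp.ne_iff.mp (Ne.symm h1)
      exact hi e i hi'
  rw [hC, aeval_C] at h0
  rw [hC, (map_eq_zero_iff _ hK).mp h0, map_zero]

end Independence

section Span

variable (k B : Type u) [Field k] [PerfectField k] [CommRing B] [Algebra k B] (p : ℕ) [Fact p.Prime]
    [CharP B p]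

/-- Unramifiedness gives `t` with product 1 in `B` that annihilates every `b ⊗ 1 - 1 ⊗ b`. The
`p`-th power of such a difference is `b^p ⊗ 1 - 1 ⊗ b^p = 0`, so the kernel of multiplication is
nil, `t` is a unit and `b ⊗ 1 = 1 ⊗ b`. -/
lemma isEpi_of_pow_mem (S : Subring B) (hS : ∀ b : B, b ^ p ∈ S) [Algebra.EssFiniteType S B]
    [Algebra.FormallyUnramified S B] : Algebra.IsEpi S B := by
  rw [Algebra.isEpi_iff_forall_one_tmul_eq]
  obtain ⟨t, ht, ht'⟩ :=
      (Algebra.FormallyUnramified.iff_exists_tensorProduct (R := S) (S := B)).mp inferInstance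
  have hnil : KaehlerDifferential.ideal S B ≤ nilradical (TensorProduct S B B) := by
    rw [← KaehlerDifferential.span_range_eq_ideal, Ideal.span_le]
    rintro _ ⟨b, rfl⟩
    refine mem_nilradical.mpr ⟨p, ?_⟩
    rcases subsingleton_or_nontrivial (TensorProduct S B B) with h | h
    · exact Subsingleton.elim _ _
    have : CharP (TensorProduct S B B) p := (CharP.charP_iff_prime_eq_zero Fact.out).mpr (by
      rw [← map_natCast (algebraMap B (TensorProduct S B B)), CharP.cast_eq_zero, map_zero])
    rw [sub_pow_char, Algebra.TensorProduct.tmul_pow, Algebra.TensorProduct.tmul_pow, one_pow,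
        sub_eq_zero]
    have h1 : b ^ p = (⟨b ^ p, hS b⟩ : S) • (1 : B) := (mul_one _).symm
    rw [h1, TensorProduct.smul_tmul]
  have h1 : (1 : TensorProduct S B B) - t ∈ KaehlerDifferential.ideal S B := by
    rw [KaehlerDifferential.ideal, RingHom.mem_ker, map_sub, ht', map_one, sub_self]
  have hu : IsUnit t := by
    have := (mem_nilradical.mp (hnil h1)).isUnit_one_sub
    rwa [sub_sub_cancel] at this
  intro b
  exact sub_eq_zero.mp (hu.mul_left_eq_zero.mp (ht b))

variable {k B} in
-- All elements of `B` are integral over `S`, and `S` contains the image of `k` since `k` is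
-- perfect. A finite set generating `B` up to localization generates it over `S` without localizing,
-- because `1/s = s^(p-1) (1/s)^p` and `(1/s)^p` lies in `S`.
lemma finite_of_pow_mem [Algebra.EssFiniteType k B] (S : Subring B) (hS : ∀ b : B, b ^ p ∈ S) :
    Module.Finite S B := by
  have hk : ∀ c : k, algebraMap k B c ∈ S := by
    intro c
    rcases subsingleton_or_nontrivial B with h | h
    · rw [Subsingleton.elim (algebraMap k B c) 0]; exact zero_mem _
    have : CharP k p :=
        (RingHom.charP_iff (algebraMap k B) (algebraMap k B).injective p).mpr inferInstance
    obtain ⟨c, rfl⟩ := surjective_frobenius k p c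
    rw [frobenius_def, map_pow]
    exact hS _
  let T := Algebra.adjoin S (Algebra.EssFiniteType.finset k B : Set B)
  have hint : ∀ b : B, IsIntegral S b := fun b => IsIntegral.of_pow (Nat.Prime.pos Fact.out)
    (isIntegral_algebraMap (x := (⟨b ^ p, hS b⟩ : S)))
  have hle : ∀ b ∈ Algebra.EssFiniteType.subalgebra k B, b ∈ T := by
    intro b hb
    induction hb using Algebra.adjoin_induction with
    | mem x hx => exact Algebra.subset_adjoin hx
    | algebraMap c => exact T.algebraMap_mem ⟨_, hk c⟩
    | add x y _ _ hx hy => exact add_mem hx hy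
    | mul x y _ _ hx hy => exact mul_mem hx hy
  have hT : T = ⊤ := by
    refine eq_top_iff.mpr fun b _ => ?_
    obtain ⟨⟨a, s⟩, hs⟩ := IsLocalization.surj (Algebra.EssFiniteType.submonoid k B) b
    obtain ⟨u, hu⟩ : IsUnit (s : B) := IsLocalization.map_units B s
    have hb : b = a * s ^ (p - 1) * ((↑u⁻¹ : B) ^ p) := by
      have hp : (s : B) ^ (p - 1) * s = s ^ p := by
        rw [← pow_succ, Nat.sub_add_cancel (Nat.Prime.pos Fact.out)]
      change b * (s : B) = a at hs
      rw [← hs, mul_assoc b, mul_comm (s : B), hp, mul_assoc, ← mul_pow, ← hu, Units.mul_inv,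
          one_pow, mul_one]
    rw [hb]
    exact mul_mem (mul_mem (hle _ a.2) (pow_mem (hle _ s.1.2) _)) (T.algebraMap_mem ⟨_, hS _⟩)
  have hfg := fg_adjoin_of_finite (R := S) (Finset.finite_toSet (Algebra.EssFiniteType.finset k B))
      fun x _ => hint x
  change T.toSubmodule.FG at hfg
  rw [hT, Algebra.top_toSubmodule] at hfg
  exact ⟨hfg⟩

variable {k B} in
/-- If the differentials of `x` generate the module of differentials, then `x` generates `B` over
its subring of `p`-th powers. -/
lemma adjoin_range_frobenius_eq_top [Algebra.EssFiniteType k B] {ι : Type*} (x : ι → B)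
    (hx : Submodule.span B (Set.range fun i => KaehlerDifferential.D k B (x i)) = ⊤) :
    Algebra.adjoin (frobenius B p).range (Set.range x) = ⊤ := by
  let S := (Algebra.adjoin (frobenius B p).range (Set.range x)).toSubring
  have hS : ∀ b : B, b ^ p ∈ S := fun b =>
      (Algebra.adjoin (frobenius B p).range (Set.range x)).algebraMap_mem ⟨_, b, rfl⟩
  have hk : ∀ c : k, algebraMap k B c ∈ S := by
    intro c
    rcases subsingleton_or_nontrivial B with h | h
    · rw [Subsingleton.elim (algebraMap k B c) 0]; exact zero_mem _
    have : CharP k p :=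
        (RingHom.charP_iff (algebraMap k B) (algebraMap k B).injective p).mpr inferInstance
    obtain ⟨c, rfl⟩ := surjective_frobenius k p c
    rw [frobenius_def, map_pow]
    exact hS _
  have hfin := finite_of_pow_mem (k := k) p S hS
  let _ : Algebra k S := ((algebraMap k B).codRestrict S hk).toAlgebra
  have : IsScalarTower k S B := IsScalarTower.of_algebraMap_eq fun _ => rfl
  -- The differentials over `S` are a quotient of those over `k`, hence generated by the `d(x i)`,
  -- which vanish because `x i` lies in `S`. Then `S → B` is a finite epimorphism of rings and so
  -- surjective.
  have hu : Algebra.FormallyUnramified S B := by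
    refine ⟨subsingleton_of_forall_eq 0 fun w => ?_⟩
    obtain ⟨w, rfl⟩ :=
        KaehlerDifferential.map_surjective_of_surjective k S B B Function.surjective_id w
    have hw : w ∈ Submodule.span B (Set.range fun i => KaehlerDifferential.D k B (x i)) :=
        hx ▸ trivial
    induction hw using Submodule.span_induction with
    | mem w hw =>
      obtain ⟨i, rfl⟩ := hw
      rw [KaehlerDifferential.map_D]
      exact (KaehlerDifferential.D S B).map_algebraMap (⟨x i, Algebra.subset_adjoin ⟨i, rfl⟩⟩ : S)
    | zero => rw [map_zero]
    | add w w' _ _ h h' => rw [map_add, h, h', add_zero]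
    | smul b w _ h => rw [map_smul, h, smul_zero]
  have hepi := isEpi_of_pow_mem B p S hS
  have hs := Algebra.isEpi_iff_surjective_algebraMap_of_finite.mp hepi
  refine eq_top_iff.mpr fun b _ => ?_
  obtain ⟨s, rfl⟩ := hs b
  exact s.2

end Span

section Basis

variable {k B : Type u} [Field k] [CommRing B] [Algebra k B] (p : ℕ) [Fact p.Prime] [CharP B p]

/-- A derivation, as a derivation over the subring of `p`-th powers. -/
def _root_.Derivation.overFrobenius (δ : Derivation k B B) : Derivation (frobenius B p).range B B :=
  Derivation.mk'
    { toFun := δ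
      map_add' := map_add δ
      map_smul' := by
        rintro ⟨_, c, rfl⟩ b
        change δ (c ^ p * b) = c ^ p * δ b
        rw [Derivation.leibniz, Derivation.leibniz_pow, ← Nat.cast_smul_eq_nsmul B p,
            CharP.cast_eq_zero,
          zero_smul, smul_zero, add_zero, smul_eq_mul] }
    (fun a b => δ.leibniz a b)

/-- If the differentials of `x` form a basis of the module of differentials of `B`, then the
monomials in `x` with exponents less than `p` form a basis of `F_* B`. -/
lemma exists_basis_frobPush [PerfectField k] [Algebra.EssFiniteType k B] [IsReduced B] {ι : Type*}
    [Fintype ι]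
    (x : ι → B) (b : Module.Basis ι B (Ω[B⁄k])) (hb : ∀ i, b i = KaehlerDifferential.D k B (x i)) :
    ∃ pb : Module.Basis (ι → Fin p) B (FrobPush p B), ∀ e, pb e =
        FrobPush.of p B (∏ i, x i ^ (e i : ℕ)) := by
  classical
  let E : (ι → Fin p) → ι →₀ ℕ := fun e => Finsupp.equivFunOnFinite.symm fun i => (e i : ℕ)
  have hE : Function.Injective E := fun e e' h => by
    funext i
    exact Fin.ext (DFunLike.congr_fun h i)
  have hli : LinearIndependent B fun e : ι → Fin p => FrobPush.of p B (∏ i, x i ^ (e i : ℕ)) := by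
    rw [Fintype.linearIndependent_iff]
    intro c hc
    -- A linear relation in `F_* B` with coefficients `c e` is a polynomial relation among the `x i`
    -- with coefficients `c e ^ p` and all exponents below `p`. The coordinate derivations of the
    -- basis `b` are dual to `x`.
    let q : MvPolynomial ι (frobenius B p).range :=
      ∑ e, MvPolynomial.monomial (E e) ⟨c e ^ p, c e, rfl⟩
    have hq : ∀ m, (∃ i, p ≤ m i) → MvPolynomial.coeff m q = 0 := by
      rintro m ⟨i, hi⟩
      rw [MvPolynomial.coeff_sum]
      refine Finset.sum_eq_zero fun e _ => ?_
      rw [MvPolynomial.coeff_monomial, if_neg]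
      rintro rfl
      exact absurd (e i).2 (not_lt.mpr hi)
    have h0 : MvPolynomial.aeval x q = 0 := by
      rw [map_sum]
      refine Eq.trans (Finset.sum_congr rfl fun e _ => ?_) hc
      rw [MvPolynomial.aeval_monomial, Finsupp.prod_fintype _ _ (by simp)]
      rfl
    have := eq_zero_of_aeval_eq_zero p x
        (fun i => Derivation.overFrobenius p ((b.coord i).compDer (KaehlerDifferential.D k B)))
      Subtype.val_injective (fun i j => by
        change b.coord i (KaehlerDifferential.D k B (x j)) = _
        rw [← hb, Module.Basis.coord_apply, b.repr_self, Finsupp.single_apply]) q hq h0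
    intro e
    have h1 := congrArg (MvPolynomial.coeff (E e)) this
    rw [MvPolynomial.coeff_sum, Finset.sum_eq_single e, MvPolynomial.coeff_monomial, if_pos rfl,
      MvPolynomial.coeff_zero] at h1
    -- The relation only shows `c e ^ p = 0`; reducedness of `B` gives `c e = 0`.
    · exact pow_eq_zero_iff (Nat.Prime.ne_zero Fact.out) |>.mp (congrArg Subtype.val h1)
    · intro e' _ h
      rw [MvPolynomial.coeff_monomial, if_neg (fun h' => h (hE h'))]
    · simp
  have hsp :
      ⊤ ≤ Submodule.span B
      (Set.range fun e : ι → Fin p => FrobPush.of p B (∏ i, x i ^ (e i : ℕ))) := by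
    rintro y -
    obtain ⟨y, rfl⟩ := (FrobPush.of p B).surjective y
    have hy : y ∈ Algebra.adjoin (frobenius B p).range (Set.range x) := by
      rw [adjoin_range_frobenius_eq_top (k := k) p x (by simp only [← hb]; exact b.span_eq)]
      trivial
    rw [Algebra.adjoin_range_eq_range_aeval] at hy
    obtain ⟨q, rfl⟩ := hy
    change FrobPush.of p B (MvPolynomial.aeval x q) ∈ _
    rw [MvPolynomial.aeval_def, MvPolynomial.eval₂_eq', map_sum]
    refine Submodule.sum_mem _ fun m _ => ?_
    obtain ⟨c, hc⟩ := (MvPolynomial.coeff m q).2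
    -- Division of each exponent by `p` moves the quotient part, being a `p`-th power, into the
    -- scalar.
    have : FrobPush.of p B (algebraMap _ B (MvPolynomial.coeff m q) * ∏ i, x i ^ m i) =
        (c * ∏ i, x i ^ (m i / p)) • FrobPush.of p B (∏ i, x i ^ (m i % p)) := by
      rw [FrobPush.smul_of, smul_eq_mul, mul_pow, mul_assoc, ← Finset.prod_pow,
          ← Finset.prod_mul_distrib]
      congr 2
      · exact hc.symm
      · refine Finset.prod_congr rfl fun i _ => ?_
        rw [← pow_mul, ← pow_add, Nat.div_add_mod']
    rw [this]
    exact Submodule.smul_mem _ _ (Submodule.subset_span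
      ⟨fun i => ⟨m i % p, Nat.mod_lt _ (Nat.Prime.pos Fact.out)⟩, rfl⟩)
  exact ⟨Module.Basis.mk hli hsp, fun e => Module.Basis.mk_apply _ _ _⟩

variable {p} in
/-- A basis of `F_* N` from bases of `F_* B` and `N`. -/
lemma exists_basis_frobPush_module {N : Type u} [AddCommGroup N] [Module B N] {T S : Type*}
    [Fintype T] [Fintype S]
    {u : T → B} (pb : Module.Basis T B (FrobPush p B)) (hpb : ∀ t, pb t = FrobPush.of p B (u t))
        (n : Module.Basis S B N) :
    ∃ b : Module.Basis (T × S) B (FrobPush p N), ∀ t s, b (t, s) = FrobPush.of p N (u t • n s) := by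
  have hsum : ∀ c : T → B, ∑ t, c t • pb t = FrobPush.of p B (∑ t, c t ^ p * u t) := by
    intro c
    rw [map_sum]
    refine Finset.sum_congr rfl fun t _ => ?_
    rw [hpb, FrobPush.smul_of, smul_eq_mul]
  have hli : LinearIndependent B fun i : T × S => FrobPush.of p N (u i.1 • n i.2) := by
    rw [Fintype.linearIndependent_iff]
    intro c hc
    have h1 : ∑ s, (∑ t, c (t, s) ^ p * u t) • n s = 0 := by
      apply (FrobPush.of p N).injective
      rw [map_zero, ← hc, Fintype.sum_prod_type, Finset.sum_comm, map_sum]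
      refine Finset.sum_congr rfl fun s _ => ?_
      rw [Finset.sum_smul, map_sum]
      refine Finset.sum_congr rfl fun t _ => ?_
      rw [FrobPush.smul_of, smul_smul]
    have h2 := Fintype.linearIndependent_iff.mp n.linearIndependent _ h1
    rintro ⟨t, s⟩
    refine Fintype.linearIndependent_iff.mp pb.linearIndependent (fun t => c (t, s)) ?_ t
    rw [hsum, h2 s, map_zero]
  have hsp : ⊤ ≤ Submodule.span B (Set.range fun i : T × S => FrobPush.of p N (u i.1 • n i.2)) := by
    rintro y -
    obtain ⟨y, rfl⟩ := (FrobPush.of p N).surjective y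
    rw [← n.sum_repr y, map_sum]
    refine Submodule.sum_mem _ fun s _ => ?_
    have h := (hsum _).symm.trans (pb.sum_repr (FrobPush.of p B (n.repr y s)))
    rw [← (FrobPush.of p B).injective h, Finset.sum_smul, map_sum]
    refine Submodule.sum_mem _ fun t _ => ?_
    rw [← smul_smul, ← FrobPush.smul_of]
    exact Submodule.smul_mem _ _ (Submodule.subset_span ⟨(t, s), rfl⟩)
  exact ⟨Module.Basis.mk hli hsp, fun t s => Module.Basis.mk_apply _ _ _⟩

/-- Generalized inverses over fields. -/
lemma _root_.LinearMap.exists_comp_comp_eq {F V W : Type*} [Field F] [AddCommGroup V] [Module F V]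
    [AddCommGroup W] [Module F W]
    (f : V →ₗ[F] W) : ∃ g : W →ₗ[F] V, f ∘ₗ g ∘ₗ f = f := by
  obtain ⟨h, hh⟩ := f.rangeRestrict.exists_rightInverse_of_surjective f.range_rangeRestrict
  obtain ⟨g, hg⟩ := h.exists_extend
  refine ⟨g, LinearMap.ext fun v => ?_⟩
  have h1 : g (f v) = h (f.rangeRestrict v) := LinearMap.congr_fun hg (f.rangeRestrict v)
  exact (congrArg f h1).trans (congrArg Subtype.val (LinearMap.congr_fun hh (f.rangeRestrict v)))

/-- A linear map whose matrix has entries in a subfield has a generalized inverse. -/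
lemma _root_.LinearMap.exists_apply_apply_eq {F R M N : Type*} [Field F] [CommRing R]
    [AddCommGroup M] [Module R M]
    [AddCommGroup N] [Module R N] (φ : F →+* R) {T S : Type*} [Fintype T] [Fintype S]
        (bM : Module.Basis T R M)
    (bN : Module.Basis S R N) (d : M →ₗ[R] N) (c : T → S → F)
        (hd : ∀ t, d (bM t) = ∑ s, φ (c t s) • bN s) :
    ∃ g : N →ₗ[R] M, ∀ x, d (g (d x)) = d x := by
  classical
  let C : Matrix S T F := Matrix.of fun s t => c t s
  obtain ⟨g, hg⟩ := (Matrix.toLin' C).exists_comp_comp_eq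
  let G := LinearMap.toMatrix' g
  have hG : C * (G * C) = C := by
    apply Matrix.toLin'.injective
    rw [Matrix.toLin'_mul, Matrix.toLin'_mul, Matrix.toLin'_toMatrix', hg]
  have hdC : d = Matrix.toLin bM bN (C.map φ) := by
    refine bM.ext fun t => ?_
    rw [hd, Matrix.toLin_self]
    rfl
  refine ⟨Matrix.toLin bN bM (G.map φ), fun x => ?_⟩
  rw [hdC, ← LinearMap.comp_apply, ← LinearMap.comp_apply, ← Matrix.toLin_mul bN bM bN,
      ← Matrix.toLin_mul bM bN bN,
    ← Matrix.map_mul, ← Matrix.map_mul, Matrix.mul_assoc, hG]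

end Basis

end CartierForms

end

/-! ### The exterior derivative in coordinates and the splitting of boundaries. -/

noncomputable section

lemma Derivation.leibniz_finsetProd {R A M ι : Type*} [CommRing R] [CommRing A] [Algebra R A]
    [AddCommGroup M]
    [Module A M] [Module R M] [DecidableEq ι] (D : Derivation R A M) (s : Finset ι) (f : ι → A) :
    D (∏ i ∈ s, f i) = ∑ i ∈ s, (∏ j ∈ s.erase i, f j) • D (f i) := by
  induction s using Finset.induction_on with
  | empty => simp
  | insert a s ha ih =>
    rw [Finset.prod_insert ha, D.leibniz, ih, Finset.sum_insert ha, Finset.erase_insert ha,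
        add_comm, Finset.smul_sum]
    congr 1
    refine Finset.sum_congr rfl fun i hi => ?_
    have hai : a ≠ i := fun h => ha (h ▸ hi)
    rw [Finset.erase_insert_of_ne hai, Finset.prod_insert (by simp [ha]), smul_smul]

namespace CartierForms

section

variable (k : Type u) {B : Type u} [CommRing k] [CommRing B] [Algebra k B]

lemma exteriorDeriv_smul_D_prod {n : ℕ} (c : B) (y : Fin n → B) :
    exteriorDeriv k B n (c • exteriorPower.ιMulti B n fun i => KaehlerDifferential.D k B (y i)) =
      wedgeD k B c n (exteriorPower.ιMulti B n fun i => KaehlerDifferential.D k B (y i)) := by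
  apply Subtype.ext
  change extDeriv k B (c • ExteriorAlgebra.ιMulti B n _) = dform k c * ExteriorAlgebra.ιMulti B n _
  have : (ExteriorAlgebra.ιMulti B n fun i => KaehlerDifferential.D k B (y i)) ∈ closedForms k B :=
      by
    rw [ExteriorAlgebra.ιMulti_apply]
    refine list_prod_mem fun z hz => ?_
    obtain ⟨i, rfl⟩ := List.mem_ofFn.mp hz
    exact extDeriv_dform k B (y i)
  rw [extDeriv_smul, show extDeriv k B _ = 0 from this, smul_zero, add_zero]

end

/-- The coordinates of a product of basis vectors are integers. -/
lemma exists_int_coords {B M ι : Type*} [CommRing B] [AddCommGroup M] [Module B M] [LinearOrder ι]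
    [Fintype ι]
    (b : Module.Basis ι B M) {n : ℕ} (f : Fin n → ι) :
    ∃ z : Set.powersetCard ι n → ℤ,
      exteriorPower.ιMulti B n (fun i => b (f i)) = ∑ s, z s • b.exteriorPower n s := by
  -- The coordinates of a product of basis vectors are minors of a matrix with entries 0 and 1.
  refine ⟨fun s =>
      (Matrix.of fun i j => if f i = Set.powersetCard.ofFinEmbEquiv.symm s j then
      (1 : ℤ) else 0).det, ?_⟩
  conv_lhs => rw [← (b.exteriorPower n).sum_repr (exteriorPower.ιMulti B n fun i => b (f i))]
  refine Finset.sum_congr rfl fun s _ => ?_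
  rw [exteriorPower.basis_repr_apply, exteriorPower.ιMultiDual_apply_ιMulti,
      ← Int.cast_smul_eq_zsmul B]
  congr 1
  change _ = Int.castRingHom B (Matrix.det _)
  rw [RingHom.map_det]
  congr 1
  ext i j
  simp [Finsupp.single_apply]

section

variable (k : Type u) {B : Type u} [Field k] [CommRing B] [Algebra k B] (p : ℕ) [Fact p.Prime]
    [CharP B p]
  {ι : Type*} [Fintype ι] (x : ι → B) (b : Module.Basis ι B (Ω[B⁄k]))

omit [Fact p.Prime] [CharP B p] in
/-- The exterior derivative maps the standard basis into the group generated by the standard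
basis. -/
lemma exteriorDeriv_mem_closure [LinearOrder ι] (hb : ∀ i, b i = KaehlerDifferential.D k B (x i))
    (n : ℕ) (e : ι → Fin p)
    (s : Set.powersetCard ι n) :
    exteriorDeriv k B n ((∏ i, x i ^ (e i : ℕ)) • b.exteriorPower n s) ∈
      AddSubgroup.closure (Set.range fun t : (ι → Fin p) × Set.powersetCard ι (n + 1) =>
        (∏ i, x i ^ (t.1 i : ℕ)) • b.exteriorPower (n + 1) t.2) := by
  have hs : b.exteriorPower n s = exteriorPower.ιMulti B n fun j =>
      KaehlerDifferential.D k B (x (Set.powersetCard.ofFinEmbEquiv.symm s j)) := by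
    rw [exteriorPower.basis_apply]
    simp only [← hb]
    rfl
  rw [hs, exteriorDeriv_smul_D_prod, wedgeD_ιMulti, (KaehlerDifferential.D k B).leibniz_finsetProd]
  -- If `e i = 0`, the truncated exponent `e i - 1` is also 0, which does no harm since the
  -- coefficient `e i` vanishes.
  have hD : ∀ i, (∏ j ∈ Finset.univ.erase i, x j ^ (e j : ℕ)) • KaehlerDifferential.D k B
      (x i ^ (e i : ℕ)) =
      (e i : ℕ) •
          ((∏ j, x j ^ (Function.update e i ⟨e i - 1, (Nat.sub_le _ _).trans_lt (e i).2⟩ j : ℕ)) •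
        KaehlerDifferential.D k B (x i)) := by
    intro i
    rw [Derivation.leibniz_pow, smul_comm, smul_smul, ← Finset.prod_erase_mul _ _
        (Finset.mem_univ i)]
    congr 3
    · refine Finset.prod_congr rfl fun j hj => ?_
      rw [Function.update_of_ne (Finset.ne_of_mem_erase hj)]
    · rw [Function.update_self]
  have hup : ∀ (w : Fin n → Ω[B⁄k]) (v : Ω[B⁄k]), Function.update (Matrix.vecCons 0 w) 0 v =
      Matrix.vecCons v w :=
    fun w v => Fin.update_cons_zero (α := fun _ => Ω[B⁄k]) 0 w v
  have hadd : ∀ w : Fin n → Ω[B⁄k], ∀ v : ι → Ω[B⁄k],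
      exteriorPower.ιMulti B (n + 1) (Matrix.vecCons (∑ i, v i) w) =
        ∑ i, exteriorPower.ιMulti B (n + 1) (Matrix.vecCons (v i) w) := by
    intro w v
    have h := map_sum ((exteriorPower.ιMulti B (n + 1) (M := Ω[B⁄k])).toMultilinearMap.toLinearMap
      (Matrix.vecCons 0 w) 0) v Finset.univ
    simp only [MultilinearMap.toLinearMap_apply, hup] at h
    exact h
  have hsmul : ∀ (w : Fin n → Ω[B⁄k]) (v : Ω[B⁄k]) (a : B),
      exteriorPower.ιMulti B (n + 1) (Matrix.vecCons (a • v) w) =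
        a • exteriorPower.ιMulti B (n + 1) (Matrix.vecCons v w) := by
    intro w v a
    have h := map_smul ((exteriorPower.ιMulti B (n + 1) (M := Ω[B⁄k])).toMultilinearMap.toLinearMap
      (Matrix.vecCons 0 w) 0) a v
    simp only [MultilinearMap.toLinearMap_apply, hup] at h
    exact h
  rw [hadd]
  refine AddSubgroup.sum_mem _ fun i _ => ?_
  rw [hD, ← Nat.cast_smul_eq_nsmul B, hsmul, hsmul, Nat.cast_smul_eq_nsmul]
  refine AddSubgroup.nsmul_mem _ ?_ _
  obtain ⟨z, hz⟩ := exists_int_coords b (Matrix.vecCons i (Set.powersetCard.ofFinEmbEquiv.symm s))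
  have hz' :
      (fun j => b ((Matrix.vecCons i (Set.powersetCard.ofFinEmbEquiv.symm s) : Fin (n + 1) → ι) j))
      =
      Matrix.vecCons (KaehlerDifferential.D k B (x i))
        fun j => KaehlerDifferential.D k B (x (Set.powersetCard.ofFinEmbEquiv.symm s j)) := by
    funext j
    refine Fin.cases (hb i) (fun j => hb _) j
  rw [← hz', hz, Finset.smul_sum]
  refine AddSubgroup.sum_mem _ fun s' _ => ?_
  rw [smul_comm]
  refine AddSubgroup.zsmul_mem _ (AddSubgroup.subset_closure (Set.mem_range.mpr ⟨(_, s'), rfl⟩)) _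

/-- With respect to the bases of monomials times products of the `d(x i)`, the derivative has a
matrix with entries in the prime field. Over a field every matrix `C` has a `G` with `C G C = C`,
and this identity survives base change to `B`. -/
lemma exists_frobDeriv_generalizedInverse [PerfectField k] [Algebra.EssFiniteType k B] [IsReduced B]
    (hb : ∀ i, b i = KaehlerDifferential.D k B (x i)) (n : ℕ) :
    Module.Free B (FrobPush p (⋀[B]^n (Ω[B⁄k]))) ∧ Module.Finite B (FrobPush p (⋀[B]^n (Ω[B⁄k]))) ∧
    ∃ g : FrobPush p (⋀[B]^(n + 1) (Ω[B⁄k])) →ₗ[B] FrobPush p (⋀[B]^n (Ω[B⁄k])),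
      ∀ y, frobDeriv k B p n (g (frobDeriv k B p n y)) = frobDeriv k B p n y := by
  classical
  let _ : LinearOrder ι := IsWellOrder.linearOrder WellOrderingRel
  obtain ⟨pb, hpb⟩ := exists_basis_frobPush p x b hb
  obtain ⟨b₀, hb₀⟩ := exists_basis_frobPush_module pb hpb (b.exteriorPower n)
  obtain ⟨b₁, hb₁⟩ := exists_basis_frobPush_module pb hpb (b.exteriorPower (n + 1))
  refine ⟨.of_basis b₀, .of_basis b₀, ?_⟩
  let φ : ZMod p →+* B := ZMod.castHom (dvd_refl p) B
  have aux : ∀ y ∈ AddSubgroup.closure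
      (Set.range fun t : (ι → Fin p) × Set.powersetCard ι (n + 1) =>
        (∏ i, x i ^ (t.1 i : ℕ)) • b.exteriorPower (n + 1) t.2),
      ∃ c : _ → ZMod p, FrobPush.of p _ y = ∑ s, φ (c s) • b₁ s := by
    intro y hy
    induction hy using AddSubgroup.closure_induction with
    | mem y hy =>
      obtain ⟨⟨e', s'⟩, rfl⟩ := hy
      refine ⟨Pi.single (e', s') 1, ?_⟩
      rw [Finset.sum_eq_single (e', s')]
      · rw [Pi.single_eq_same, map_one, one_smul, hb₁]
      · intro t _ ht
        rw [Pi.single_eq_of_ne ht, map_zero]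
        exact zero_smul B (b₁ t)
      · simp
    | zero =>
      refine ⟨0, ?_⟩
      rw [map_zero]
      refine (Finset.sum_eq_zero fun s _ => ?_).symm
      rw [Pi.zero_apply, map_zero]
      exact zero_smul B (b₁ s)
    | add y y' _ _ h h' =>
      obtain ⟨c, hc⟩ := h
      obtain ⟨c', hc'⟩ := h'
      refine ⟨c + c', ?_⟩
      simp only [map_add, hc, hc', Pi.add_apply, add_smul, Finset.sum_add_distrib]
    | neg y _ h =>
      obtain ⟨c, hc⟩ := h
      refine ⟨-c, ?_⟩
      simp only [map_neg, hc, Pi.neg_apply, neg_smul, Finset.sum_neg_distrib]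
  have key : ∀ t, ∃ c : _ → ZMod p, frobDeriv k B p n (b₀ t) = ∑ s, φ (c s) • b₁ s := by
    rintro ⟨e, s⟩
    rw [hb₀]
    exact aux _ (exteriorDeriv_mem_closure k p x b hb n e s)
  choose c hc using key
  exact LinearMap.exists_apply_apply_eq φ b₀ b₁ _ c hc

/-- `GΩ^n` is a direct summand of `F_* Ω^n`. -/
lemma exists_section_mkQ_boundaries [PerfectField k] [Algebra.EssFiniteType k B] [IsReduced B]
    (hb : ∀ i, b i = KaehlerDifferential.D k B (x i)) (n : ℕ) :
    ∃ s : GForms k B p n →ₗ[B] FrobPush p (⋀[B]^n (Ω[B⁄k])), (boundaries k B p n).mkQ ∘ₗ s =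
        LinearMap.id := by
  cases n with
  | zero =>
    refine ⟨(boundaries k B p 0).liftQ LinearMap.id bot_le, ?_⟩
    apply Submodule.linearMap_qext
    rfl
  | succ n =>
    obtain ⟨-, -, g, hg⟩ := exists_frobDeriv_generalizedInverse k p x b hb n
    -- By `d g d = d` the map `1 - d g` kills boundaries, and it differs from the identity by
    -- boundaries.
    refine ⟨(boundaries k B p (n + 1)).liftQ (LinearMap.id - frobDeriv k B p n ∘ₗ g) ?_, ?_⟩
    · rintro _ ⟨y, rfl⟩
      change frobDeriv k B p n y - frobDeriv k B p n (g (frobDeriv k B p n y)) = 0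
      rw [hg, sub_self]
    · apply Submodule.linearMap_qext
      ext y
      change (boundaries k B p (n + 1)).mkQ (y - frobDeriv k B p n (g y)) =
          (boundaries k B p (n + 1)).mkQ y
      rw [map_sub, sub_eq_self, Submodule.mkQ_apply, Submodule.Quotient.mk_eq_zero]
      exact ⟨g y, rfl⟩

/-- `GΩ^n` is a direct summand of the finite free module `F_* Ω^n`. Its base change to the
hypersurface then has no local cohomology below the dimension. -/
lemma gForms_projective_and_finite [PerfectField k] [Algebra.EssFiniteType k B] [IsReduced B]
    (hb : ∀ i, b i = KaehlerDifferential.D k B (x i)) (n : ℕ) :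
    Module.Projective B (GForms k B p n) ∧ Module.Finite B (GForms k B p n) := by
  obtain ⟨_, _, -⟩ := exists_frobDeriv_generalizedInverse k p x b hb n
  obtain ⟨s, hs⟩ := exists_section_mkQ_boundaries k p x b hb n
  exact ⟨Module.Projective.of_split s _ hs, inferInstance⟩

/-- Frobenius `B → F_* B` splits. -/
lemma exists_frobenius_splitting [PerfectField k] [Algebra.EssFiniteType k B] [IsReduced B]
    (hb : ∀ i, b i = KaehlerDifferential.D k B (x i)) :
    ∃ s : FrobPush p B →ₗ[B] B, s (FrobPush.of p B 1) = 1 := by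
  obtain ⟨pb, hpb⟩ := exists_basis_frobPush p x b hb
  refine ⟨pb.coord fun _ => ⟨0, Nat.Prime.pos Fact.out⟩, ?_⟩
  have : FrobPush.of p B 1 = pb fun _ => ⟨0, Nat.Prime.pos Fact.out⟩ := by simp [hpb]
  rw [this, Module.Basis.coord_apply, Module.Basis.repr_self, Finsupp.single_eq_same]

end

end CartierForms

end

/-! ### Regular sequences from `p`-bases. -/

noncomputable section

namespace CartierForms

section Coordinates

variable {B : Type u} [CommRing B] {p : ℕ} [Fact p.Prime] [CharP B p] {ι : Type*} [Fintype ι]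
    [DecidableEq ι]
  {x : ι → B} (pb : Module.Basis (ι → Fin p) B (FrobPush p B))

/-- Raise the exponent of one variable by one, cyclically. -/
def raiseExponent (l : ι) (e : ι → Fin p) : ι → Fin p := Function.update e l (e l + 1)

omit [Fintype ι] in
lemma raiseExponent_injective (l : ι) : Function.Injective (raiseExponent (p := p) l) := by
  intro e e' h
  funext i
  have hi := congrFun h i
  by_cases hil : i = l
  · subst hil
    simpa [raiseExponent] using hi
  · simpa [raiseExponent, hil] using hi

include pb in
-- Multiplication by `x l` permutes the monomial basis cyclically. When the exponent wraps around
-- from `p - 1` to 0, the factor `x l ^ p` becomes the scalar `x l`.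
lemma repr_mul_raiseExponent (hpb : ∀ e, pb e = FrobPush.of p B (∏ i, x i ^ (e i : ℕ))) (l : ι)
    (b : B) (e : ι → Fin p) :
    pb.repr (FrobPush.of p B (x l * b)) (raiseExponent l e) =
      (if (e l : ℕ) + 1 = p then x l else 1) * pb.repr (FrobPush.of p B b) e := by
  have hmul : ∀ e, FrobPush.of p B (x l * ∏ i, x i ^ (e i : ℕ)) =
      (if (e l : ℕ) + 1 = p then x l else 1) • pb (raiseExponent l e) := by
    intro e
    rw [hpb, FrobPush.smul_of, smul_eq_mul, ← Finset.mul_prod_erase _ _ (Finset.mem_univ l),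
      ← Finset.mul_prod_erase Finset.univ _ (Finset.mem_univ l), ← mul_assoc, ← mul_assoc]
    congr 2
    · rw [raiseExponent, Function.update_self, ← pow_succ', Fin.val_add, Fin.val_one']
      split_ifs with h
      · rw [Nat.add_mod_mod, h, Nat.mod_self, pow_zero, mul_one]
      · have := (e l).2
        rw [Nat.add_mod_mod, Nat.mod_eq_of_lt (by omega), one_pow, one_mul]
    · refine Finset.prod_congr rfl fun i hi => ?_
      rw [raiseExponent, Function.update_of_ne (Finset.ne_of_mem_erase hi)]
  let T : FrobPush p B →ₗ[B] FrobPush p B :=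
    { toFun := fun y => FrobPush.of p B (x l * (FrobPush.of p B).symm y)
      map_add' := fun y z => by rw [map_add, mul_add, map_add]
      map_smul' := fun a y => by
        obtain ⟨y, rfl⟩ := (FrobPush.of p B).surjective y
        rw [RingHom.id_apply, FrobPush.smul_of, AddEquiv.symm_apply_apply,
            AddEquiv.symm_apply_apply,
          FrobPush.smul_of, smul_eq_mul, smul_eq_mul, mul_left_comm] }
  have key : pb.coord (raiseExponent l e) ∘ₗ T =
      (if (e l : ℕ) + 1 = p then x l else 1) • pb.coord e := by
    refine pb.ext fun e' => ?_
    have hT : T (pb e') = (if (e' l : ℕ) + 1 = p then x l else 1) • pb (raiseExponent l e') := by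
      rw [hpb]
      exact hmul e'
    rw [LinearMap.comp_apply, hT, map_smul, LinearMap.smul_apply, Module.Basis.coord_apply,
      Module.Basis.coord_apply, Module.Basis.repr_self, Module.Basis.repr_self]
    by_cases h : e' = e
    · rw [h, Finsupp.single_eq_same, Finsupp.single_eq_same]
    · rw [Finsupp.single_eq_of_ne (Ne.symm h), Finsupp.single_eq_of_ne, smul_zero, smul_zero]
      exact fun h' => h (raiseExponent_injective l h'.symm)
  exact LinearMap.congr_fun key (FrobPush.of p B b)

include pb in
-- A monomial without `x l` arises from multiplication by `x l` only through a wrap-around, so its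
-- coordinate acquires the factor `x l`.
lemma repr_mem_span (hpb : ∀ e, pb e = FrobPush.of p B (∏ i, x i ^ (e i : ℕ))) (L : Set ι) {b : B}
    (hb : b ∈ Ideal.span (x '' L)) (e : ι → Fin p) (he : ∀ l ∈ L, (e l : ℕ) = 0) :
    pb.repr (FrobPush.of p B b) e ∈ Ideal.span (x '' L) := by
  induction hb using Submodule.closure_induction with
  | zero => simp
  | add y z _ _ hy hz => rw [map_add, map_add, Finsupp.add_apply]; exact add_mem hy hz
  | smul_mem a y hy =>
    obtain ⟨l, hl, rfl⟩ := hy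
    obtain ⟨e', rfl⟩ := (Finite.injective_iff_surjective.mp (raiseExponent_injective (p := p) l)) e
    have h := he l hl
    rw [smul_eq_mul, mul_comm, repr_mul_raiseExponent pb hpb, if_pos]
    · exact Ideal.mul_mem_right _ _ (Ideal.subset_span ⟨l, hl, rfl⟩)
    · rw [raiseExponent, Function.update_self, Fin.val_add, Fin.val_one', Nat.add_mod_mod] at h
      have := Nat.le_of_dvd (Nat.succ_pos _) (Nat.dvd_of_mod_eq_zero h)
      have := (e' l).2
      omega

include pb in
/-- The variables of a `p`-basis that lie in the maximal ideal form a regular sequence. -/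
lemma mem_span_of_mul_mem_span [IsLocalRing B] [IsNoetherianRing B]
    (hpb : ∀ e, pb e = FrobPush.of p B (∏ i, x i ^ (e i : ℕ))) (L : Set ι) {l : ι} (hl : l ∉ L)
    (hm : x l ∈ maximalIdeal B) {b : B} (hb : x l * b ∈ Ideal.span (x '' L)) :
        b ∈ Ideal.span (x '' L) := by
  let I := Ideal.span (x '' L)
  let J : Ideal B := Submodule.comap (LinearMap.mulLeft B (x l)) I
  -- Nakayama's lemma for the colon ideal `J = (I : x l)`.
  suffices h : J ≤ I ⊔ maximalIdeal B • J from
    Submodule.le_of_le_smul_of_le_jacobson_bot (IsNoetherian.noetherian J)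
      (maximalIdeal_le_jacobson _) h hb
  intro b (hb : x l * b ∈ I)
  have hsum : b = ∑ e, pb.repr (FrobPush.of p B b) e ^ p * ∏ i, x i ^ (e i : ℕ) := by
    apply (FrobPush.of p B).injective
    rw [map_sum]
    conv_lhs => rw [← pb.sum_repr (FrobPush.of p B b)]
    refine Finset.sum_congr rfl fun e _ => ?_
    rw [hpb, FrobPush.smul_of, smul_eq_mul]
  rw [hsum]
  refine Submodule.sum_mem _ fun e _ => ?_
  by_cases he : ∀ j ∈ L, (e j : ℕ) = 0
  -- The coordinate `c` of `b` at `e` is compared with that of `x l * b` at the raised index.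
  -- Without wrap-around `c` lies in `I`. With wrap-around `x l * c` lies in `I`, so `c` lies in
  -- `J`; here `e l = p - 1` is positive, so the monomial provides a factor `x l` from the maximal
  -- ideal. Monomials involving some `x j` with `j ∈ L` lie in `I` anyway.
  · have h := repr_mem_span pb hpb L hb (raiseExponent l e) (fun j hj => by
      rw [raiseExponent, Function.update_of_ne (ne_of_mem_of_not_mem hj hl)]
      exact he j hj)
    rw [repr_mul_raiseExponent pb hpb] at h
    split_ifs at h with h1
    · refine Submodule.mem_sup_right ?_
      have hel : (e l : ℕ) = (e l - 1 : ℕ) + 1 := by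
        have := Nat.Prime.two_le (Fact.out : p.Prime)
        omega
      have : pb.repr (FrobPush.of p B b) e ^ p * ∏ i, x i ^ (e i : ℕ) =
          x l • ((pb.repr (FrobPush.of p B b) e ^ (p - 1) * (x l ^ (e l - 1 : ℕ) *
            ∏ i ∈ Finset.univ.erase l, x i ^ (e i : ℕ))) • pb.repr (FrobPush.of p B b) e) := by
        rw [← Finset.mul_prod_erase _ _ (Finset.mem_univ l), smul_eq_mul, smul_eq_mul]
        generalize pb.repr (FrobPush.of p B b) e = c
        nth_rw 1 [hel]
        rw [← pow_sub_one_mul (Nat.Prime.ne_zero (Fact.out : p.Prime)) c, pow_succ]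
        ring
      rw [this]
      exact Submodule.smul_mem_smul hm (Submodule.smul_mem _ _ h)
    · rw [one_mul] at h
      refine Submodule.mem_sup_left (Ideal.mul_mem_right _ _ ?_)
      exact Ideal.pow_mem_of_mem _ h _ (Nat.Prime.pos Fact.out)
  · push Not at he
    obtain ⟨j, hj, hej⟩ := he
    refine Submodule.mem_sup_left (Ideal.mul_mem_left _ _ ?_)
    rw [← Finset.mul_prod_erase _ _ (Finset.mem_univ j)]
    exact Ideal.mul_mem_right _ _
        (Ideal.pow_mem_of_mem _ (Ideal.subset_span (Set.mem_image_of_mem x hj)) _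
        (Nat.pos_of_ne_zero hej))

end Coordinates

/-! ### Cotangent spaces of smooth local rings over a perfect field. -/

section Cotangent

open TensorProduct

variable (k : Type u) {B : Type u} [Field k] [PerfectField k] [CommRing B] [IsLocalRing B]
    [Algebra k B]

instance [Algebra.EssFiniteType k B] : Algebra.FormallySmooth k (ResidueField B) :=
  have : Algebra.EssFiniteType k (ResidueField B) :=
      inferInstanceAs (Algebra.EssFiniteType k (B ⧸ maximalIdeal B))
  inferInstance

/-- The differential is injective on the cotangent space of a local ring over a perfect field. -/
lemma mem_maximalIdeal_sq_of_one_tmul_D_eq_zero [Algebra.EssFiniteType k B]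
    [Algebra.FormallySmooth k B] {y : B} (hy : y ∈ maximalIdeal B)
    (h : (1 : ResidueField B) ⊗ₜ[B] KaehlerDifferential.D k B y = 0) : y ∈ maximalIdeal B ^ 2 := by
  have hinj :=
      (Algebra.FormallySmooth.kerCotangentToTensor_injective_iff (R := k) (P := B)
      (A := ResidueField B)
    residue_surjective).mpr inferInstance
  have hk : RingHom.ker (algebraMap B (ResidueField B)) = maximalIdeal B := ker_residue
  have h0 := (injective_iff_map_eq_zero _).mp hinj
    (Ideal.toCotangent _ ⟨y, hk.symm ▸ hy⟩)
        (by rw [KaehlerDifferential.kerCotangentToTensor_toCotangent]; exact h)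
  rw [Ideal.toCotangent_eq_zero] at h0
  exact hk ▸ h0

/-- A minimal system of generators of the maximal ideal extends to a basis of differentials. -/
lemma exists_basis_differentials_extending [IsNoetherianRing B] [Algebra.EssFiniteType k B]
    [Algebra.FormallySmooth k B] :
    ∃ (ι : Type u) (_ : Finite ι) (y : Fin (Module.finrank (ResidueField B) (CotangentSpace B)) → B)
        (z : ι → B)
      (b : Module.Basis (Fin (Module.finrank (ResidueField B) (CotangentSpace B)) ⊕ ι) B (Ω[B⁄k])),
      (∀ i, y i ∈ maximalIdeal B) ∧ ∀ i, b i = KaehlerDifferential.D k B (Sum.elim y z i) := by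
  let c := Module.finBasis (ResidueField B) (CotangentSpace B)
  choose y' hy' using fun i => Ideal.toCotangent_surjective (maximalIdeal B) (c i)
  let y := fun i => (y' i : B)
  let u : B → TensorProduct B (ResidueField B) (Ω[B⁄k]) := fun b => 1 ⊗ₜ KaehlerDifferential.D k B b
  -- A relation lifts to an element `∑ a i * y i` of the maximal ideal with zero differential over
  -- the residue field. It lies in the square of the maximal ideal, so the relation already holds
  -- among the basis vectors of the cotangent space.
  have hy : LinearIndependent (ResidueField B) fun i => u (y i) := by
    rw [Fintype.linearIndependent_iff]
    intro g hg
    choose a ha using fun i => residue_surjective (g i)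
    have h1 : u (∑ i, a i * y i) = 0 := by
      simp only [u, map_sum, Derivation.leibniz, TensorProduct.tmul_add, TensorProduct.tmul_sum,
          Finset.sum_add_distrib]
      have h2 : ∑ i, (1 : ResidueField B) ⊗ₜ[B] (y i • KaehlerDifferential.D k B (a i)) = 0 := by
        refine Finset.sum_eq_zero fun i _ => ?_
        rw [← TensorProduct.smul_tmul, Algebra.smul_def, mul_one]
        have : algebraMap B (ResidueField B) (y i) = 0 := (residue_eq_zero_iff _).mpr (y' i).2
        rw [this, TensorProduct.zero_tmul]
      rw [h2, add_zero, ← hg]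
      refine Finset.sum_congr rfl fun i _ => ?_
      rw [← TensorProduct.smul_tmul, Algebra.smul_def, mul_one, ← ha, TensorProduct.smul_tmul',
          smul_eq_mul, mul_one]
      rfl
    have hmem : ∑ i, a i * y i ∈ maximalIdeal B := Ideal.sum_mem _ fun i _ =>
        Ideal.mul_mem_left _ _ (y' i).2
    have h3 := mem_maximalIdeal_sq_of_one_tmul_D_eq_zero k hmem h1
    have h4 : ∑ i, g i • c i = 0 := by
      rw [← (Ideal.toCotangent_eq_zero _ ⟨_, hmem⟩).mpr h3]
      have h5 : (⟨_, hmem⟩ : maximalIdeal B) = ∑ i, a i • y' i := Subtype.ext (by simp [y])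
      rw [h5, map_sum]
      refine Finset.sum_congr rfl fun i _ => ?_
      rw [map_smul, hy', ← ha]
      exact algebraMap_smul (ResidueField B) (a i) (c i)
    exact Fintype.linearIndependent_iff.mp c.linearIndependent g h4
  let W := Submodule.span (ResidueField B) (Set.range fun i => u (y i))
  have hu : Submodule.span (ResidueField B) (Set.range u) = ⊤ := by
    have := (map_tensorProduct_mk_eq_top
        (N := Submodule.span B (Set.range (KaehlerDifferential.D k B)))).mpr
      (KaehlerDifferential.span_range_derivation k B)
    rw [← Submodule.span_image, ← Set.range_comp, eq_top_iff, ← SetLike.coe_subset_coe,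
      Submodule.top_coe] at this
    exact eq_top_iff.mpr (Set.Subset.trans this (Submodule.span_subset_span _ _ _))
  -- The exact differentials span, so the missing basis vectors can be chosen among them, modulo the
  -- span `W` of those of the `y i`.
  obtain ⟨ι, z, -, hz, hli⟩ := exists_linearIndependent' (ResidueField B) (W.mkQ ∘ u)
  have hli' : LinearIndependent (ResidueField B) (Sum.elim (fun i => u (y i)) (u ∘ z)) :=
    LinearIndependent.sumElim_of_quotient (M' := W)
      (f := fun i => ⟨u (y i), Submodule.subset_span ⟨i, rfl⟩⟩) (.of_comp W.subtype hy) (u ∘ z) hli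
  have hsp : Submodule.span (ResidueField B) (Set.range (Sum.elim (fun i => u (y i)) (u ∘ z))) =
      ⊤ := by
    rw [Set.Sum.elim_range, Submodule.span_union]
    change W ⊔ _ = ⊤
    rw [← Submodule.map_mkQ_eq_top, Submodule.map_span, ← Set.range_comp]
    change Submodule.span _ (Set.range ((W.mkQ ∘ u) ∘ z)) = ⊤
    rw [hz, Set.range_comp, ← Submodule.map_span, hu, Submodule.map_top, Submodule.range_mkQ]
  have helim : Sum.elim (fun i => u (y i)) (u ∘ z) = TensorProduct.mk B (ResidueField B)
      (Ω[B⁄k]) 1 ∘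
      fun i => KaehlerDifferential.D k B (Sum.elim y z i) := by
    funext i
    cases i <;> rfl
  rw [helim] at hli' hsp
  have : Module.FinitePresentation B (Ω[B⁄k]) := Module.finitePresentation_of_finite B _
  obtain ⟨b, hb⟩ := Module.exists_basis_of_basis_baseChange _ hli' hsp
    (Module.Flat.rTensor_preserves_injective_linearMap
        (maximalIdeal B).subtype Subtype.val_injective)
  have hfin : Finite (Fin (Module.finrank (ResidueField B) (CotangentSpace B)) ⊕ ι) :=
      Module.Finite.finite_basis b
  exact ⟨ι,
      Finite.of_injective
      (Sum.inr : ι → Fin (Module.finrank (ResidueField B) (CotangentSpace B)) ⊕ ι)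
      Sum.inr_injective,
    y, z, b, fun i => (y' i).2, hb⟩

/-- A reduced local ring that is smooth over a perfect field has a regular sequence whose length is
at least the dimension. -/
theorem exists_isRegular_of_formallySmooth (p : ℕ) [Fact p.Prime] [CharP B p] [IsNoetherianRing B]
    [IsReduced B]
    [Algebra.EssFiniteType k B] [Algebra.FormallySmooth k B] :
    ∃ rs : List B, ringKrullDim B ≤ rs.length ∧ (∀ r ∈ rs, r ∈ maximalIdeal B) ∧
      RingTheory.Sequence.IsRegular B rs := by
  classical
  obtain ⟨ι, _, y, z, b, hy, hb⟩ := exists_basis_differentials_extending k (B := B)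
  have := Fintype.ofFinite ι
  obtain ⟨pb, hpb⟩ := exists_basis_frobPush p (Sum.elim y z) b hb
  have hmem : ∀ r ∈ List.ofFn y, r ∈ maximalIdeal B := by
    intro r hr
    obtain ⟨i, rfl⟩ := List.mem_ofFn.mp hr
    exact hy i
  refine ⟨List.ofFn y, ?_, hmem, ?_⟩
  -- The length is the embedding dimension, which bounds the Krull dimension from above.
  · rw [List.length_ofFn, ← IsLocalRing.spanFinrank_maximalIdeal_eq_finrank_cotangentSpace]
    exact ringKrullDim_le_spanFinrank_maximalIdeal B
  · refine .of_isWeaklyRegular_of_mem_maximalIdeal B hmem ⟨fun i hi => ?_⟩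
    rw [List.length_ofFn] at hi
    let L : Set (Fin (Module.finrank (ResidueField B) (CotangentSpace B)) ⊕ ι) :=
        Sum.inl '' {j | (j : ℕ) < i}
    have hL : Ideal.ofList ((List.ofFn y).take i) • (⊤ : Submodule B B) =
        Ideal.span (Sum.elim y z '' L) := by
      rw [smul_eq_mul, Ideal.mul_top, Ideal.ofList]
      congr 1
      ext r
      simp only [L, Set.mem_ofPred_eq, List.mem_take_iff_getElem, List.getElem_ofFn,
          List.length_ofFn, Set.mem_image]
      constructor
      · rintro ⟨j, hj, rfl⟩
        exact ⟨Sum.inl ⟨j, by omega⟩, ⟨_, (by simp; omega), rfl⟩, rfl⟩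
      · rintro ⟨_, ⟨j, hj, rfl⟩, rfl⟩
        exact ⟨j, by simp; omega, rfl⟩
    rw [List.getElem_ofFn]
    intro u v huv
    obtain ⟨u, rfl⟩ := Submodule.Quotient.mk_surjective _ u
    obtain ⟨v, rfl⟩ := Submodule.Quotient.mk_surjective _ v
    change y ⟨i, hi⟩ • _ = y ⟨i, hi⟩ • _ at huv
    rw [← Submodule.Quotient.mk_smul, ← Submodule.Quotient.mk_smul, Submodule.Quotient.eq, hL,
        smul_eq_mul, smul_eq_mul,
      ← mul_sub] at huv
    rw [Submodule.Quotient.eq, hL]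
    refine mem_span_of_mul_mem_span pb hpb L (l := Sum.inl ⟨i, hi⟩) ?_ (hy _) huv
    rintro ⟨j, hj, hj'⟩
    rw [Sum.inl_injective hj'] at hj
    exact lt_irrefl i hj

end Cotangent

end CartierForms

end

/-! ### Extending regular sequences inside an ideal, and vanishing of `Ext`. -/

noncomputable section

open RingTheory.Sequence Abelian Pointwise

/-- A Noetherian local ring is a domain if its quotient by a regular element of the maximal ideal
    is. -/
lemma IsLocalRing.isDomain_of_isPrime_span_singleton {R : Type*} [CommRing R] [IsLocalRing R]
    [IsNoetherianRing R] {f : R}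
    (hf : f ∈ nonZeroDivisors R) (hprime : (Ideal.span {f}).IsPrime) : IsDomain R := by
  -- By Krull's intersection theorem nonzero elements are divisible by `f` only finitely often.
  -- Cancelling powers of `f` in `x * y = 0` leaves two factors outside the prime `(f)` with product
  -- zero.
  have hfin : ∀ x : R, x ≠ 0 → FiniteMultiplicity f x := by
    intro x hx
    by_contra h
    have h' := FiniteMultiplicity.not_iff_forall.mp h
    apply hx
    rw [← Ideal.mem_bot, ← Ideal.iInf_pow_eq_bot_of_isLocalRing (Ideal.span {f})
      (Ideal.IsPrime.ne_top hprime)]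
    refine (Submodule.mem_iInf _).mpr fun n => ?_
    rw [Ideal.span_singleton_pow, Ideal.mem_span_singleton]
    exact h' n
  have : NoZeroDivisors R := by
    refine ⟨fun {x y} hxy => ?_⟩
    by_contra! hne
    obtain ⟨c, hc, hc'⟩ := (hfin x hne.1).exists_eq_pow_mul_and_not_dvd
    obtain ⟨c', hd, hd'⟩ := (hfin y hne.2).exists_eq_pow_mul_and_not_dvd
    have h0 : c * c' = 0 := by
      have hpow : f ^ (multiplicity f x + multiplicity f y) ∈ nonZeroDivisors R := pow_mem hf _
      refine (mem_nonZeroDivisors_iff_right.mp hpow) _ ?_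
      rw [← hxy]
      conv_rhs => rw [hc, hd]
      ring
    have : c * c' ∈ Ideal.span {f} := h0 ▸ zero_mem _
    rcases hprime.mem_or_mem this with h | h
    · exact hc' (Ideal.mem_span_singleton.mp h)
    · exact hd' (Ideal.mem_span_singleton.mp h)
  have : Nontrivial R := inferInstance
  exact NoZeroDivisors.to_isDomain R

namespace RingTheory.Sequence

variable {R : Type u} [CommRing R]

/-- For a regular `r`, `Ext^i(N, M/rM)` lies between `Ext^i(N, M)` and `Ext^{i+1}(N, M)`. Each
element of the sequence costs one degree of vanishing. -/
lemma subsingleton_hom_quotient (N : ModuleCat.{u} R) (rs : List R) (M : Type u) [AddCommGroup M]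
    [Module R M]
    (reg : IsWeaklyRegular M rs) (h : ∀ i ≤ rs.length, Subsingleton (Ext N (ModuleCat.of R M) i)) :
    Subsingleton (N →ₗ[R] M ⧸ (Ideal.ofList rs • ⊤ : Submodule R M)) := by
  induction rs generalizing M with
  | nil =>
    have : Subsingleton (N →ₗ[R] M) :=
        (Ext.addEquiv₀.trans ModuleCat.homAddEquiv).symm.subsingleton_congr.mpr
      (h 0 le_rfl)
    have e : (M ⧸ (Ideal.ofList ([] : List R) • ⊤ : Submodule R M)) ≃ₗ[R] M :=
      Submodule.quotEquivOfEqBot _ (by rw [Ideal.ofList_nil, Submodule.bot_smul])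
    exact (LinearEquiv.congrRight (M := N) e).toEquiv.subsingleton
  | cons r rs ih =>
    rw [isWeaklyRegular_cons_iff] at reg
    have := ih (QuotSMulTop r M) reg.2 fun i hi => by
      have zero1 := AddCommGrpCat.isZero_of_iff_subsingleton.mpr (h i (by simp; omega))
      have zero2 := AddCommGrpCat.isZero_of_iff_subsingleton.mpr (h (i + 1) (by simp; omega))
      exact AddCommGrpCat.subsingleton_of_isZero <| ShortComplex.Exact.isZero_of_both_zeros
        ((Ext.covariant_sequence_exact₃' N
            (IsSMulRegular.smulShortComplex_shortExact (M := ModuleCat.of R M) reg.1)) i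
            (i + 1) rfl)
        (zero1.eq_zero_of_src _) (zero2.eq_zero_of_tgt _)
    exact (LinearEquiv.congrRight (M := N)
        (Submodule.quotOfListConsSMulTopEquivQuotSMulTopInner M r rs)).toEquiv.subsingleton

/-- If the local rings at the primes that contain `J` have regular sequences of length `n`, then
every weakly regular sequence of length less than `n` in `J` can be extended. -/
lemma exists_mem_isSMulRegular [IsNoetherianRing R] (J : Ideal R) (rs : List R)
    (reg : IsWeaklyRegular R rs)
    (h : ∀ (P : Ideal R) [P.IsPrime], J ≤ P → ∃ rs' : List (Localization.AtPrime P),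
        rs.length < rs'.length ∧
      (∀ r ∈ rs', r ∈ maximalIdeal (Localization.AtPrime P)) ∧
          IsRegular (Localization.AtPrime P) rs') :
    ∃ a ∈ J, IsSMulRegular (R ⧸ (Ideal.ofList rs • ⊤ : Submodule R R)) a := by
  by_contra hcon
  -- If `J` contains no regular element, there is a nonzero map from `R ⧸ J` to the quotient by
  -- `rs`, and hence an associated prime `P` of that quotient containing `J`. The contradiction
  -- arises in the localization at `P`.
  have hn : ¬ Subsingleton ((R ⧸ J) →ₗ[R] (R ⧸ (Ideal.ofList rs • ⊤ : Submodule R R))) := by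
    rw [IsSMulRegular.subsingleton_linearMap_iff, Ideal.annihilator_quotient]
    exact hcon
  rw [not_subsingleton_iff_nontrivial] at hn
  obtain ⟨φ, hφ⟩ := exists_ne (0 : (R ⧸ J) →ₗ[R] (R ⧸ (Ideal.ofList rs • ⊤ : Submodule R R)))
  have hz : φ 1 ≠ 0 := fun h0 => hφ (Submodule.linearMap_qext _ (LinearMap.ext_ring h0))
  obtain ⟨P, hP, hle⟩ := exists_le_isAssociatedPrime_of_isNoetherianRing R (φ 1) hz
  obtain ⟨hprime, z, hz'⟩ := (isAssociatedPrime_iff).mp hP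
  have hJP : J ≤ P := fun a ha => hle (by
    rw [Submodule.mem_colon_singleton, ← map_smul, Submodule.mem_bot]
    have h1 : a • (1 : R ⧸ J) = 0 := by
      change Ideal.Quotient.mk J (a * 1) = 0
      rw [mul_one]
      exact Ideal.Quotient.eq_zero_iff_mem.mpr ha
    rw [h1, map_zero])
  obtain ⟨rs', hlen, hmem, hreg⟩ := h P hJP
  obtain ⟨c, rfl⟩ := Submodule.Quotient.mk_surjective _ z
  let B := Localization.AtPrime P
  have hB : IsWeaklyRegular B (rs.map (algebraMap R B)) := reg.of_isLocalization B P.primeCompl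
  -- The longer sequence `rs'` makes `Ext^i` from the residue field to `B` vanish for all `i` up to
  -- the length of `rs`. By `subsingleton_hom_quotient` the residue field has no nonzero map to the
  -- quotient of `B` by `rs`.
  have hext := ModuleCat.subsingleton_ext_of_exists_isRegular (maximalIdeal B)
      (ModuleCat.of B (B ⧸ maximalIdeal B))
    (by rw [Module.support_eq_zeroLocus, Ideal.annihilator_quotient]) (ModuleCat.of B B) (by
      rw [smul_eq_mul, Ideal.mul_top]; exact lt_top_iff_ne_top.mpr
          (Ideal.IsPrime.ne_top inferInstance)) rs' hmem hreg
  have hsub := subsingleton_hom_quotient (ModuleCat.of B (B ⧸ maximalIdeal B)) _ B hB fun i hi =>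
    hext i (by rw [List.length_map] at hi; omega)
  have hPc : ∀ a, a ∈ P ↔ a * c ∈ Ideal.ofList rs := by
    intro a
    rw [hz', Submodule.mem_colon_singleton, Submodule.mem_bot, ← Submodule.Quotient.mk_smul,
      Submodule.Quotient.mk_eq_zero, smul_eq_mul, smul_eq_mul, Ideal.mul_top]
  have hmc : ∀ b ∈ maximalIdeal B, b * algebraMap R B c ∈ Ideal.ofList (rs.map (algebraMap R B)) :=
      by
    intro b hb
    rw [← Ideal.map_ofList]
    rw [← Localization.AtPrime.map_eq_maximalIdeal] at hb
    induction hb using Submodule.closure_induction with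
    | zero => simp
    | add x y _ _ hx hy => rw [add_mul]; exact add_mem hx hy
    | smul_mem r x hx =>
      obtain ⟨a, ha, rfl⟩ := hx
      rw [smul_eq_mul, mul_assoc, ← map_mul]
      exact Ideal.mul_mem_left _ _ (Ideal.mem_map_of_mem _ ((hPc a).mp ha))
  let ψ : (B ⧸ maximalIdeal B) →ₗ[B] B ⧸
      (Ideal.ofList (rs.map (algebraMap R B)) • ⊤ : Submodule B B) :=
    Submodule.liftQ _ (LinearMap.toSpanSingleton B _ (Submodule.Quotient.mk (algebraMap R B c))) (by
      intro b hb
      rw [LinearMap.mem_ker, LinearMap.toSpanSingleton_apply, ← Submodule.Quotient.mk_smul,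
        Submodule.Quotient.mk_eq_zero, smul_eq_mul, smul_eq_mul, Ideal.mul_top]
      exact hmc b hb)
  have hψ : ψ 1 = 0 := by rw [Subsingleton.elim (α := _ →ₗ[B] _) ψ 0]; rfl
  have hc : algebraMap R B c ∈ (Ideal.ofList rs).map (algebraMap R B) := by
    have h1 : ψ 1 = (1 : B) • Submodule.Quotient.mk (algebraMap R B c) := rfl
    rwa [h1, one_smul, Submodule.Quotient.mk_eq_zero, smul_eq_mul, Ideal.mul_top,
        ← Ideal.map_ofList] at hψ
  -- The class of `c` vanishes after localization, so some `s` outside `P` kills it, while `P` is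
  -- the annihilator of that class.
  obtain ⟨s, hs⟩ := (IsLocalization.algebraMap_mem_map_algebraMap_iff P.primeCompl B _ _).mp hc
  exact hs.1 ((hPc s).mpr hs.2)

/-- Weakly regular sequences can be extended to the expected length. -/
lemma exists_append_isWeaklyRegular [IsNoetherianRing R] (J : Ideal R) (n : ℕ)
    (h : ∀ (P : Ideal R) [P.IsPrime], J ≤ P → ∃ rs' : List (Localization.AtPrime P),
        n ≤ rs'.length ∧
      (∀ r ∈ rs', r ∈ maximalIdeal (Localization.AtPrime P)) ∧
          IsRegular (Localization.AtPrime P) rs')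
    (rs : List R) (reg : IsWeaklyRegular R rs) (hlen : rs.length ≤ n) :
    ∃ rs₁ : List R, rs.length + rs₁.length = n ∧ (∀ r ∈ rs₁, r ∈ J) ∧
        IsWeaklyRegular R (rs ++ rs₁) := by
  obtain ⟨c, rfl⟩ := Nat.exists_eq_add_of_le hlen
  clear hlen
  induction c generalizing rs with
  | zero => exact ⟨[], by simp, by simp, by simpa using reg⟩
  | succ c ih =>
    obtain ⟨a, ha, hreg⟩ := exists_mem_isSMulRegular J rs reg fun P _ hP => by
      obtain ⟨rs', h1, h2⟩ := h P hP
      exact ⟨rs', by omega, h2⟩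
    have hreg' : IsWeaklyRegular R (rs ++ [a]) :=
      (isWeaklyRegular_append_iff R rs [a]).mpr ⟨reg, (isWeaklyRegular_singleton_iff _ a).mpr hreg⟩
    obtain ⟨rs₁, h1, h2, h3⟩ := ih (rs ++ [a]) hreg' (by
      rw [List.length_append, List.length_singleton, add_assoc, add_comm 1 c]; exact h)
    refine ⟨a :: rs₁, ?_, ?_, ?_⟩
    · rw [List.length_append, List.length_singleton] at h1
      rw [List.length_cons]; omega
    · rintro r hr
      rcases List.mem_cons.mp hr with rfl | hr
      · exact ha
      · exact h2 r hr
    · rwa [List.append_assoc] at h3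

end RingTheory.Sequence

namespace localCohomology

variable {A : Type u} [CommRing A] [IsLocalRing A] [IsNoetherianRing A]

/-- `Ext^i` vanishes below the length of a regular sequence. -/
lemma ExtVanish.of_isWeaklyRegular {rs : List A} (hrs : ∀ r ∈ rs, r ∈ maximalIdeal A)
    (reg : IsWeaklyRegular A rs)
    (M : ModuleCat.{u} A) [Module.Finite A M] [Module.Projective A M] {i : ℕ} (hi : i < rs.length) :
    ExtVanish (maximalIdeal A) i M := by
  intro t
  rcases subsingleton_or_nontrivial M with hM | hM
  · have : Limits.IsZero M := ModuleCat.isZero_of_subsingleton M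
    exact ⟨fun a b =>
        by rw [← Ext.comp_mk₀_id a, ← Ext.comp_mk₀_id b, this.eq_of_src (𝟙 M) 0]; simp⟩
  have hw : IsWeaklyRegular M rs :=
    ((TensorProduct.rid A M).isWeaklyRegular_congr rs).mp reg.isWeaklyRegular_lTensor
  have hreg : IsRegular M rs := .of_isWeaklyRegular_of_mem_maximalIdeal M hrs hw
  have hfin : Module.Finite A (quotPow (maximalIdeal A) t) :=
    inferInstanceAs (Module.Finite A (A ⧸ maximalIdeal A ^ t))
  refine ModuleCat.subsingleton_ext_of_exists_isRegular (maximalIdeal A) _ ?_ M ?_ rs hrs hreg i hi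
  · change Module.support A (A ⧸ maximalIdeal A ^ t) ⊆ _
    rw [Module.support_eq_zeroLocus, Ideal.annihilator_quotient,
        PrimeSpectrum.zeroLocus_subset_zeroLocus_iff]
    exact fun x hx => ⟨t, Ideal.pow_mem_pow hx t⟩
  · exact lt_top_iff_ne_top.mpr (Ne.symm (Submodule.top_ne_ideal_smul_of_le_jacobson_annihilator
      (IsLocalRing.maximalIdeal_le_jacobson _)))

end localCohomology

namespace CartierForms

variable (k : Type u) {R : Type u} [Field k] [PerfectField k] [CommRing R] [IsDomain R]
    [IsNoetherianRing R]
  [Algebra k R] [Algebra.EssFiniteType k R] [Algebra.FormallySmooth k R] (p : ℕ) [Fact p.Prime]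
      [CharP R p]

include k p in
/-- In a smooth domain, a regular element extends to a regular sequence in `J` whose length is
bounded by the height of `J`. -/
lemma exists_isWeaklyRegular_cons {f : R} (hf : f ≠ 0) (J : Ideal R) (n : ℕ)
    (h : ∀ (P : Ideal R) [P.IsPrime], J ≤ P → (n : WithBot ℕ∞) + 1 ≤ ringKrullDim
        (Localization.AtPrime P)) :
    ∃ rs : List R, rs.length = n ∧ (∀ r ∈ rs, r ∈ J) ∧ IsWeaklyRegular R (f :: rs) := by
  have hreg : IsWeaklyRegular R [f] := (isWeaklyRegular_singleton_iff R f).mpr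
      (IsSMulRegular.of_ne_zero hf)
  obtain ⟨rs, h1, h2, h3⟩ := exists_append_isWeaklyRegular J (n + 1) (fun P _ hP => by
    have : CharP (Localization.AtPrime P) p := charP_of_injective_algebraMap
      (IsLocalization.injective _ P.primeCompl_le_nonZeroDivisors) p
    have : IsDomain (Localization.AtPrime P) := inferInstance
    obtain ⟨rs, h1, h2⟩ := exists_isRegular_of_formallySmooth k (B := Localization.AtPrime P) p
    refine ⟨rs, ?_, h2⟩
    have := (h P hP).trans h1
    exact_mod_cast this) [f] hreg (by simp)
  exact ⟨rs, by simpa [add_comm] using h1, h2, h3⟩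

variable (A : Type u) [CommRing A] [Algebra R A]

omit [IsDomain R] [IsNoetherianRing R] in
lemma isWeaklyRegular_map_of_cons {f : R} (hsurj : Function.Surjective (algebraMap R A))
    (hker : RingHom.ker (algebraMap R A) = Ideal.span {f}) {rs : List R}
        (h : IsWeaklyRegular R (f :: rs)) :
    IsWeaklyRegular A (rs.map (algebraMap R A)) := by
  rw [isWeaklyRegular_map_algebraMap_iff]
  have hk : (f • ⊤ : Submodule R R) = LinearMap.ker (Algebra.linearMap R A) := by
    rw [← Submodule.ideal_span_singleton_smul, smul_eq_mul, Ideal.mul_top, ← hker]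
    rfl
  have e : QuotSMulTop f R ≃ₗ[R] A := Submodule.quotEquivOfEq _ _ hk ≪≫ₗ
    (Algebra.linearMap R A).quotKerEquivOfSurjective hsurj
  exact (e.isWeaklyRegular_congr rs).mp ((isWeaklyRegular_cons_iff R f rs).mp h).2

end CartierForms

end

/-! ### Singular points of a hypersurface and the Jacobian criterion. -/

noncomputable section

open TensorProduct

namespace IsLocalRing

variable {B C : Type*} [CommRing B] [IsLocalRing B] [CommRing C] [IsLocalRing C]
  {g : B →+* C} (hg : Function.Surjective g) {f : B} (hker : RingHom.ker g = Ideal.span {f})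

include hg hker

omit [IsLocalRing B] [IsLocalRing C] in
lemma ringKrullDim_succ_le_of_surjective (hf : f ∈ nonZeroDivisors B) :
    ringKrullDim C + 1 ≤ ringKrullDim B := by
  have h := ringKrullDim_quotient_succ_le_of_nonZeroDivisor hf
  rwa [← hker, ringKrullDim_eq_of_ringEquiv (RingHom.quotientKerEquivOfSurjective hg)] at h

/-- A hypersurface whose equation lies in the square of the maximal ideal is not regular. -/
lemma not_isRegularLocalRing_of_mem_sq [IsNoetherianRing B] (hf : f ∈ nonZeroDivisors B)
    (hf2 : f ∈ maximalIdeal B ^ 2) : ¬ IsRegularLocalRing C := by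
  intro hC
  obtain ⟨s, hs, hspan⟩ :=
      (IsNoetherian.noetherian (maximalIdeal C)).exists_span_set_encard_eq_spanFinrank
  have hsfin : s.Finite := Set.finite_of_encard_eq_coe hs
  let t : Set B := Function.surjInv hg '' s
  have hcomap : ∀ b, g b ∈ maximalIdeal C → b ∈ maximalIdeal B := fun b hb hu => hb (hu.map g)
  -- As `f` lies in the square of the maximal ideal, lifts of generators for `C` generate for `B`,
  -- by Nakayama. If `C` were regular, the embedding dimension of `B` would be at most `dim C`,
  -- hence smaller than `dim B`.
  have ht : maximalIdeal B ≤ Submodule.span B t := by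
    refine Submodule.le_of_le_smul_of_le_jacobson_bot (I := maximalIdeal B)
        (IsNoetherian.noetherian _)
      (maximalIdeal_le_jacobson _) ?_
    intro b hb
    have hlocal : IsLocalHom g := hg.isLocalHom
    have hgb : g b ∈ maximalIdeal C := fun hu => hb (isUnit_of_map_unit g b hu)
    have himg : Ideal.map g (Ideal.span t) = maximalIdeal C := by
      rw [Ideal.map_span, ← Set.image_comp, ← hspan]
      congr 1
      have : (g ∘ Function.surjInv hg) = id := funext fun x => Function.surjInv_eq hg x
      rw [this, Set.image_id]
    rw [← himg] at hgb
    obtain ⟨x, hx, hxb⟩ := (Ideal.mem_map_iff_of_surjective g hg).mp hgb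
    have hsub : b - x ∈ Ideal.span {f} := by
      rw [← hker, RingHom.mem_ker, map_sub, hxb, sub_self]
    rw [← add_sub_cancel x b]
    refine Submodule.add_mem_sup hx ?_
    rw [smul_eq_mul, ← pow_two]
    exact (Ideal.span_singleton_le_iff_mem _).mpr hf2 hsub
  have ht' : maximalIdeal B = Submodule.span B t := by
    refine le_antisymm ht (Submodule.span_le.mpr ?_)
    rintro _ ⟨x, hx, rfl⟩
    refine hcomap _ ?_
    rw [Function.surjInv_eq hg, ← hspan]
    exact Submodule.subset_span hx
  have h1 : (maximalIdeal B).spanFinrank ≤ (maximalIdeal C).spanFinrank := by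
    rw [ht']
    refine (Submodule.spanFinrank_span_le_ncard_of_finite (hsfin.image _)).trans
      ((Set.ncard_image_le hsfin).trans ?_)
    rw [Set.ncard, hs]; rfl
  have h2 := (ringKrullDim_succ_le_of_surjective hg hker hf).trans
      (ringKrullDim_le_spanFinrank_maximalIdeal B)
  rw [← hC.spanFinrank_maximalIdeal] at h2
  have h3 : (maximalIdeal C).spanFinrank + 1 ≤ (maximalIdeal B).spanFinrank := by exact_mod_cast h2
  omega

end IsLocalRing

namespace CartierForms

variable (k : Type u) {R : Type u} [Field k] [PerfectField k] [CommRing R]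
  [Algebra k R] [Algebra.FormallySmooth k R]

omit [PerfectField k] in
-- Since the differentials form a projective module, `df` is a linear combination of differentials
-- whose coefficients are values of linear forms on `df`. These values lie in `P` and vanish in the
-- residue field.
lemma one_tmul_D_eq_zero (P : Ideal R) [P.IsPrime] (f : R)
    (h : ∀ φ : Module.Dual R (Ω[R⁄k]), φ (KaehlerDifferential.D k R f) ∈ P) :
    (1 : ResidueField (Localization.AtPrime P)) ⊗ₜ[Localization.AtPrime P]
      KaehlerDifferential.D k (Localization.AtPrime P) (algebraMap R _ f) = 0 := by
  obtain ⟨s, hs⟩ := (Module.projective_def' (R := R) (P := Ω[R⁄k])).mp inferInstance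
  have h1 : KaehlerDifferential.D k (Localization.AtPrime P) (algebraMap R _ f) =
      KaehlerDifferential.map k k R (Localization.AtPrime P) (KaehlerDifferential.D k R f) :=
    (KaehlerDifferential.map_D k k R (Localization.AtPrime P) f).symm
  rw [h1, ← LinearMap.id_apply (R := R) (KaehlerDifferential.D k R f), ← hs, LinearMap.comp_apply,
    Finsupp.linearCombination_apply, Finsupp.sum, map_sum, tmul_sum]
  refine Finset.sum_eq_zero fun w _ => ?_
  have hw := h (Finsupp.lapply w ∘ₗ s)
  rw [map_smul, ← algebraMap_smul (Localization.AtPrime P), tmul_smul, smul_tmul', Algebra.smul_def,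
      mul_one,
    show algebraMap (Localization.AtPrime P) (ResidueField (Localization.AtPrime P)) =
        residue _ from rfl,
    (residue_eq_zero_iff _).mpr, zero_tmul]
  exact (IsLocalization.AtPrime.to_map_mem_maximal_iff _ P _).mpr hw

variable {A : Type u} [CommRing A] [Algebra R A] [IsNoetherianRing R] [Algebra.EssFiniteType k R]

/-- The primes that contain `f` and the coefficients of `D f` correspond to singular points of
the hypersurface `f = 0`. -/
lemma succ_le_ringKrullDim_of_dual_mem {f : R} (hf : f ∈ nonZeroDivisors R)
    (hsurj : Function.Surjective (algebraMap R A))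
    (hker : RingHom.ker (algebraMap R A) = Ideal.span {f}) (c : WithBot ℕ∞)
    (hsing : ∀ (𝔮 : Ideal A) [𝔮.IsPrime], ¬ IsRegularLocalRing (Localization.AtPrime 𝔮) →
      c ≤ ringKrullDim (Localization.AtPrime 𝔮))
    (P : Ideal R) [P.IsPrime] (hfP : f ∈ P)
    (h : ∀ φ : Module.Dual R (Ω[R⁄k]), φ (KaehlerDifferential.D k R f) ∈ P) :
    c + 1 ≤ ringKrullDim (Localization.AtPrime P) := by
  have hkP : RingHom.ker (algebraMap R A) ≤ P := by rwa [hker, Ideal.span_singleton_le_iff_mem]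
  let 𝔮 := P.map (algebraMap R A)
  have h𝔮 : 𝔮.IsPrime := Ideal.map_isPrime_of_surjective hsurj hkP
  have hcomap : 𝔮.comap (algebraMap R A) = P := by
    rw [Ideal.comap_map_of_surjective _ hsurj]
    exact sup_eq_left.mpr hkP
  have hT : Submonoid.map (algebraMap R A) P.primeCompl = 𝔮.primeCompl := by
    ext x
    obtain ⟨y, rfl⟩ := hsurj x
    have hy : algebraMap R A y ∈ 𝔮 ↔ y ∈ P := by rw [← Ideal.mem_comap, hcomap]
    constructor
    · rintro ⟨z, hz, hzy⟩ hmem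
      rw [← hzy] at hmem
      exact hz (hcomap ▸ Ideal.mem_comap.mpr hmem)
    · intro hmem
      exact ⟨y, fun hyP => hmem (hy.mpr hyP), rfl⟩
  let g : Localization.AtPrime P →+* Localization.AtPrime 𝔮 :=
    IsLocalization.map (Localization.AtPrime 𝔮) (algebraMap R A)
        (hT.symm ▸ P.primeCompl.le_comap_map)
  have hg : Function.Surjective g := by
    intro x
    obtain ⟨x, s, rfl⟩ := IsLocalization.exists_mk'_eq 𝔮.primeCompl x
    obtain ⟨y, rfl⟩ := hsurj x
    obtain ⟨t, ht, hts⟩ : (s : A) ∈ Submonoid.map (algebraMap R A) P.primeCompl := hT.symm ▸ s.2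
    refine ⟨IsLocalization.mk' _ y ⟨t, ht⟩, ?_⟩
    rw [IsLocalization.map_mk']
    congr 1
    exact Subtype.ext hts
  have hgker : RingHom.ker g = Ideal.span {algebraMap R (Localization.AtPrime P) f} := by
    rw [IsLocalization.ker_map (S := Localization.AtPrime P) (Localization.AtPrime 𝔮)
        (algebraMap R A) hT, hker,
      Ideal.map_span, Set.image_singleton]
  have hf' : algebraMap R (Localization.AtPrime P) f ∈ nonZeroDivisors (Localization.AtPrime P) :=
    IsLocalization.map_nonZeroDivisors_le P.primeCompl _ ⟨f, hf, rfl⟩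
  -- The differential of `f` vanishes at `P`, so `f` lies in the square of the maximal ideal of
  -- `R_P` and the hypersurface is singular there. The additional 1 is the drop in dimension on
  -- passing to the hypersurface.
  have hsq := mem_maximalIdeal_sq_of_one_tmul_D_eq_zero k
    ((IsLocalization.AtPrime.to_map_mem_maximal_iff (Localization.AtPrime P) P f).mpr hfP)
        (one_tmul_D_eq_zero k P f h)
  exact (add_le_add_left (hsing 𝔮 (not_isRegularLocalRing_of_mem_sq hg hgker hf' hsq)) 1).trans
    (ringKrullDim_succ_le_of_surjective hg hgker hf')

omit [IsNoetherianRing R] [PerfectField k] in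
/-- The differentials of suitable elements form a basis in the local case. -/
lemma exists_basis_differentials [IsLocalRing R] : ∃ (ι : Type u) (_ : Fintype ι) (x : ι → R)
    (b : Module.Basis ι R (Ω[R⁄k])),
    ∀ i, b i = KaehlerDifferential.D k R (x i) := by
  have : Module.FinitePresentation R (Ω[R⁄k]) := Module.finitePresentation_of_projective R _
  obtain ⟨κ, a, b, hb⟩ := Module.exists_basis_of_span_of_flat (KaehlerDifferential.D k R)
    (KaehlerDifferential.span_range_derivation k R)
  have := Module.Finite.finite_basis b
  exact ⟨κ, Fintype.ofFinite κ, a, b, hb⟩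

end CartierForms

end

/-! ### The Koszul complex of `df`. -/

noncomputable section

open TensorProduct RingTheory.Sequence

namespace CartierForms

section Koszul

variable (k : Type u) {R : Type u} [CommRing k] [CommRing R] [Algebra k R]

/-- Contraction of forms with a linear form on one-forms. -/
def contract (φ : Module.Dual R (Ω[R⁄k])) (n : ℕ) : ⋀[R]^(n + 1) (Ω[R⁄k]) →ₗ[R] ⋀[R]^n (Ω[R⁄k]) :=
  (CliffordAlgebra.contractLeft φ).restrict (by
    suffices h : ∀ (n : ℕ) (x : Forms k R), x ∈ ⋀[R]^n (Ω[R⁄k]) → CliffordAlgebra.contractLeft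
        (Q := 0) φ x ∈ ⋀[R]^(n - 1) (Ω[R⁄k]) from
      h (n + 1)
    intro n x hx
    induction hx using Submodule.pow_induction_on_left' with
    | algebraMap r =>
      exact (CliffordAlgebra.contractLeft_algebraMap (0 : QuadraticForm R (Ω[R⁄k])) φ r).symm ▸
          zero_mem _
    | add x y i _ _ hx hy => rw [map_add]; exact add_mem hx hy
    | mem_mul m hm i x hx' hx =>
      obtain ⟨m, rfl⟩ := hm
      have h := CliffordAlgebra.contractLeft_ι_mul (Q := (0 : QuadraticForm R (Ω[R⁄k]))) φ m x
      refine (h.symm ▸ sub_mem (Submodule.smul_mem _ _ hx') ?_ :)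
      cases i with
      | zero =>
        rw [pow_zero] at hx'
        obtain ⟨r, rfl⟩ := Submodule.mem_one.mp hx'
        rw [show CliffordAlgebra.contractLeft (Q := (0 : QuadraticForm R (Ω[R⁄k]))) φ
            (algebraMap R _ r) = 0 from
          CliffordAlgebra.contractLeft_algebraMap _ φ r, mul_zero]
        exact zero_mem _
      | succ i =>
        rw [Nat.succ_sub_one] at hx
        change _ ∈ LinearMap.range (ExteriorAlgebra.ι R) ^ (i + 1)
        rw [pow_succ']
        exact Submodule.mul_mem_mul ⟨_, rfl⟩ hx)

lemma contract_wedgeD_zero (φ : Module.Dual R (Ω[R⁄k])) (f : R) (x : ⋀[R]^0 (Ω[R⁄k])) :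
    contract k φ 0 (wedgeD k R f 0 x) = φ (KaehlerDifferential.D k R f) • x := by
  apply Subtype.ext
  have h := CliffordAlgebra.contractLeft_ι_mul (Q := (0 : QuadraticForm R (Ω[R⁄k]))) φ
      (KaehlerDifferential.D k R f) x.1
  have hx : x.1 ∈ LinearMap.range (ExteriorAlgebra.ι R) ^ 0 := x.2
  rw [pow_zero] at hx
  obtain ⟨r, hr⟩ := Submodule.mem_one.mp hx
  rw [← hr, show CliffordAlgebra.contractLeft (Q := (0 : QuadraticForm R (Ω[R⁄k]))) φ
      (algebraMap R _ r) = 0 from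
    CliffordAlgebra.contractLeft_algebraMap _ φ r, mul_zero, sub_zero, hr] at h
  exact h

/-- Contraction with `φ` is a null-homotopy of multiplication by `φ(df)` on the complex with
differential `df ∧`. -/
lemma contract_wedgeD_succ (φ : Module.Dual R (Ω[R⁄k])) (f : R) (n : ℕ)
    (x : ⋀[R]^(n + 1) (Ω[R⁄k])) :
    contract k φ (n + 1) (wedgeD k R f (n + 1) x) =
      φ (KaehlerDifferential.D k R f) • x - wedgeD k R f n (contract k φ n x) :=
  Subtype.ext (CliffordAlgebra.contractLeft_ι_mul (Q := (0 : QuadraticForm R (Ω[R⁄k]))) φ _ x.1)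

variable {k}

lemma smul_top_map {M N : Type*} [AddCommGroup M] [AddCommGroup N] [Module R M] [Module R N]
    (I : Ideal R) (g : M →ₗ[R] N) {x : M}
    (hx : x ∈ (I • ⊤ : Submodule R M)) : g x ∈ (I • ⊤ : Submodule R N) :=
  (Submodule.map_smul'' I ⊤ g).trans_le (smul_mono_right I le_top) (Submodule.mem_map_of_mem hx)

/-- The ideal generated by the coefficients of `D f` and by `f`. -/
def jacobianIdeal (k : Type u) {R : Type u} [CommRing k] [CommRing R] [Algebra k R] (f : R) :
    Ideal R :=
  LinearMap.range (Module.Dual.eval R (Ω[R⁄k]) (KaehlerDifferential.D k R f)) ⊔ Ideal.span {f}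

lemma self_mem_jacobianIdeal (f : R) : f ∈ jacobianIdeal k f :=
  Submodule.mem_sup_right (Ideal.mem_span_singleton_self f)

lemma dual_mem_jacobianIdeal (f : R) (φ : Module.Dual R (Ω[R⁄k])) :
    φ (KaehlerDifferential.D k R f) ∈ jacobianIdeal k f :=
  Submodule.mem_sup_left ⟨φ, rfl⟩

lemma isSMulRegular_exteriorPower [∀ n, Module.Flat R (⋀[R]^n (Ω[R⁄k]))] {l : List R} {b : R}
    {bs : List R}
    (hreg : IsWeaklyRegular R (l ++ b :: bs)) {n : ℕ} {x : ⋀[R]^n (Ω[R⁄k])}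
    (hx : b • x ∈ (Ideal.ofList l • ⊤ : Submodule R (⋀[R]^n (Ω[R⁄k])))) :
    x ∈ (Ideal.ofList l • ⊤ : Submodule R (⋀[R]^n (Ω[R⁄k]))) := by
  have hw : IsWeaklyRegular (⋀[R]^n (Ω[R⁄k])) (l ++ b :: bs) :=
    ((TensorProduct.rid R (⋀[R]^n (Ω[R⁄k]))).isWeaklyRegular_congr _).mp
        hreg.isWeaklyRegular_lTensor
  have h := ((isWeaklyRegular_cons_iff _ _ _).mp ((isWeaklyRegular_append_iff _ _ _).mp hw).2).1
  rw [← Submodule.Quotient.mk_eq_zero] at hx ⊢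
  exact h.right_eq_zero_of_smul hx

/-- The Koszul complex of `D f` is exact modulo `l` in low degrees. -/
lemma exists_of_wedgeD_mem [∀ n, Module.Flat R (⋀[R]^n (Ω[R⁄k]))] (f : R) (bs : List R)
    (hbs : ∀ b ∈ bs, b ∈ jacobianIdeal k f) (l : List R) (hf : f ∈ l)
    (hreg : IsWeaklyRegular R (l ++ bs)) :
    (∀ x : ⋀[R]^0 (Ω[R⁄k]), 0 < bs.length →
        wedgeD k R f 0 x ∈ (Ideal.ofList l • ⊤ : Submodule R (⋀[R]^1 (Ω[R⁄k]))) →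
      x ∈ (Ideal.ofList l • ⊤ : Submodule R (⋀[R]^0 (Ω[R⁄k])))) ∧
    ∀ (n : ℕ) (x : ⋀[R]^(n + 1) (Ω[R⁄k])), n + 1 < bs.length →
      wedgeD k R f (n + 1) x ∈ (Ideal.ofList l • ⊤ : Submodule R (⋀[R]^(n + 2) (Ω[R⁄k]))) →
      ∃ y : ⋀[R]^n (Ω[R⁄k]),
          x - wedgeD k R f n y ∈ (Ideal.ofList l • ⊤ : Submodule R (⋀[R]^(n + 1) (Ω[R⁄k]))) := by
  induction bs generalizing l with
  | nil => exact ⟨fun x h => absurd h (by simp), fun n x h => absurd h (by simp)⟩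
  | cons b bs ih =>
    obtain ⟨_, ⟨φ, rfl⟩, _, hc, hb⟩ := Submodule.mem_sup.mp (hbs b (by simp))
    obtain ⟨c, rfl⟩ := Ideal.mem_span_singleton'.mp hc
    replace hb : φ (KaehlerDifferential.D k R f) + c * f = b := hb
    have hcf : ∀ (n : ℕ) (x : ⋀[R]^n (Ω[R⁄k])),
        (c * f) • x ∈ (Ideal.ofList l • ⊤ : Submodule R (⋀[R]^n (Ω[R⁄k]))) :=
      fun n x => Submodule.smul_mem_smul (Ideal.mul_mem_left _ _ (Ideal.subset_span hf)) trivial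
    refine ⟨fun x _ hx => isSMulRegular_exteriorPower hreg ?_, fun n x hn hx => ?_⟩
    · rw [← hb, add_smul, ← contract_wedgeD_zero]
      exact add_mem (smul_top_map _ _ hx) (hcf _ _)
    · obtain ⟨ih0, ih1⟩ := ih (fun b hb => hbs b (by simp [hb])) (l ++ [b]) (by simp [hf])
        (by simpa using hreg)
      have hsup : ∀ (n : ℕ) (z : ⋀[R]^n (Ω[R⁄k])),
          z ∈ (Ideal.ofList (l ++ [b]) • ⊤ : Submodule R (⋀[R]^n (Ω[R⁄k]))) ↔
          ∃ w, z - b • w ∈ (Ideal.ofList l • ⊤ : Submodule R (⋀[R]^n (Ω[R⁄k]))) := by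
        intro n z
        rw [Ideal.ofList_append, Ideal.ofList_singleton, Submodule.sup_smul, Submodule.mem_sup]
        constructor
        · rintro ⟨y, hy, z', hz, rfl⟩
          rw [Submodule.ideal_span_singleton_smul] at hz
          obtain ⟨w, -, rfl⟩ := hz
          exact ⟨w, by simpa using hy⟩
        · rintro ⟨w, hw⟩
          exact ⟨_, hw, _, Submodule.smul_mem_smul (Ideal.mem_span_singleton_self b) trivial,
              sub_add_cancel _ _⟩
      -- Because `f` lies in `l`, multiplication by `b` agrees with multiplication by `φ(df)` modulo
      -- `l`. As `df ∧ x` vanishes modulo `l`, the homotopy formula shows that `b x` is `df ∧` the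
      -- contraction of `x`, so the contraction is a cycle modulo `l` and `b`.
      have key : b • x - wedgeD k R f n (contract k φ n x) ∈
          (Ideal.ofList l • ⊤ : Submodule R (⋀[R]^(n + 1) (Ω[R⁄k]))) := by
        rw [← hb, add_smul, add_sub_right_comm, ← contract_wedgeD_succ]
        exact add_mem (smul_top_map _ _ hx) (hcf _ _)
      have hmem : wedgeD k R f n (contract k φ n x) ∈
          (Ideal.ofList (l ++ [b]) • ⊤ : Submodule R (⋀[R]^(n + 1) (Ω[R⁄k]))) := by
        rw [hsup]
        exact ⟨x, by rw [← neg_sub]; exact neg_mem key⟩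
      -- It is enough to write `df ∧` the contraction as `b (df ∧ w)` modulo `l`: then `b (x - df ∧
      -- w)` vanishes modulo `l`, and `b` is regular there. The induction hypothesis for `l, b`
      -- gives the contraction as a boundary plus `b w`, and the boundary disappears under `df ∧`.
      suffices h : ∃ w, wedgeD k R f n (contract k φ n x) - b • wedgeD k R f n w ∈
          (Ideal.ofList l • ⊤ : Submodule R (⋀[R]^(n + 1) (Ω[R⁄k]))) by
        obtain ⟨w, hw⟩ := h
        refine ⟨w, isSMulRegular_exteriorPower hreg ?_⟩
        have := add_mem key hw
        rw [sub_add_sub_cancel] at this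
        exact (smul_sub b x _).symm ▸ this
      cases n with
      | zero =>
        obtain ⟨w, hw⟩ := (hsup _ _).mp (ih0 _ (by simp at hn; omega) hmem)
        refine ⟨w, ?_⟩
        rw [← map_smul (wedgeD k R f 0), ← map_sub]
        exact smul_top_map _ _ hw
      | succ n =>
        obtain ⟨y, hy⟩ := ih1 n _ (by simp at hn; omega) hmem
        obtain ⟨w, hw⟩ := (hsup _ _).mp hy
        refine ⟨w, ?_⟩
        have := smul_top_map _ (wedgeD k R f (n + 1)) hw
        rwa [map_sub, map_sub, wedgeD_wedgeD, sub_zero, map_smul (wedgeD k R f (n + 1))] at this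

end Koszul

end CartierForms

/-! ### Semilinear maps and base change along `R → A`. -/

namespace LinearMap

section Descend

variable {R A E E' N : Type*} [CommRing R] [CommRing A] [Algebra R A] [AddCommGroup E] [Module R E]
  [AddCommGroup E'] [Module R E'] [AddCommGroup N] [Module A N]

/-- A semilinear map factors through a surjective semilinear map. -/
lemma exists_descend {N' : Type*} [AddCommGroup N'] [Module A N']
    (hA : Function.Surjective (algebraMap R A))
    {q : E →ₛₗ[algebraMap R A] N} (hq : Function.Surjective q) (g : E →ₛₗ[algebraMap R A] N')
    (h : ∀ e, q e = 0 → g e = 0) : ∃ g' : N →ₗ[A] N', ∀ e, g' (q e) = g e := by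
  have hs : ∀ e, g (Function.surjInv hq (q e)) = g e := fun e => by
    rw [← sub_eq_zero, ← map_sub]
    exact h _ (by rw [map_sub, Function.surjInv_eq hq, sub_self])
  refine ⟨{ toFun := fun x => g (Function.surjInv hq x), map_add' := ?_, map_smul' := ?_ }, hs⟩
  · intro x y
    obtain ⟨x, rfl⟩ := hq x
    obtain ⟨y, rfl⟩ := hq y
    rw [← map_add, hs, hs, hs, map_add]
  · intro a x
    obtain ⟨a, rfl⟩ := hA a
    obtain ⟨x, rfl⟩ := hq x
    rw [← map_smulₛₗ q, hs, hs, map_smulₛₗ g, RingHom.id_apply]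

variable (R A E) in
/-- The map `e ↦ 1 ⊗ e`. -/
def oneTmul : E →ₛₗ[algebraMap R A] A ⊗[R] E where
  toFun e := 1 ⊗ₜ e
  map_add' _ _ := tmul_add _ _ _
  map_smul' r e := by rw [tmul_smul, algebraMap_smul]

lemma oneTmul_surjective (hA : Function.Surjective (algebraMap R A)) :
    Function.Surjective (oneTmul R A E) := by
  intro x
  induction x using TensorProduct.induction_on with
  | zero => exact ⟨0, map_zero _⟩
  | tmul a e =>
    obtain ⟨r, rfl⟩ := hA a
    exact ⟨r • e, by change 1 ⊗ₜ _ = _; rw [tmul_smul, smul_tmul', Algebra.smul_def, mul_one]⟩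
  | add x y hx hy =>
    obtain ⟨x, rfl⟩ := hx
    obtain ⟨y, rfl⟩ := hy
    exact ⟨x + y, map_add _ _ _⟩

lemma exists_of_oneTmul_eq_zero (hA : Function.Surjective (algebraMap R A)) {f : R}
    (hker : RingHom.ker (algebraMap R A) = Ideal.span {f}) {e : E} (he : oneTmul R A E e = 0) :
        ∃ e', e = f • e' := by
  have h : e ∈ LinearMap.ker (TensorProduct.mk R (R ⧸ RingHom.ker (algebraMap R A)) E 1) := by
    rw [LinearMap.mem_ker]
    let c := (Ideal.quotientKerAlgEquivOfSurjective (f := Algebra.ofId R A) hA)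
    have := congrArg (LinearMap.rTensor E c.symm.toLinearMap) he
    rw [map_zero] at this
    change c.symm 1 ⊗ₜ[R] e = 0 at this
    rwa [map_one] at this
  rw [LinearMap.ker_tensorProductMk, hker, Submodule.ideal_span_singleton_smul] at h
  obtain ⟨e', -, rfl⟩ := h
  exact ⟨e', rfl⟩

lemma oneTmul_smul_eq_zero {f : R} (hf : algebraMap R A f = 0) (e : E) : oneTmul R A E (f • e) =
    0 := by
  rw [map_smulₛₗ, hf, zero_smul]

lemma exists_tensor_descend (hA : Function.Surjective (algebraMap R A)) {f : R}
    (hker : RingHom.ker (algebraMap R A) = Ideal.span {f}) (g : E →ₛₗ[algebraMap R A] N) :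
    ∃ g' : A ⊗[R] E →ₗ[A] N, ∀ e, g' (oneTmul R A E e) = g e := by
  refine exists_descend hA (oneTmul_surjective hA) g fun e he => ?_
  obtain ⟨e, rfl⟩ := exists_of_oneTmul_eq_zero hA hker he
  have : algebraMap R A f = 0 := by
    rw [← RingHom.mem_ker, hker]; exact Ideal.mem_span_singleton_self f
  rw [map_smulₛₗ, this, zero_smul]

end Descend

end LinearMap

end

/-! ### Comparison of rows in local cohomology. -/

noncomputable section

open TensorProduct LinearMap

namespace localCohomology

variable {A : Type u} [CommRing A] (I : Ideal A) {M N : ModuleCat.{u} A}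

lemma map_add_apply {n : ℕ} (F G : M ⟶ N) (y : (localCohomology I n).obj M) :
    (localCohomology I n).map (F + G) y = (localCohomology I n).map F y +
        (localCohomology I n).map G y := by
  obtain ⟨t, α, rfl⟩ := exists_of I y
  rw [map_of, map_of, map_of, Abelian.Ext.mk₀_add, Abelian.Ext.comp_add, map_add]

/-- Homomorphisms in `I • Hom(M, N)` kill the socle. -/
lemma map_eq_zero_of_mem_smul_top {n : ℕ} {y : (localCohomology I n).obj M}
    (hy : ∀ r ∈ I, (localCohomology I n).map (r • 𝟙 M) y = 0) (F : M →ₗ[A] N)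
        (hF : F ∈ (I • ⊤ : Submodule A (M →ₗ[A] N))) :
    (localCohomology I n).map (ModuleCat.ofHom F) y = 0 := by
  induction hF using Submodule.smul_induction_on' with
  | smul r hr G _ =>
    have : ModuleCat.ofHom (r • G) = (r • 𝟙 M) ≫ ModuleCat.ofHom G := by
      rw [Linear.smul_comp, Category.id_comp]; rfl
    rw [this, ← map_map_apply, hy r hr, map_zero]
  | add F _ G _ hF hG =>
    have : ModuleCat.ofHom (F + G) = ModuleCat.ofHom F + ModuleCat.ofHom G := rfl
    rw [this, map_add_apply, hF, hG, add_zero]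

end localCohomology

section Rows

variable {R A : Type u} [CommRing R] [CommRing A] [Algebra R A]
    (hA : Function.Surjective (algebraMap R A)) {f : R}
  (hker : RingHom.ker (algebraMap R A) = Ideal.span {f})
  {E₀ E₁ N₀ N₁ : Type u} [AddCommGroup E₀] [Module R E₀] [AddCommGroup E₁] [Module R E₁]
  [AddCommGroup N₀] [Module A N₀] [AddCommGroup N₁] [Module A N₁]
  {q₀ : E₀ →ₛₗ[algebraMap R A] N₀} (hq₀ : Function.Surjective q₀)
  {q₁ : E₁ →ₛₗ[algebraMap R A] N₁} (hq₁ : Function.Surjective q₁) {w : E₀ →ₗ[R] E₁}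

include hA hker hq₀ hq₁

/-- The reduction modulo `f` of the sequence `E₀ → E₁ → N₁`. -/
lemma exists_exact_row (h₀ : ∀ e, q₀ e = 0 ↔ ∃ e', w e = f • e')
    (h₁ : ∀ e, q₁ e = 0 ↔ ∃ α β, e = f • α + w β) :
    ∃ (i : N₀ →ₗ[A] A ⊗[R] E₁) (r : A ⊗[R] E₁ →ₗ[A] N₁), (∀ e, i (q₀ e) = oneTmul R A E₁ (w e)) ∧
      (∀ e, r (oneTmul R A E₁ e) = q₁ e) ∧ Function.Injective i ∧ Function.Surjective r ∧
          Function.Exact i r := by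
  have hf : algebraMap R A f = 0 := by
    rw [← RingHom.mem_ker, hker]; exact Ideal.mem_span_singleton_self f
  obtain ⟨i, hi⟩ := exists_descend hA hq₀ ((oneTmul R A E₁).comp w) fun e he => by
    obtain ⟨e', he'⟩ := (h₀ e).mp he
    rw [LinearMap.comp_apply, he', oneTmul_smul_eq_zero hf]
  obtain ⟨r, hr⟩ := exists_tensor_descend hA hker q₁
  refine ⟨i, r, hi, hr, ?_, ?_, ?_⟩
  · rw [injective_iff_map_eq_zero]
    intro x hx
    obtain ⟨e, rfl⟩ := hq₀ x
    rw [hi] at hx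
    exact (h₀ e).mpr (exists_of_oneTmul_eq_zero hA hker hx)
  · intro x
    obtain ⟨e, rfl⟩ := hq₁ x
    exact ⟨_, hr e⟩
  · intro x
    obtain ⟨e, rfl⟩ := oneTmul_surjective (E := E₁) hA x
    rw [hr, h₁]
    constructor
    · rintro ⟨α, β, rfl⟩
      refine ⟨q₀ β, ?_⟩
      rw [hi, map_add, oneTmul_smul_eq_zero hf, zero_add]
      rfl
    · rintro ⟨x, hx⟩
      obtain ⟨β, rfl⟩ := hq₀ x
      rw [hi] at hx
      have : oneTmul R A E₁ (e - w β) = 0 := by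
        rw [map_sub, ← hx, sub_eq_zero]; rfl
      obtain ⟨α, hα⟩ := exists_of_oneTmul_eq_zero hA hker this
      exact ⟨α, β, by rw [← hα, sub_add_cancel]⟩

omit hq₀ in
/-- Descent of injectivity of local cohomology along a map of rows. -/
lemma eq_zero_of_row (h₁ : ∀ e, q₁ e = 0 → ∃ α β, e = f • α + w β)
    {i : N₀ →ₗ[A] A ⊗[R] E₁} {r : A ⊗[R] E₁ →ₗ[A] N₁} (hi : ∀ e, i (q₀ e) = oneTmul R A E₁ (w e))
    (hr : ∀ e, r (oneTmul R A E₁ e) = q₁ e) (hinj : Function.Injective i)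
        (hsurj : Function.Surjective r)
    (hex : Function.Exact i r) (hq₀ : Function.Surjective q₀)
    {G₀ G₁ H₀ H₁ : Type u} [AddCommGroup G₀] [Module R G₀] [AddCommGroup G₁] [Module R G₁]
    [AddCommGroup H₀] [Module A H₀] [AddCommGroup H₁] [Module A H₁]
    {g₀ : G₀ →ₛₗ[algebraMap R A] H₀} (hg₀ : Function.Surjective g₀) {g₁ : G₁ →ₛₗ[algebraMap R A] H₁}
    {w' : G₀ →ₗ[R] G₁} (hw' : ∀ x, g₀ x = 0 → ∃ y, w' x = f • y) (hgw : ∀ x, g₁ (w' x) = 0)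
    {C₀ : E₀ →ₗ[R] G₀} {C₁ : E₁ →ₗ[R] G₁} {C₀' : N₀ →ₗ[A] H₀} {C₁' : N₁ →ₗ[A] H₁}
    (hw : ∀ e, w' (C₀ e) = C₁ (w e)) (hC₀ : ∀ e, g₀ (C₀ e) = C₀' (q₀ e))
        (hC₁ : ∀ e, g₁ (C₁ e) = C₁' (q₁ e))
    {I : Ideal A} {n : ℕ} (hv : localCohomology.ExtVanish I n (ModuleCat.of A (A ⊗[R] G₁)))
    (hC : Function.Injective ((localCohomology I n).map (ModuleCat.ofHom C₁')))
    (y : (localCohomology I (n + 1)).obj (ModuleCat.of A N₀))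
    (hy : (localCohomology I (n + 1)).map (ModuleCat.ofHom i) y = 0)
    (hCy : (localCohomology I (n + 1)).map (ModuleCat.ofHom C₀') y = 0) : y = 0 := by
  have hf : algebraMap R A f = 0 := by
    rw [← RingHom.mem_ker, hker]; exact Ideal.mem_span_singleton_self f
  obtain ⟨a, ha⟩ := exists_descend hA hg₀ ((oneTmul R A G₁).comp w') fun e he => by
    obtain ⟨e', he'⟩ := hw' e he
    rw [LinearMap.comp_apply, he', oneTmul_smul_eq_zero hf]
  obtain ⟨ĝ, hĝ⟩ := exists_tensor_descend hA hker g₁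
  obtain ⟨τ₂, hτ₂⟩ := exists_tensor_descend hA hker ((oneTmul R A G₁).comp C₁)
  replace hτ₂ : ∀ e, τ₂ (oneTmul R A E₁ e) = oneTmul R A G₁ (C₁ e) := hτ₂
  replace ha : ∀ e, a (g₀ e) = oneTmul R A G₁ (w' e) := ha
  -- The lower row is replaced by the short exact sequence of `K`, its ambient module and the
  -- quotient, so its own exactness plays no role. It suffices that `C₁'` factors through this
  -- quotient as `v ∘ τ₃`.
  let K := LinearMap.range a
  obtain ⟨τ₃, hτ₃⟩ := exists_descend hA hq₁ ((K.mkQ.comp τ₂).comp (oneTmul R A E₁)) fun e he => by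
    obtain ⟨α, β, rfl⟩ := h₁ e he
    rw [map_add, LinearMap.comp_apply, LinearMap.comp_apply, LinearMap.comp_apply,
        LinearMap.comp_apply, oneTmul_smul_eq_zero hf, map_zero, map_zero, zero_add,
      hτ₂, Submodule.mkQ_apply, Submodule.Quotient.mk_eq_zero]
    exact ⟨g₀ (C₀ β), by rw [ha, hw]⟩
  replace hτ₃ : ∀ e, τ₃ (q₁ e) = K.mkQ (τ₂ (oneTmul R A E₁ e)) := hτ₃
  let v : (A ⊗[R] G₁ ⧸ K) →ₗ[A] H₁ := K.liftQ ĝ (by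
    rintro _ ⟨x, rfl⟩
    obtain ⟨x, rfl⟩ := hg₀ x
    rw [mem_ker, ha, hĝ, hgw])
  let S : ShortComplex (ModuleCat.{u} A) := ShortComplex.mk (ModuleCat.ofHom i) (ModuleCat.ofHom r)
    (by ext x; exact hex.apply_apply_eq_zero x)
  have hS : S.ShortExact :=
    { exact := (ShortComplex.ShortExact.moduleCat_exact_iff_function_exact S).mpr hex
      mono_f := (ModuleCat.mono_iff_injective _).mpr hinj
      epi_g := (ModuleCat.epi_iff_surjective _).mpr hsurj }
  let S' : ShortComplex (ModuleCat.{u} A) := ShortComplex.mk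
    (ModuleCat.ofHom (X := K) K.subtype) (ModuleCat.ofHom (Y := (A ⊗[R] G₁) ⧸ K) K.mkQ)
    (ModuleCat.hom_ext (LinearMap.ext fun x : K => (Submodule.Quotient.mk_eq_zero K).mpr x.2))
  have hS' : S'.ShortExact :=
    { exact := (ShortComplex.ShortExact.moduleCat_exact_iff_function_exact S').mpr
        (LinearMap.exact_subtype_mkQ K)
      mono_f := (ModuleCat.mono_iff_injective _).mpr K.injective_subtype
      epi_g := (ModuleCat.epi_iff_surjective _).mpr K.mkQ_surjective }
  let c : S ⟶ S' :=
    { τ₁ := ModuleCat.ofHom (a.rangeRestrict ∘ₗ C₀')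
      τ₂ := ModuleCat.ofHom τ₂
      τ₃ := ModuleCat.ofHom τ₃
      comm₁₂ := by
        ext x
        obtain ⟨e, rfl⟩ := hq₀ x
        change a (C₀' (q₀ e)) = τ₂ (i (q₀ e))
        rw [hi, hτ₂, ← hC₀, ha, hw]
      comm₂₃ := by
        ext e
        change K.mkQ (τ₂ (oneTmul R A E₁ e)) = τ₃ (r (oneTmul R A E₁ e))
        rw [hr, hτ₃] }
  refine localCohomology.eq_zero_of_connecting hS hS' c hv (G₁ := ModuleCat.of A H₀)
      (G₃ := ModuleCat.of A H₁)
    (ModuleCat.ofHom C₀') (ModuleCat.ofHom a.rangeRestrict) rfl (ModuleCat.ofHom v) ?_ y hy hCy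
  have : c.τ₃ ≫ ModuleCat.ofHom v = ModuleCat.ofHom C₁' := by
    ext x
    obtain ⟨e, rfl⟩ := hq₁ x
    change v (τ₃ (q₁ e)) = C₁' (q₁ e)
    rw [hτ₃, hτ₂]
    change ĝ _ = _
    rw [hĝ, hC₁]
  rwa [this]

end Rows

end

/-! ### Local cohomology of forms on a hypersurface. -/

noncomputable section

open TensorProduct LinearMap RingTheory.Sequence localCohomology

namespace CartierForms

section Smooth

variable (k : Type u) {R A : Type u} [CommRing k] [CommRing R] [CommRing A] [Algebra k R]
    [Algebra k A]
  [Algebra R A] [IsScalarTower k R A] (hA : Function.Surjective (algebraMap R A)) {f : R}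
  (hker : RingHom.ker (algebraMap R A) = Ideal.span {f})

include hA hker

/-- If `D f` is a unimodular element, the differentials of the hypersurface `f =
    0` are projective. -/
lemma projective_kaehlerDifferential_of_dual_eq_one [Module.Projective R (Ω[R⁄k])]
    (φ : Module.Dual R (Ω[R⁄k]))
    (hφ : φ (KaehlerDifferential.D k R f) = 1) : Module.Projective A (Ω[A⁄k]) := by
  have hf : algebraMap R A f = 0 := by
    rw [← RingHom.mem_ker, hker]; exact Ideal.mem_span_singleton_self f
  let π := KaehlerDifferential.mapBaseChange k R A
  have hπ : Function.Surjective π := KaehlerDifferential.mapBaseChange_surjective k R A hA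
  let φ' : A ⊗[R] Ω[R⁄k] →ₗ[A] A := (Algebra.linearMap R A ∘ₗ φ).liftBaseChange A
  let e : A ⊗[R] Ω[R⁄k] := 1 ⊗ₜ KaehlerDifferential.D k R f
  have he : φ' e = 1 := by
    change (1 : A) • algebraMap R A (φ _) = 1
    rw [hφ, map_one, smul_eq_mul, one_mul]
  have hπe : π e = 0 := by
    change KaehlerDifferential.mapBaseChange k R A (1 ⊗ₜ _) = 0
    rw [KaehlerDifferential.mapBaseChange_tmul, KaehlerDifferential.map_D, hf, map_zero, smul_zero]
  -- The kernel of `π` is generated by `e`, and `φ' e = 1`. Thus `s` kills this kernel, and it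
  -- descends to a section of `π`.
  let s : A ⊗[R] Ω[R⁄k] →ₗ[A] A ⊗[R] Ω[R⁄k] := LinearMap.id - φ'.smulRight e
  have hs : ∀ z, s z = z - φ' z • e := fun z => rfl
  have hle : LinearMap.ker π ≤ LinearMap.ker s := by
    intro z hz
    obtain ⟨y, rfl⟩ := (KaehlerDifferential.exact_kerCotangentToTensor_mapBaseChange k R A hA z).mp
        hz
    obtain ⟨⟨y, hy⟩, rfl⟩ := Ideal.toCotangent_surjective _ y
    rw [hker, Ideal.mem_span_singleton'] at hy
    obtain ⟨c, rfl⟩ := hy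
    have : KaehlerDifferential.kerCotangentToTensor k R A (Ideal.toCotangent _ ⟨c * f, hy⟩) =
        algebraMap R A c • e := by
      rw [KaehlerDifferential.kerCotangentToTensor_toCotangent]
      change 1 ⊗ₜ KaehlerDifferential.D k R (c * f) = _
      rw [Derivation.leibniz, tmul_add, tmul_smul, tmul_smul, ← algebraMap_smul A f, hf, zero_smul,
          add_zero,
        ← algebraMap_smul A c]
    rw [this, mem_ker, map_smul, hs, he, one_smul, sub_self, smul_zero]
  refine Module.Projective.of_split
      ((LinearMap.ker π).liftQ s hle ∘ₗ (π.quotKerEquivOfSurjective hπ).symm.toLinearMap) π ?_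
  refine LinearMap.ext fun z => ?_
  obtain ⟨z, rfl⟩ := hπ z
  change π ((LinearMap.ker π).liftQ s hle ((π.quotKerEquivOfSurjective hπ).symm (π z))) = π z
  have : (π.quotKerEquivOfSurjective hπ).symm (π z) = (LinearMap.ker π).mkQ z :=
    (LinearEquiv.symm_apply_eq _).mpr rfl
  rw [this]
  change π (s z) = π z
  rw [hs, map_sub, map_smul, hπe, smul_zero, sub_zero]

end Smooth

section FrobeniusSplitting

variable (k : Type u) {A : Type u} [Field k] [CommRing A] [Algebra k A] (p : ℕ) [Fact p.Prime]
    [CharP A p]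

/-- A Frobenius splitting gives a retraction of `C⁻¹` in degree zero. -/
lemma exists_retraction_inverseCartier_zero (s : FrobPush p A →ₗ[A] A)
    (hs : s (FrobPush.of p A 1) = 1) :
    ∃ r : GForms k A p 0 →ₗ[A] ⋀[A]^0 (Ω[A⁄k]), r ∘ₗ inverseCartier k A p 0 = LinearMap.id := by
  let z := exteriorPower.zeroEquiv A (Ω[A⁄k])
  let z' : FrobPush p (⋀[A]^0 (Ω[A⁄k])) →ₗ[A] FrobPush p A :=
    { toFun := fun x => FrobPush.of p A (z ((FrobPush.of p _).symm x))
      map_add' := fun x y => by rw [map_add, map_add, map_add]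
      map_smul' := fun a x => by
        obtain ⟨x, rfl⟩ := (FrobPush.of p _).surjective x
        rw [FrobPush.smul_of, AddEquiv.symm_apply_apply, AddEquiv.symm_apply_apply, map_smul]
        rfl }
  have hz' : ∀ y, z' (FrobPush.of p _ y) = FrobPush.of p A (z y) := fun _ => rfl
  have hz : ∀ b, z (exteriorPower.ιMulti A 0 b) = 1 := exteriorPower.zeroEquiv_ιMulti
  clear_value z z'
  have hle : boundaries k A p 0 ≤ LinearMap.ker (z.symm.toLinearMap ∘ₗ s ∘ₗ z') :=
    (bot_le : (⊥ : Submodule A (FrobPush p (⋀[A]^0 (Ω[A⁄k])))) ≤ _)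
  refine ⟨(boundaries k A p 0).liftQ (z.symm.toLinearMap ∘ₗ s ∘ₗ z') hle, ?_⟩
  refine LinearMap.ext fun x => ?_
  induction x using exteriorPower_D_induction with
  | smul a b =>
    rw [LinearMap.comp_apply, inverseCartier_apply, Submodule.mkQ_apply, Submodule.liftQ_apply,
        LinearMap.comp_apply,
      LinearMap.comp_apply, hz', map_smul z, hz, ← FrobPush.smul_of, map_smul s, hs,
          LinearEquiv.coe_coe,
      map_smul z.symm, LinearMap.id_apply, ← hz (fun i => KaehlerDifferential.D k A (b i)),
          LinearEquiv.symm_apply_apply]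
  | add x y hx hy => rw [map_add, hx, hy, map_add]

end FrobeniusSplitting

section Rows

variable (k : Type u) {R A : Type u} [CommRing k] [CommRing R] [CommRing A] [Algebra k R]
    [Algebra k A]
  [Algebra R A] [IsScalarTower k R A] (hA : Function.Surjective (algebraMap R A)) {f : R}
  (hker : RingHom.ker (algebraMap R A) = Ideal.span {f})

include hA hker

lemma formsMapDeg_succ_eq_zero_iff (n : ℕ) (x : ⋀[R]^(n + 1) (Ω[R⁄k])) :
    formsMapDeg k R A (n + 1) x = 0 ↔ ∃ α β, x = f • α + wedgeD k R f n β := by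
  have hf : algebraMap R A f = 0 := by
    rw [← RingHom.mem_ker, hker]; exact Ideal.mem_span_singleton_self f
  refine ⟨exists_of_formsMapDeg_succ_eq_zero hA hker, ?_⟩
  rintro ⟨α, β, rfl⟩
  rw [map_add, map_smulₛₗ (formsMapDeg k R A (n + 1)), hf, zero_smul, formsMapDeg_wedgeD hf,
      add_zero]

/-- Injectivity on the left of the row. If `df ∧ x` vanishes modulo `f`, Koszul exactness gives `x =
f α + df ∧ β`, which dies on `A`. The range of `n` is that in which the sequence `bs` from the
Jacobian ideal ensures exactness. -/
lemma formsMapDeg_eq_zero_iff_wedgeD [∀ n, Module.Flat R (⋀[R]^n (Ω[R⁄k]))] {bs : List R}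
    (hbs : ∀ b ∈ bs, b ∈ jacobianIdeal k f)
    (hreg : IsWeaklyRegular R (f :: bs)) {n : ℕ} (hn : n < bs.length) (x : ⋀[R]^n (Ω[R⁄k])) :
    formsMapDeg k R A n x = 0 ↔ ∃ y, wedgeD k R f n x = f • y := by
  have hf : algebraMap R A f = 0 := by
    rw [← RingHom.mem_ker, hker]; exact Ideal.mem_span_singleton_self f
  obtain ⟨h0, h1⟩ := exists_of_wedgeD_mem f bs hbs [f] (by simp) hreg
  have hmem : ∀ (n : ℕ) (z : ⋀[R]^n (Ω[R⁄k])),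
      z ∈ (Ideal.ofList [f] • ⊤ : Submodule R (⋀[R]^n (Ω[R⁄k]))) ↔
      ∃ y, z = f • y := by
    intro n z
    rw [Ideal.ofList_singleton, Submodule.ideal_span_singleton_smul]
    constructor
    · rintro ⟨y, -, rfl⟩
      exact ⟨y, rfl⟩
    · rintro ⟨y, rfl⟩
      exact ⟨y, trivial, rfl⟩
  simp only [hmem] at h0 h1
  cases n with
  | zero =>
    constructor
    · intro h
      obtain ⟨α, rfl⟩ := exists_of_formsMapDeg_zero_eq_zero hA hker h
      exact ⟨_, map_smul (wedgeD k R f 0) _ _⟩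
    · intro h
      obtain ⟨α, rfl⟩ := h0 x hn h
      rw [map_smulₛₗ (formsMapDeg k R A 0), hf, zero_smul]
  | succ n =>
    rw [formsMapDeg_succ_eq_zero_iff k hA hker]
    constructor
    · rintro ⟨α, β, rfl⟩
      exact ⟨wedgeD k R f (n + 1) α,
          by rw [map_add, wedgeD_wedgeD, add_zero, map_smul (wedgeD k R f (n + 1))]⟩
    · intro h
      obtain ⟨y, α, hα⟩ := h1 n x hn h
      exact ⟨α, y, by rw [← hα, sub_add_cancel]⟩

variable [IsLocalRing A] {d : ℕ}
  (hv : ∀ (E : Type u) [AddCommGroup E] [Module R E] [Module.Finite R E] [Module.Projective R E]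
      (i : ℕ), i < d →
    ExtVanish (maximalIdeal A) i (ModuleCat.of A (A ⊗[R] E)))
  [∀ n, Module.Projective R (⋀[R]^n (Ω[R⁄k]))] [∀ n, Module.Finite R (⋀[R]^n (Ω[R⁄k]))]
  {bs : List R} (hbs : ∀ b ∈ bs, b ∈ jacobianIdeal k f) (hreg : IsWeaklyRegular R (f :: bs))

include hv hbs hreg

/-- Local cohomology of the forms on a hypersurface vanishes in low degrees. -/
lemma extVanish_exteriorPower {i j : ℕ} (hj : j ≤ bs.length) (hij : i + j < d) :
    ExtVanish (maximalIdeal A) i (ModuleCat.of A (⋀[A]^j (Ω[A⁄k]))) := by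
  induction j generalizing i with
  | zero =>
    let e : ⋀[A]^0 (Ω[A⁄k]) ≃ₗ[A] A ⊗[R] R := exteriorPower.zeroEquiv A _ ≪≫ₗ
        (AlgebraTensorModule.rid R A A).symm
    exact (hv R i hij).of_retract (ModuleCat.ofHom e.toLinearMap)
        (ModuleCat.ofHom e.symm.toLinearMap)
      (ModuleCat.hom_ext (LinearMap.ext fun x => e.symm_apply_apply x))
  | succ j ih =>
    obtain ⟨ι, r, -, -, hinj, hsurj, hex⟩ :=
        exists_exact_row hA hker (formsMapDeg_surjective k R A hA j)
      (formsMapDeg_surjective k R A hA (j + 1))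
          (formsMapDeg_eq_zero_iff_wedgeD k hA hker hbs hreg hj)
      (formsMapDeg_succ_eq_zero_iff k hA hker j)
    let S : ShortComplex (ModuleCat.{u} A) := ShortComplex.mk (ModuleCat.ofHom ι)
        (ModuleCat.ofHom r)
      (ModuleCat.hom_ext (LinearMap.ext fun x => hex.apply_apply_eq_zero x))
    have hS : S.ShortExact :=
      { exact := (ShortComplex.ShortExact.moduleCat_exact_iff_function_exact S).mpr hex
        mono_f := (ModuleCat.mono_iff_injective _).mpr hinj
        epi_g := (ModuleCat.epi_iff_surjective _).mpr hsurj }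
    -- The index moves from `(i, j+1)` to `(i+1, j)`, which keeps the sum `i + j` below `d`.
    exact ExtVanish.of_shortExact hS (hv _ i (by omega)) (ih (by omega) (by omega))

variable (p : ℕ) [Fact p.Prime] [CharP R p] [CharP A p]
  [∀ n, Module.Projective R (GForms k R p n)] [∀ n, Module.Finite R (GForms k R p n)]

/-- Injectivity of `C⁻¹` descends from `(i, j + 1)` to `(i + 1, j)`. -/
lemma injective_map_inverseCartier_of_succ {i j : ℕ} (hj : j < bs.length) (hij : i + j + 1 = d)
    (hD : KaehlerDifferential.D k R f ∈
        ((maximalIdeal A).comap (algebraMap R A) • ⊤ : Submodule R (Ω[R⁄k])))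
    (hC : Function.Injective
        ((localCohomology (maximalIdeal A) i).map (ModuleCat.ofHom (inverseCartier k A p (j + 1)))))
        :
    Function.Injective
        ((localCohomology (maximalIdeal A) (i + 1)).map
        (ModuleCat.ofHom (inverseCartier k A p j))) := by
  have hf : algebraMap R A f = 0 := by
    rw [← RingHom.mem_ker, hker]; exact Ideal.mem_span_singleton_self f
  obtain ⟨ι, r, hι, hr, hinj, hsurj, hex⟩ :=
      exists_exact_row hA hker (formsMapDeg_surjective k R A hA j)
    (formsMapDeg_surjective k R A hA (j + 1)) (formsMapDeg_eq_zero_iff_wedgeD k hA hker hbs hreg hj)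
    (formsMapDeg_succ_eq_zero_iff k hA hker j)
  have hg : Function.Surjective (gMap k R A p j) := by
    intro x
    obtain ⟨x, rfl⟩ := Submodule.mkQ_surjective _ x
    obtain ⟨y, hy⟩ := formsMapDeg_surjective k R A hA j ((FrobPush.of p _).symm x)
    refine ⟨(boundaries k R p j).mkQ (FrobPush.of p _ y), ?_⟩
    rw [gMap_mkQ, frobMap_of, hy, AddEquiv.apply_symm_apply]
  -- The descent along rows reduces the claim to classes that die in the middle term.
  have key : ∀ y, (localCohomology (maximalIdeal A) (i + 1)).map (ModuleCat.ofHom ι) y = 0 →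
      (localCohomology (maximalIdeal A) (i + 1)).map (ModuleCat.ofHom (inverseCartier k A p j)) y =
          0 → y = 0 :=
    eq_zero_of_row hA hker (formsMapDeg_surjective k R A hA (j + 1))
      (fun e => (formsMapDeg_succ_eq_zero_iff k hA hker j e).mp) hι hr hinj hsurj hex
          (formsMapDeg_surjective k R A hA j)
      hg (fun x => exists_gWedge_eq_smul hA p hker) (gMap_gWedge p hf j)
          (gWedge_inverseCartier k R p f j)
      (gMap_inverseCartier k R A p j) (gMap_inverseCartier k R A p (j + 1)) (hv _ i (by omega)) hC
  rw [injective_iff_map_eq_zero]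
  intro y hy
  cases j with
  -- Here `i + 1 < d`, so the middle term has no cohomology in degree `i + 1`.
  | succ j => exact key y ((hv _ (i + 1) (by omega)).eq_zero _) hy
  | zero =>
    -- Now `i + 1 = d` and the middle term may have cohomology. A nonzero class in the kernel of
    -- `C⁻¹` has a nonzero multiple in the socle, still in the kernel, and `ι` kills it because `df`
    -- has coefficients in the maximal ideal.
    by_contra hne
    obtain ⟨y', hne', hy', hsoc⟩ := exists_socle (maximalIdeal A) _ y hne hy
    refine hne' (key y' (map_eq_zero_of_mem_smul_top (M := ModuleCat.of A (⋀[A]^0 (Ω[A⁄k])))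
      (N := ModuleCat.of A (A ⊗[R] ⋀[R]^1 (Ω[R⁄k]))) _ hsoc ι ?_) hy')
    let T : A ⊗[R] ⋀[R]^1 (Ω[R⁄k]) →ₗ[A] (⋀[A]^0 (Ω[A⁄k]) →ₗ[A] A ⊗[R] ⋀[R]^1 (Ω[R⁄k])) :=
      LinearMap.smulRightₗ (exteriorPower.zeroEquiv A (Ω[A⁄k])).toLinearMap
    have hTapp : ∀ n x, T n x = exteriorPower.zeroEquiv A (Ω[A⁄k]) x • n := fun _ _ => rfl
    -- `ι` is multiplication by `1 ⊗ df`. Written as `T` of that element, it inherits membership in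
    -- the maximal ideal times all homomorphisms.
    have hT : ι =
        T (oneTmul R A _
        ((exteriorPower.oneEquiv R (Ω[R⁄k])).symm (KaehlerDifferential.D k R f))) := by
      refine LinearMap.ext fun x => ?_
      obtain ⟨e, rfl⟩ := formsMapDeg_surjective k R A hA 0 x
      let u : Fin 0 → Ω[R⁄k] := Fin.elim0
      obtain ⟨a, rfl⟩ : ∃ a : R, e = a • exteriorPower.ιMulti R 0 u :=
        ⟨exteriorPower.zeroEquiv R _ e, (exteriorPower.zeroEquiv R _).injective (by
          rw [map_smul (exteriorPower.zeroEquiv R _), exteriorPower.zeroEquiv_ιMulti, smul_eq_mul,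
              mul_one])⟩
      have h1 : (exteriorPower.oneEquiv R (Ω[R⁄k])).symm (KaehlerDifferential.D k R f) =
          wedgeD k R f 0 (exteriorPower.ιMulti R 0 u) := by
        rw [LinearEquiv.symm_apply_eq, wedgeD_ιMulti, exteriorPower.oneEquiv_ιMulti]
        rfl
      have h2 : exteriorPower.zeroEquiv A (Ω[A⁄k])
          (formsMapDeg k R A 0 (exteriorPower.ιMulti R 0 u)) = 1 := by
        rw [formsMap_ιMulti, exteriorPower.zeroEquiv_ιMulti]
      rw [h1, hι, map_smul (wedgeD k R f 0), map_smulₛₗ, map_smulₛₗ (formsMapDeg k R A 0)]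
      rw [hTapp, map_smul, h2, smul_eq_mul, mul_one]
    rw [hT]
    clear hT
    refine smul_top_map (R := A) (M := A ⊗[R] ⋀[R]^1 (Ω[R⁄k]))
        (N := ⋀[A]^0 (Ω[A⁄k]) →ₗ[A] A ⊗[R] ⋀[R]^1 (Ω[R⁄k])) _ T ?_
    generalize KaehlerDifferential.D k R f = v at hD
    induction hD using Submodule.smul_induction_on' with
    | smul a ha w _ =>
      rw [map_smul, map_smulₛₗ]
      exact Submodule.smul_mem_smul ha trivial
    | add x _ y _ hx hy => rw [map_add, map_add]; exact add_mem hx hy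

end Rows

end CartierForms

end

/-! ### Injectivity at a point of the hypersurface. -/

noncomputable section

open TensorProduct LinearMap RingTheory.Sequence localCohomology

namespace CartierForms

section Local

variable (k : Type u) {R A : Type u} [Field k] [PerfectField k] [CommRing R] [IsLocalRing R]
    [IsNoetherianRing R]
  [CommRing A] [IsLocalRing A] [IsDomain A] [Algebra k R] [Algebra k A] [Algebra R A]
      [IsScalarTower k R A]
  [Algebra.EssFiniteType k R] [Algebra.FormallySmooth k R]
  (hA : Function.Surjective (algebraMap R A)) {f : R} (hf : f ∈ nonZeroDivisors R)
  (hker : RingHom.ker (algebraMap R A) = Ideal.span {f})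
  (p : ℕ) [Fact p.Prime] [CharP R p] [CharP A p] {d : ℕ} (hd : ringKrullDim A = d)

include k hA hf hker p hd

omit [IsDomain A] [Algebra k A] [IsScalarTower k R A] [CharP A p] in
-- As `dim R ≥ d + 1`, the equation `f` continues to a regular sequence of `d + 1` elements in `R`;
-- the elements after `f` are regular on `A`.
lemma exists_isWeaklyRegular_of_ringKrullDim_eq [IsDomain R] (hf0 : f ≠ 0) : ∃ rs : List A,
    rs.length = d ∧ (∀ r ∈ rs, r ∈ maximalIdeal A) ∧ IsWeaklyRegular A rs := by
  obtain ⟨rs, h1, h2, h3⟩ := exists_isWeaklyRegular_cons k p hf0 (maximalIdeal R) d fun P _ hP => by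
    obtain rfl : P = maximalIdeal R :=
        (le_maximalIdeal (Ideal.IsPrime.ne_top inferInstance)).antisymm hP
    rw [IsLocalization.AtPrime.ringKrullDim_eq_height (maximalIdeal R),
        maximalIdeal_height_eq_ringKrullDim, ← hd]
    exact ringKrullDim_succ_le_of_surjective hA hker hf
  have hloc : IsLocalHom (algebraMap R A) := hA.isLocalHom
  refine ⟨_, by rw [List.length_map, h1], ?_, isWeaklyRegular_map_of_cons A hA hker h3⟩
  intro a ha
  obtain ⟨r, hr, rfl⟩ := List.mem_map.mp ha
  exact map_nonunit (algebraMap R A) r (h2 r hr)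

/-- Injectivity of the inverse Cartier operator at a point of a hypersurface. -/
theorem injective_map_inverseCartier (hfm : f ∈ maximalIdeal R) {m : ℕ}
    (hsing : ∀ (𝔮 : Ideal A) [𝔮.IsPrime], ¬ IsRegularLocalRing (Localization.AtPrime 𝔮) →
      (m : WithBot ℕ∞) + 2 ≤ ringKrullDim (Localization.AtPrime 𝔮))
    (hC : ∀ i, i + m = d →
      Function.Injective
          ((localCohomology (maximalIdeal A) i).map (ModuleCat.ofHom (inverseCartier k A p m))))
    {i j : ℕ} (hj : j ≤ m) (hij : i + j ≤ d) :
    Function.Injective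
        ((localCohomology (maximalIdeal A) i).map (ModuleCat.ofHom (inverseCartier k A p j))) := by
  have hdom : IsDomain R := isDomain_of_isPrime_span_singleton hf (hker ▸ RingHom.ker_isPrime _)
  have hnoeth : IsNoetherianRing A := isNoetherianRing_of_surjective R A _ hA
  obtain ⟨rs, hlen, hrs, hreg⟩ := exists_isWeaklyRegular_of_ringKrullDim_eq k hA hf hker p hd
      (nonZeroDivisors.ne_zero hf)
  -- If a coefficient of `df` is a unit, the forms on `A` are projective and the bound on the
  -- singular locus is not needed.
  by_cases hunit : ∃ φ : Module.Dual R (Ω[R⁄k]), IsUnit (φ (KaehlerDifferential.D k R f))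
  · obtain ⟨φ, a, ha⟩ := hunit
    have : Module.Projective A (Ω[A⁄k]) := projective_kaehlerDifferential_of_dual_eq_one k hA hker
        ((a⁻¹ : Rˣ).1 • φ)
      (by rw [LinearMap.smul_apply, ← ha, smul_eq_mul, Units.inv_mul])
    have : Algebra.EssFiniteType R A := by
      have := Algebra.FiniteType.of_surjective (Algebra.ofId R A) hA
      infer_instance
    have : Algebra.EssFiniteType k A := Algebra.EssFiniteType.comp k R A
    have : Module.FinitePresentation A (Ω[A⁄k]) := Module.finitePresentation_of_projective A _
    obtain ⟨κ, a, b, hb⟩ := Module.exists_basis_of_span_of_flat (KaehlerDifferential.D k A)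
      (KaehlerDifferential.span_range_derivation k A)
    have : Finite κ := Module.Finite.finite_basis b
    have := Fintype.ofFinite κ
    have : Module.Free A (Ω[A⁄k]) := Module.Free.of_basis b
    rcases hij.lt_or_eq with h | h
    · exact (ExtVanish.of_isWeaklyRegular hrs hreg (ModuleCat.of A (⋀[A]^j (Ω[A⁄k])))
        (by omega)).map_injective _
    · rcases j.eq_zero_or_pos with rfl | hpos
      -- The only pair with possible cohomology is `(d, 0)`, where `C⁻¹` is Frobenius and has a
      -- retraction.
      · obtain ⟨s, hs⟩ := exists_frobenius_splitting k p a b hb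
        obtain ⟨r, hr⟩ := exists_retraction_inverseCartier_zero k p s hs
        refine Function.LeftInverse.injective
            (g := (localCohomology (maximalIdeal A) i).map (ModuleCat.ofHom r)) fun y => ?_
        rw [map_map_apply, ← ModuleCat.ofHom_comp, hr]
        exact congrArg (fun F => F.hom y) ((localCohomology (maximalIdeal A) i).map_id _)
      · exact (ExtVanish.of_isWeaklyRegular hrs hreg (ModuleCat.of A (⋀[A]^j (Ω[A⁄k])))
          (by omega)).map_injective _
  · push Not at hunit
    have hdual : ∀ φ : Module.Dual R (Ω[R⁄k]), φ (KaehlerDifferential.D k R f) ∈ maximalIdeal R :=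
        hunit
    obtain ⟨ι, _, x, b, hb⟩ := exists_basis_differentials k (R := R)
    have hfree : Module.Free R (Ω[R⁄k]) := Module.Free.of_basis b
    have hG := gForms_projective_and_finite k p x b hb
    have := fun n => (hG n).1
    have := fun n => (hG n).2
    -- The point is singular, so the codimension bound applies to it. Consequently `d - m` is a
    -- genuine degree, and `i` is positive in the descending induction.
    have hdm : m + 2 ≤ d := by
      have h := succ_le_ringKrullDim_of_dual_mem k hf hA hker _ hsing (maximalIdeal R) hfm hdual
      rw [IsLocalization.AtPrime.ringKrullDim_eq_height (maximalIdeal R),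
          maximalIdeal_height_eq_ringKrullDim] at h
      have h2 := Ideal.height_le_ringKrullDim_quotient_add_one hfm
      rw [maximalIdeal_height_eq_ringKrullDim, ← hker,
        ringKrullDim_eq_of_ringEquiv (RingHom.quotientKerEquivOfSurjective hA), hd] at h2
      have := h.trans h2
      have : m + 2 + 1 ≤ d + 1 := by exact_mod_cast this
      omega
    -- Every prime containing the Jacobian ideal has height at least `m + 3`; only `m + 1` is
    -- needed, for `f` followed by `m` elements.
    obtain ⟨bs, hbs1, hbs2, hbs3⟩ := exists_isWeaklyRegular_cons k p (nonZeroDivisors.ne_zero hf)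
        (jacobianIdeal k f) m
      fun P _ hP => (add_le_add_left (by exact_mod_cast (show m ≤ m + 2 by omega)) 1).trans
        (succ_le_ringKrullDim_of_dual_mem k hf hA hker _ hsing P (hP (self_mem_jacobianIdeal f))
          fun φ => hP (dual_mem_jacobianIdeal f φ))
    have hv : ∀ (E : Type u) [AddCommGroup E] [Module R E] [Module.Finite R E]
        [Module.Projective R E] (i : ℕ), i < d →
        ExtVanish (maximalIdeal A) i (ModuleCat.of A (A ⊗[R] E)) := fun E _ _ _ _ i hi =>
      ExtVanish.of_isWeaklyRegular hrs hreg (ModuleCat.of A (A ⊗[R] E)) (by omega)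
    rcases hij.lt_or_eq with h | h
    · exact (extVanish_exteriorPower k hA hker hv hbs2 hbs3 (by omega) h).map_injective _
    · have hloc : IsLocalHom (algebraMap R A) := hA.isLocalHom
      have hcomap : (maximalIdeal A).comap (algebraMap R A) = maximalIdeal R :=
        ((IsLocalRing.local_hom_TFAE (algebraMap R A)).out 0 4).mp hloc
      have hD : KaehlerDifferential.D k R f ∈
          ((maximalIdeal A).comap (algebraMap R A) • ⊤ : Submodule R (Ω[R⁄k])) := by
        rw [hcomap, ← b.sum_repr (KaehlerDifferential.D k R f)]
        exact sum_mem fun l _ => Submodule.smul_mem_smul (hdual (b.coord l)) trivial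
      -- Descending induction on `j` along the line `i + j = d`, starting from the assumed case `j =
      -- m`.
      obtain ⟨c, hc⟩ := Nat.exists_eq_add_of_le hj
      clear hj hij
      induction c generalizing i j with
      | zero => exact (add_zero j ▸ hc) ▸ hC i (hc ▸ h)
      | succ c ih =>
        obtain ⟨i, rfl⟩ : ∃ i', i = i' + 1 := ⟨i - 1, by omega⟩
        exact injective_map_inverseCartier_of_succ k hA hker hv hbs2 hbs3 p (by omega) (by omega) hD
          (ih (by omega) (by omega))

end Local

end CartierForms

end

/-! ### From local rings to schemes. -/

noncomputable section

namespace AlgebraicGeometry.Scheme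

/-- The localizations of the local rings of a scheme are its local rings at the generizations. -/
lemma exists_stalk_ringEquiv_localization (D : Scheme.{u}) (x : D) (𝔮 : Ideal (D.presheaf.stalk x))
    [𝔮.IsPrime] :
    ∃ y : D, Nonempty (D.presheaf.stalk y ≃+* Localization.AtPrime 𝔮) := by
  obtain ⟨W, hW, hxW, -⟩ := exists_isAffineOpen_mem_and_subset (x := x) (U := ⊤) trivial
  let _ := (D.presheaf.germ W x hxW).hom.toAlgebra
  have : IsLocalization.AtPrime (D.presheaf.stalk x) (hW.primeIdealOf ⟨x, hxW⟩).asIdeal :=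
      hW.isLocalization_stalk ⟨x, hxW⟩
  -- An iterated localization of the coordinate ring of an affine neighbourhood is its localization
  -- at the contracted prime, that is, the stalk at the corresponding generization.
  let Q := 𝔮.comap (algebraMap Γ(D, W) (D.presheaf.stalk x))
  have : IsLocalization.AtPrime (Localization.AtPrime 𝔮) Q :=
    IsLocalization.isLocalization_isLocalization_atPrime_isLocalization
      (hW.primeIdealOf ⟨x, hxW⟩).asIdeal.primeCompl (Localization.AtPrime 𝔮) 𝔮
  let y : PrimeSpectrum Γ(D, W) := ⟨Q, inferInstance⟩
  have hy : hW.fromSpec y ∈ W := (hW.isoSpec.inv y).2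
  let _ := (D.presheaf.germ W (hW.fromSpec y) hy).hom.toAlgebra
  have : IsLocalization.AtPrime (D.presheaf.stalk (hW.fromSpec y)) Q :=
      hW.isLocalization_stalk' y hy
  exact ⟨hW.fromSpec y, ⟨(IsLocalization.algEquiv Q.primeCompl (D.presheaf.stalk (hW.fromSpec y))
    (Localization.AtPrime 𝔮)).toRingEquiv⟩⟩

end AlgebraicGeometry.Scheme

namespace Hypersurface

lemma le_ringKrullDim_localization_of_le_codim {D : Scheme.{u}} {c : WithBot ℕ∞}
    (h : c ≤ codim D (singularLocus D))
    (x : D) (𝔮 : Ideal (D.presheaf.stalk x)) [𝔮.IsPrime]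
        (hq : ¬ IsRegularLocalRing (Localization.AtPrime 𝔮)) :
    c ≤ ringKrullDim (Localization.AtPrime 𝔮) := by
  obtain ⟨y, ⟨e⟩⟩ := D.exists_stalk_ringEquiv_localization x 𝔮
  rw [← ringKrullDim_eq_of_ringEquiv e]
  exact h.trans (iInf₂_le y fun hy => hq (@IsRegularLocalRing.of_ringEquiv _ _ hy _ _ e))

section

variable {k : Type u} [Field k] {X D : Scheme.{u}} (f : X ⟶ Spec (.of k)) (ι : D ⟶ X)

lemma essFiniteType_and_formallySmooth [Smooth f] (y : X) :
    Algebra.EssFiniteType k (LocalRingAt f y) ∧ Algebra.FormallySmooth k (LocalRingAt f y) := by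
  obtain ⟨V, hV, hyV, -⟩ := exists_isAffineOpen_mem_and_subset (x := y) (U := ⊤) trivial
  have hs : (f.appLE ⊤ V le_top).hom.Smooth := f.smooth_appLE (isAffineOpen_top _) hV _
  have hs' := RingHom.Smooth.respectsIso.2 _
      (Scheme.ΓSpecIso (.of k)).symm.commRingCatIsoToRingEquiv hs
  let _ := (((f.appLE ⊤ V le_top).hom).comp
      (Scheme.ΓSpecIso (.of k)).symm.commRingCatIsoToRingEquiv.toRingHom).toAlgebra
  let _ : Algebra Γ(X, V) (LocalRingAt f y) := (X.presheaf.germ V y hyV).hom.toAlgebra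
  have : Algebra.Smooth k Γ(X, V) := hs'
  have : IsScalarTower k Γ(X, V) (LocalRingAt f y) := .of_algebraMap_eq' (by
    change CommRingCat.Hom.hom
        ((Scheme.ΓSpecIso (.of k)).inv ≫ f.appTop ≫ X.presheaf.germ ⊤ y trivial) =
      CommRingCat.Hom.hom
          (((Scheme.ΓSpecIso (.of k)).inv ≫ f.appLE ⊤ V le_top) ≫ X.presheaf.germ V y hyV)
    have h1 : f.appLE ⊤ V le_top = f.appTop ≫ X.presheaf.map (homOfLE (le_top : V ≤ ⊤)).op := rfl
    have h2 : X.presheaf.map (homOfLE (le_top : V ≤ ⊤)).op ≫ X.presheaf.germ V y hyV =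
        X.presheaf.germ ⊤ y trivial :=
      X.presheaf.germ_res (homOfLE (le_top : V ≤ ⊤)) y hyV
    rw [h1, Category.assoc, Category.assoc, h2])
  have : IsLocalization.AtPrime (LocalRingAt f y) (hV.primeIdealOf ⟨y, hyV⟩).asIdeal :=
      hV.isLocalization_stalk ⟨y, hyV⟩
  have := Algebra.EssFiniteType.of_isLocalization (LocalRingAt f y)
      (hV.primeIdealOf ⟨y, hyV⟩).asIdeal.primeCompl
  have := Algebra.FormallySmooth.of_isLocalization (Rₘ := LocalRingAt f y)
      (hV.primeIdealOf ⟨y, hyV⟩).asIdeal.primeCompl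
  exact ⟨Algebra.EssFiniteType.comp k Γ(X, V) _, Algebra.FormallySmooth.comp k Γ(X, V) _⟩

instance (x : D) : Algebra (LocalRingAt f (ι x)) (LocalRingAt (ι ≫ f) x) :=
    (ι.stalkMap x).hom.toAlgebra

instance (x : D) : IsScalarTower k (LocalRingAt f (ι x)) (LocalRingAt (ι ≫ f) x) :=
    .of_algebraMap_eq' (by
  change CommRingCat.Hom.hom
      ((Scheme.ΓSpecIso (.of k)).inv ≫ (ι ≫ f).appTop ≫ D.presheaf.germ ⊤ x trivial) =
    CommRingCat.Hom.hom
        (((Scheme.ΓSpecIso (.of k)).inv ≫ f.appTop ≫ X.presheaf.germ ⊤ (ι x) trivial) ≫ ι.stalkMap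
        x)
  exact congrArg (fun h => CommRingCat.Hom.hom ((Scheme.ΓSpecIso (.of k)).inv ≫ f.appTop ≫ h))
    (ι.germ_stalkMap ⊤ x trivial).symm)

variable {ι}

/-- Locally, a hypersurface is defined by one equation. -/
lemma IsHypersurface.exists_equation (hD : IsHypersurface ι) (x : D) :
    Function.Surjective (algebraMap (LocalRingAt f (ι x)) (LocalRingAt (ι ≫ f) x)) ∧
    ∃ a ∈ nonZeroDivisors (LocalRingAt f (ι x)), a ∈ maximalIdeal (LocalRingAt f (ι x)) ∧
      RingHom.ker (algebraMap (LocalRingAt f (ι x)) (LocalRingAt (ι ≫ f) x)) = Ideal.span {a} := by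
  have := hD.isClosedImmersion
  refine ⟨ι.stalkMap_surjective x, ?_⟩
  obtain ⟨U, hxU, F, hF, hker⟩ := hD.locally_principal (ι x)
  have hU : IsAffineOpen U.1 := U.2
  rw [Scheme.Hom.ker_apply] at hker
  obtain ⟨hV, hsurj⟩ : IsAffineOpen (ι ⁻¹ᵁ U.1) ∧ Function.Surjective (ι.app U.1) :=
    ⟨(isClosedImmersion_iff_isAffineHom.mp this).1.isAffine_preimage _ hU, ι.app_surjective U.1 hU⟩
  let _ : Algebra Γ(X, U.1) (LocalRingAt f (ι x)) := (X.presheaf.germ U.1 (ι x) hxU).hom.toAlgebra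
  let _ : Algebra Γ(D, ι ⁻¹ᵁ U.1) (LocalRingAt (ι ≫ f) x) :=
      (D.presheaf.germ (ι ⁻¹ᵁ U.1) x hxU).hom.toAlgebra
  have : IsLocalization.AtPrime (LocalRingAt f (ι x)) (hU.primeIdealOf ⟨ι x, hxU⟩).asIdeal :=
      hU.isLocalization_stalk ⟨ι x, hxU⟩
  have : IsLocalization.AtPrime (LocalRingAt (ι ≫ f) x) (hV.primeIdealOf ⟨x, hxU⟩).asIdeal :=
      hV.isLocalization_stalk ⟨x, hxU⟩
  have hcomm : ∀ s, algebraMap (LocalRingAt f (ι x)) (LocalRingAt (ι ≫ f) x)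
      (algebraMap Γ(X, U.1) _ s) =
      algebraMap Γ(D, ι ⁻¹ᵁ U.1) (LocalRingAt (ι ≫ f) x) (ι.app U.1 s) :=
    fun s => Scheme.Hom.germ_stalkMap_apply ι U.1 x hxU s
  have hF0 : ι.app U.1 F = 0 := by
    change F ∈ RingHom.ker (ι.app U.1).hom
    rw [hker]; exact Ideal.mem_span_singleton_self F
  have hloc : IsLocalHom (algebraMap (LocalRingAt f (ι x)) (LocalRingAt (ι ≫ f) x)) :=
    inferInstanceAs (IsLocalHom (ι.stalkMap x).hom)
  have hmem : algebraMap _ (LocalRingAt f (ι x)) F ∈ RingHom.ker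
      (algebraMap (LocalRingAt f (ι x)) (LocalRingAt (ι ≫ f) x)) := by
    rw [RingHom.mem_ker, hcomm, hF0, map_zero]
  refine ⟨algebraMap _ _ F, IsLocalization.map_nonZeroDivisors_le
      (hU.primeIdealOf ⟨ι x, hxU⟩).asIdeal.primeCompl _ ⟨F, hF, rfl⟩,
    fun hu => ?_, le_antisymm ?_ ((Ideal.span_singleton_le_iff_mem _).mpr hmem)⟩
  · have := hu.map (algebraMap (LocalRingAt f (ι x)) (LocalRingAt (ι ≫ f) x))
    rw [RingHom.mem_ker.mp hmem] at this
    exact not_isUnit_zero this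
  · intro z hz
    obtain ⟨s, t, rfl⟩ := IsLocalization.exists_mk'_eq
        (hU.primeIdealOf ⟨ι x, hxU⟩).asIdeal.primeCompl z
    have hz' : algebraMap (LocalRingAt f (ι x)) (LocalRingAt (ι ≫ f) x) (algebraMap Γ(X, U.1) _ s) =
        0 := by
      rw [← IsLocalization.mk'_spec (LocalRingAt f (ι x)) s t, map_mul, RingHom.mem_ker.mp hz,
          zero_mul]
    -- Some `v` outside the prime of `x` kills the image of `s` on `D`. A lift of `v` to `X`
    -- satisfies `v * s ∈ (F)`, and it is a unit in the stalk of `X` because the stalk map is local.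
    rw [hcomm, IsLocalization.map_eq_zero_iff (hV.primeIdealOf ⟨x, hxU⟩).asIdeal.primeCompl] at hz'
    obtain ⟨⟨v, hv⟩, hvs⟩ := hz'
    obtain ⟨v, rfl⟩ := hsurj v
    have hvs' : v * s ∈ Ideal.span {F} := by
      rw [← hker, RingHom.mem_ker, map_mul]; exact hvs
    have hvu : IsUnit (algebraMap _ (LocalRingAt f (ι x)) v) := by
      refine isUnit_of_map_unit (algebraMap (LocalRingAt f (ι x)) (LocalRingAt (ι ≫ f) x)) _ ?_
      rw [hcomm]
      exact IsLocalization.map_units (LocalRingAt (ι ≫ f) x)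
          (⟨_, hv⟩ : (hV.primeIdealOf ⟨x, hxU⟩).asIdeal.primeCompl)
    have hms : algebraMap _ (LocalRingAt f (ι x)) s ∈ Ideal.span
        {algebraMap _ (LocalRingAt f (ι x)) F} := by
      rw [← Ideal.unit_mul_mem_iff_mem _ hvu, ← map_mul, ← Set.image_singleton, ← Ideal.map_span]
      exact Ideal.mem_map_of_mem _ hvs'
    rwa [← Ideal.unit_mul_mem_iff_mem _ (IsLocalization.map_units (LocalRingAt f (ι x)) t),
        IsLocalization.mk'_spec']

variable [PerfectField k] (p : ℕ) [Fact p.Prime] [CharP k p]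

/-- Injectivity of the inverse Cartier operators in degree `m` implies injectivity in lower
degrees. -/
theorem IsHypersurface.cartierInjective [Smooth f] (hD : IsHypersurface ι) (hnormal : IsNormal D)
    {d : ℕ}
    (hd : HasPureDimension D d) {m : ℕ} (hm : (m : WithBot ℕ∞) + 2 ≤ codim D (singularLocus D))
    (hC : ∀ i : ℕ, i + m = d → CartierInjective (ι ≫ f) p i m) {i j : ℕ} (hj : j ≤ m)
        (hij : i + j ≤ d) :
    CartierInjective (ι ≫ f) p i j := by
  intro x hx
  obtain ⟨hA, a, ha, ham, hker⟩ := hD.exists_equation f x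
  obtain ⟨_, _⟩ := essFiniteType_and_formallySmooth f (ι x)
  have : IsNoetherianRing (LocalRingAt f (ι x)) := Algebra.EssFiniteType.isNoetherianRing k _
  have : IsDomain (LocalRingAt (ι ≫ f) x) := (hnormal x).1
  exact CartierForms.injective_map_inverseCartier k hA ha hker p (hd x hx) ham
    (fun 𝔮 h𝔮 h => @le_ringKrullDim_localization_of_le_codim D _ hm x 𝔮 h𝔮 h)
        (fun i hi => hC i hi x hx) hj hij

end

end Hypersurface

end

/-- Condition (∗) is indexed by all `i` with `i + m = d`. For `m > d` there is no such `i`, in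
agreement with the convention that cohomology in negative degrees is zero. -/
theorem theorem1p3 {k : Type u} [Field k] [PerfectField k] (p : ℕ) [Fact p.Prime] [CharP k p]
    {X D : Scheme.{u}} (f : X ⟶ Spec (.of k)) [Smooth f] [IsSeparated f] [QuasiCompact f]
    (ι : D ⟶ X) (hD : Hypersurface.IsHypersurface ι) (hnormal : Hypersurface.IsNormal D)
    (d : ℕ) (hd : Hypersurface.HasPureDimension D d) (m : ℕ) (hm : 0 < m) :
    ((m : WithBot ℕ∞) + 2 ≤ Hypersurface.codim D (Hypersurface.singularLocus D) →
      (∀ i : ℕ, i + m = d → Hypersurface.CartierInjective (ι ≫ f) p i m) →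
      ∀ i j : ℕ, j ≤ m → i + j ≤ d → Hypersurface.CartierInjective (ι ≫ f) p i j) ∧
    (Hypersurface.IsFInjective (ι ≫ f) p d m ↔
      2 * (m : WithBot ℕ∞) + 1 ≤ Hypersurface.codim D (Hypersurface.singularLocus D) ∧
        ∀ i : ℕ, i + m = d → Hypersurface.CartierInjective (ι ≫ f) p i m) := by
  have main : (m : WithBot ℕ∞) + 2 ≤ Hypersurface.codim D (Hypersurface.singularLocus D) →
      (∀ i : ℕ, i + m = d → Hypersurface.CartierInjective (ι ≫ f) p i m) →
      ∀ i j : ℕ, j ≤ m → i + j ≤ d → Hypersurface.CartierInjective (ι ≫ f) p i j :=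
    fun h hC i j hj hij => hD.cartierInjective f p hnormal hd h hC hj hij
  refine ⟨main, fun h => ⟨h.1, fun i hi => h.2 i m le_rfl hi.le⟩, fun h =>
      ⟨h.1, main (le_trans ?_ h.1) h.2⟩⟩
  -- This is where `m > 0` enters.
  exact_mod_cast (show m + 2 ≤ 2 * m + 1 by omega)
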